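/- **Setting.** Sorts are $S ::= \mathsf{nat}\mid\mathsf{int}\mid\mathsf{bool}\mid\mathsf{unit}$, with subsorting $\leq:$ the least reflexive relation with $\mathsf{nat}\leq:\mathsf{int}$. Session types are $T ::= \&_{i\in I}\,p?\ell_i(S_i).T_i \mid \oplus_{i\in I}\,p!\ell_i(S_i).T_i \mid \mathsf{end}\mid \mu t.T\mid t$ with $I\neq\emptyset$, distinct labels and guarded recursion; a singleton choice is written as a prefix, and payloads of sort $\mathsf{unit}$ are omitted. The tree of $T$ is its infinite unfolding. A tree is SO (SI, SISO) if all its selections (branchings, both) are singletons; $[\![\cdot]\!]_{SO}$ (resp. $[\![\cdot]\!]_{SI}$) is the set of trees obtained by keeping exactly one alternative at every selection (resp. branching). On SISO trees $\lesssim$ is the largest relation such that $W_1\lesssim W_2$ only if (i) both are $\mathsf{end}$; or (ii) $W_1=p?\ell(S).W$, $W_2=\mathcal A.p?\ell(S').W'$, $S'\leq: S$, $W\lesssim\mathcal A.W'$, where $\mathcal A$ is a finite sequence of inputs from participants other than $p$; or (iii) $W_1=p!\ell(S).W$, $W_2=\mathcal B.p!\ell(S').W'$, $S\leq: S'$, $W\lesssim\mathcal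 B.W'$, where $\mathcal B$ is a finite sequence of inputs and of outputs to participants other than $p$; if $\mathcal A$ (resp. $\mathcal B$) is nonempty, then $W$ and $\mathcal A.W'$ (resp. $\mathcal B.W'$) must moreover have the same set of actions $q?$, $q!$. Asynchronous subtyping $T\leqslant T'$ means, for the trees of $T$ and $T'$: for all $U\in[\![T]\!]_{SO}$ and $V'\in[\![T']\!]_{SI}$ there are $W\in[\![U]\!]_{SI}$ and $W'\in[\![V']\!]_{SO}$ with $W\lesssim W'$. Processes are $P ::= \sum_{i\in I}p?\ell_i(x_i).P_i \mid p!\ell\langle e\rangle.P\mid \mathsf{if}\ e\ \mathsf{then}\ P\ \mathsf{else}\ Q\mid X\mid\mu X.P\mid \mathbf 0$, with expressions $e$ built from variables and values (integers, booleans, unit) by successor, integer inversion, negation, $e>0$ and $e\approx()$. Sessions $\mathcal M$ are parallel compositions of distinct participants $p$, each with its process and its FIFO output queue ($p\triangleleft P\mid p\triangleleft h$), reducing by asynchronous sends, receptions and conditionals up to structural congruence; they reduce to $\mathsf{error}$ in case of a label mismatch, an orphan message, starvation, a deadlock, or an expression (or condition) that does not evaluate to a value (or boolean). Typing environments $\Gamma$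 map participants to pairs $(\sigma,T)$ of a queue type and a session type; $\Gamma\vdash\mathcal M$ is the standard typing judgement, with subsumption along $\leqslant$ for processes. $\Gamma$ reduces by sends (any alternative of a selection is appended to the sender's queue type) and receptions, up to congruence. A path of such reductions is fair if every enabled send $p{:}q!\ell$ is eventually followed by a send from $p$ to $q$, and every enabled reception is eventually performed; it is live if every message at the head of a queue is eventually received and every pending branching eventually receives a message; $\Gamma$ is live if all fair paths from $\Gamma$ are live. **Protocol.** Fix a sort $S$, distinct participants $\mathsf{bp}_1,\mathsf{bp}_2,\mathsf{src},\mathsf{ctl},\mathsf{sk}$ and distinct labels $d$, $b_1$, $b_2$. Let $$T_{\mathsf{bp}}=\mu t.\,\mathsf{src}?d(S).\,\mathsf{sk}!d(S).\,t,$$ $$T_{\mathsf{src}}=\mu t.\,\&\{\mathsf{ctl}?b_1.\mathsf{ctl}!b_1.\mathsf{bp}_1!d(S).t,\ \ \mathsf{ctl}?b_2.\mathsf{ctl}!b_2.\mathsf{bp}_2!d(S).t\},$$ $$T_{\mathsf{sk}}=\mu t.\,\mathsf{ctl}!b_1.\mathsf{ctl}?b_1.\mathsf{bp}_1?d(S).\mathsf{ctl}!b_2.\mathsf{ctl}?b_2.\mathsf{bp}_2?d(S).t,$$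 $$T_{\mathsf{ctl}}=\mu t.\,\mathsf{src}!b_1.\mathsf{src}?b_1.\mathsf{sk}?b_1.\mathsf{sk}!b_1.\mathsf{src}!b_2.\mathsf{src}?b_2.\mathsf{sk}?b_2.\mathsf{sk}!b_2.t,$$ $$T^*_{\mathsf{ctl}}=\mathsf{src}!b_1.\mathsf{src}!b_2.\mu t.\,\mathsf{src}?b_1.\mathsf{sk}?b_1.\mathsf{sk}!b_1.\mathsf{src}!b_1.\mathsf{src}?b_2.\mathsf{sk}?b_2.\mathsf{sk}!b_2.\mathsf{src}!b_2.t.$$ Let $f(x)$ be an expression of sort $S$ in a variable $x$ of sort $S$, let $\mathit{datum}$ be a closed expression of sort $S$, and let $$P_{\mathsf{bp}}=\mu X.\,\mathsf{src}?d(x).\,\mathsf{sk}!d\langle f(x)\rangle.X,$$ $$P_{\mathsf{src}}=\mu X.\sum\{\mathsf{ctl}?b_1().\mathsf{ctl}!b_1.\mathsf{bp}_1!d\langle\mathit{datum}\rangle.X,\ \ \mathsf{ctl}?b_2().\mathsf{ctl}!b_2.\mathsf{bp}_2!d\langle\mathit{datum}\rangle.X\},$$ $$P_{\mathsf{ctl}}=\mathsf{src}!b_1.\mathsf{src}!b_2.\mu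 X.\,\mathsf{src}?b_1().\mathsf{sk}?b_1().\mathsf{sk}!b_1.\mathsf{src}!b_1.\mathsf{src}?b_2().\mathsf{sk}?b_2().\mathsf{sk}!b_2.\mathsf{src}!b_2.X,$$ $$P_{\mathsf{sk}}=\mu X.\,\mathsf{ctl}!b_1.\mathsf{ctl}?b_1().\mathsf{bp}_1?d(y_1).\mathsf{ctl}!b_2.\mathsf{ctl}?b_2().\mathsf{bp}_2?d(y_2).X.$$ Let $\Gamma=\mathsf{bp}_1{:}(\epsilon,T_{\mathsf{bp}}),\mathsf{bp}_2{:}(\epsilon,T_{\mathsf{bp}}),\mathsf{src}{:}(\epsilon,T_{\mathsf{src}}),\mathsf{ctl}{:}(\epsilon,T_{\mathsf{ctl}}),\mathsf{sk}{:}(\epsilon,T_{\mathsf{sk}})$, and let $\mathcal M$ be the parallel composition of $\mathsf{bp}_1$ and $\mathsf{bp}_2$ with process $P_{\mathsf{bp}}$, $\mathsf{src}$ with $P_{\mathsf{src}}$, $\mathsf{ctl}$ with $P_{\mathsf{ctl}}$ and $\mathsf{sk}$ with $P_{\mathsf{sk}}$, all with empty queues. **Proposition.** (1) $T^*_{\mathsf{ctl}}\leqslant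 T_{\mathsf{ctl}}$. (2) $\Gamma$ is live, $\Gamma\vdash\mathcal M$, and $\mathcal M$ never reduces to $\mathsf{error}$, i.e. not $\mathcal M\longrightarrow^*\mathsf{error}$. -/

import Mathlib

namespace AsyncMPST

/-! ## Names, sorts, values and expressions -/

/-- Participant names: the five parties of the batch-processing protocol and infinitely many
others. -/
inductive Participant where
  | bp1 | bp2 | src | ctl | sk
  | other (n : ℕ)
  deriving DecidableEq

/-- Message labels: the three labels of the protocol and infinitely many others. -/
inductive Label where
  | data | b1 | b2
  | other (n : ℕ)
  deriving DecidableEq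

inductive Srt where
  | nat | int | bool | unit

/-- Subsorting: the least reflexive relation with `nat` below `int`. -/
inductive Srt.Le : Srt → Srt → Prop
  | refl (S : Srt) : Srt.Le S S
  | natInt : Srt.Le .nat .int

/-- Values: integers (positive, zero or negative), booleans, unit. -/
inductive Val where
  | int (i : ℤ)
  | bool (b : Bool)
  | unit

/-- Expressions, with de Bruijn indices for variables. `gtz e` is `e > 0` and `isUnit e` is
`e ≈ ()`. -/
inductive Expr where
  | var (x : ℕ)
  | val (v : Val)
  | succ (e : Expr)
  | inv (e : Expr)
  | neg (e : Expr)
  | gtz (e : Expr)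
  | isUnit (e : Expr)

def Expr.rename (ρ : ℕ → ℕ) : Expr → Expr
  | .var x => .var (ρ x)
  | .val v => .val v
  | .succ e => .succ (e.rename ρ)
  | .inv e => .inv (e.rename ρ)
  | .neg e => .neg (e.rename ρ)
  | .gtz e => .gtz (e.rename ρ)
  | .isUnit e => .isUnit (e.rename ρ)

def Expr.subst (σ : ℕ → Expr) : Expr → Expr
  | .var x => σ x
  | .val v => .val v
  | .succ e => .succ (e.subst σ)
  | .inv e => .inv (e.subst σ)
  | .neg e => .neg (e.subst σ)
  | .gtz e => .gtz (e.subst σ)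
  | .isUnit e => .isUnit (e.subst σ)

/-- Evaluation contexts (there is none for `≈`). -/
inductive ECtx where
  | hole
  | succ (E : ECtx)
  | inv (E : ECtx)
  | neg (E : ECtx)
  | gtz (E : ECtx)

def ECtx.fill : ECtx → Expr → Expr
  | .hole, e => e
  | .succ E, e => .succ (E.fill e)
  | .inv E, e => .inv (E.fill e)
  | .neg E, e => .neg (E.fill e)
  | .gtz E, e => .gtz (E.fill e)

/-- `Eval e v`: the expression `e` evaluates to the value `v`. The successor is defined on
positive integers only. -/
inductive Eval : Expr → Val → Prop
  | val (v : Val) : Eval (.val v) v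
  | succ (n : ℤ) : 0 < n → Eval (.succ (.val (.int n))) (.int (n + 1))
  | inv (i : ℤ) : Eval (.inv (.val (.int i))) (.int (-i))
  | neg (b : Bool) : Eval (.neg (.val (.bool b))) (.bool (!b))
  | isUnit : Eval (.isUnit (.val .unit)) (.bool true)
  | gtzTrue (e : Expr) (n : ℤ) : 0 < n → Eval e (.int n) → Eval (.gtz e) (.bool true)
  | gtzFalse (e : Expr) (n : ℤ) : n ≤ 0 → Eval e (.int n) → Eval (.gtz e) (.bool false)
  | ctx (E : ECtx) (e : Expr) (v v' : Val) :
      Eval e v → Eval (E.fill (.val v)) v' → Eval (E.fill e) v'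

/-! ## Renamings and substitutions under a binder -/

/-- Extension of a renaming under one binder. -/
def upRen (ρ : ℕ → ℕ) : ℕ → ℕ
  | 0 => 0
  | n + 1 => ρ n + 1

/-! ## Processes -/

/-- Processes. `ext q I P` is the external choice over the messages from `q` with label in `I`;
it binds one expression variable in every branch. `mu` binds one process variable. Both kinds of
variables are de Bruijn indices. -/
inductive Proc where
  | ext (q : Participant) (I : Finset Label) (P : I → Proc)
  | out (q : Participant) (ℓ : Label) (e : Expr) (P : Proc)
  | cond (e : Expr) (P Q : Proc)
  | var (X : ℕ)
  | mu (P : Proc)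
  | nil

/-- An external choice with one branch. -/
def Proc.ext1 (q : Participant) (ℓ : Label) (P : Proc) : Proc :=
  .ext q {ℓ} (fun _ => P)

/-- Renaming of expression variables. -/
def Proc.renE : (ℕ → ℕ) → Proc → Proc
  | ρ, .ext q I P => .ext q I (fun i => (P i).renE (upRen ρ))
  | ρ, .out q ℓ e P => .out q ℓ (e.rename ρ) (P.renE ρ)
  | ρ, .cond e P Q => .cond (e.rename ρ) (P.renE ρ) (Q.renE ρ)
  | _, .var X => .var X
  | ρ, .mu P => .mu (P.renE ρ)
  | _, .nil => .nil

/-- Extension of a substitution of expressions under one binder. -/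
def upExpr (σ : ℕ → Expr) : ℕ → Expr
  | 0 => .var 0
  | n + 1 => (σ n).rename Nat.succ

/-- Substitution of expressions for expression variables. -/
def Proc.substE : (ℕ → Expr) → Proc → Proc
  | σ, .ext q I P => .ext q I (fun i => (P i).substE (upExpr σ))
  | σ, .out q ℓ e P => .out q ℓ (e.subst σ) (P.substE σ)
  | σ, .cond e P Q => .cond (e.subst σ) (P.substE σ) (Q.substE σ)
  | _, .var X => .var X
  | σ, .mu P => .mu (P.substE σ)
  | _, .nil => .nil

/-- `P.instE v` is `P` with the value `v` for its expression variable `0`. -/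
def Proc.instE (P : Proc) (v : Val) : Proc :=
  P.substE (fun n => match n with
    | 0 => .val v
    | n + 1 => .var n)

/-- Renaming of process variables. -/
def Proc.renP : (ℕ → ℕ) → Proc → Proc
  | ρ, .ext q I P => .ext q I (fun i => (P i).renP ρ)
  | ρ, .out q ℓ e P => .out q ℓ e (P.renP ρ)
  | ρ, .cond e P Q => .cond e (P.renP ρ) (Q.renP ρ)
  | ρ, .var X => .var (ρ X)
  | ρ, .mu P => .mu (P.renP (upRen ρ))
  | _, .nil => .nil

/-- Extension of a substitution of processes under one process binder. -/
def upProc (σ : ℕ → Proc) : ℕ → Proc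
  | 0 => .var 0
  | n + 1 => (σ n).renP Nat.succ

/-- Capture-avoiding substitution of processes for process variables. -/
def Proc.substP : (ℕ → Proc) → Proc → Proc
  | σ, .ext q I P => .ext q I (fun i => (P i).substP (fun n => (σ n).renE Nat.succ))
  | σ, .out q ℓ e P => .out q ℓ e (P.substP σ)
  | σ, .cond e P Q => .cond e (P.substP σ) (Q.substP σ)
  | σ, .var X => σ X
  | σ, .mu P => .mu (P.substP (upProc σ))
  | _, .nil => .nil

/-- `P.instP Q` is `P` with the process `Q` for its process variable `0`. -/
def Proc.instP (P Q : Proc) : Proc :=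
  P.substP (fun n => match n with
    | 0 => Q
    | n + 1 => .var n)

/-- The process variable `X` does not occur in `P` outside all external choices and outputs. -/
def Proc.GuardedVar : ℕ → Proc → Prop
  | _, .ext _ _ _ => True
  | _, .out _ _ _ _ => True
  | X, .cond _ P Q => P.GuardedVar X ∧ Q.GuardedVar X
  | X, .var Y => Y ≠ X
  | X, .mu P => P.GuardedVar (X + 1)
  | _, .nil => True

/-- Input and output actions: `recv p` is `p?` and `send p` is `p!`. -/
inductive Action where
  | recv (p : Participant)
  | send (p : Participant)

/-- The set of input and output actions of a process. -/
def Proc.actions : Proc → Set Action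
  | .ext q _ P => {.recv q} ∪ ⋃ i, (P i).actions
  | .out q _ _ P => {.send q} ∪ P.actions
  | .cond _ P Q => P.actions ∪ Q.actions
  | .var _ => ∅
  | .mu P => P.actions
  | .nil => ∅

/-- Structural congruence of processes: the least congruence that contains the unfolding of
recursion. -/
inductive Proc.Cong : Proc → Proc → Prop
  | refl (P : Proc) : Proc.Cong P P
  | symm {P Q : Proc} : Proc.Cong P Q → Proc.Cong Q P
  | trans {P Q R : Proc} : Proc.Cong P Q → Proc.Cong Q R → Proc.Cong P R
  | unfold (P : Proc) : Proc.Cong (.mu P) (P.instP (.mu P))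
  | ext (q : Participant) (I : Finset Label) {P Q : I → Proc} :
      (∀ i, Proc.Cong (P i) (Q i)) → Proc.Cong (.ext q I P) (.ext q I Q)
  | out (q : Participant) (ℓ : Label) (e : Expr) {P Q : Proc} :
      Proc.Cong P Q → Proc.Cong (.out q ℓ e P) (.out q ℓ e Q)
  | cond (e : Expr) {P P' Q Q' : Proc} :
      Proc.Cong P P' → Proc.Cong Q Q' → Proc.Cong (.cond e P Q) (.cond e P' Q')
  | mu {P Q : Proc} : Proc.Cong P Q → Proc.Cong (.mu P) (.mu Q)

/-! ## Queues -/

/-- Exchange of two adjacent messages with different recipients. -/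
inductive SwapStep {α : Type} : List (Participant × α) → List (Participant × α) → Prop
  | swap (h₁ h₂ : List (Participant × α)) (m₁ m₂ : Participant × α) : m₁.1 ≠ m₂.1 →
      SwapStep (h₁ ++ m₁ :: m₂ :: h₂) (h₁ ++ m₂ :: m₁ :: h₂)

/-- Structural congruence of queues and of queue types. Both are lists, so that concatenation is
associative with the empty queue as its unit. -/
def QCong {α : Type} : List (Participant × α) → List (Participant × α) → Prop :=
  Relation.EqvGen SwapStep

/-- The output queue of a participant: a message is its recipient, its label and its value. -/
abbrev Queue := List (Participant × Label × Val)

/-- The queue has a message to `p` that `p` can consume next. -/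
def Queue.HasMsg (h : Queue) (p : Participant) : Prop :=
  ∃ (ℓ : Label) (v : Val) (h' : Queue), QCong h ((p, ℓ, v) :: h')

/-! ## Sessions -/

/-- Sessions: `part p P h` is the participant `p` with its process `P` and output queue `h`. -/
inductive Sess where
  | part (p : Participant) (P : Proc) (h : Queue)
  | par (M N : Sess)
  | error

/-- The individual participants of a session, from left to right. -/
def Sess.comps : Sess → List (Participant × Proc × Queue)
  | .part p P h => [(p, P, h)]
  | .par M N => M.comps ++ N.comps
  | .error => []

def Sess.NoError : Sess → Prop
  | .part _ _ _ => True
  | .par M N => M.NoError ∧ N.NoError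
  | .error => False

/-- The participants of a session are pairwise distinct. -/
def Sess.WF (M : Sess) : Prop := (M.comps.map Prod.fst).Nodup

/-- The rules of structural congruence of sessions, inside any parallel composition. -/
inductive Sess.CongStep : Sess → Sess → Prop
  | unit (p : Participant) (M : Sess) : Sess.CongStep (.par (.part p .nil []) M) M
  | comm (M N : Sess) : Sess.CongStep (.par M N) (.par N M)
  | assoc (M₁ M₂ M₃ : Sess) :
      Sess.CongStep (.par (.par M₁ M₂) M₃) (.par M₁ (.par M₂ M₃))
  | part (p : Participant) {P Q : Proc} {h₁ h₂ : Queue} : P.Cong Q → QCong h₁ h₂ →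
      Sess.CongStep (.part p P h₁) (.part p Q h₂)
  | par {M M' : Sess} (N : Sess) : Sess.CongStep M M' → Sess.CongStep (.par M N) (.par M' N)

/-- Structural congruence, on sessions with pairwise distinct participants (so the inactive
participant that the unit law adds is a new one). -/
def Sess.Cong : Sess → Sess → Prop :=
  Relation.EqvGen (fun M N => M.WF ∧ N.WF ∧ Sess.CongStep M N)

/-- The reduction relation of sessions, with the error reductions. -/
inductive Sess.Red : Sess → Sess → Prop
  | send (p q : Participant) (ℓ : Label) (e : Expr) (v : Val) (P : Proc) (h : Queue) (M : Sess) :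
      Eval e v →
      Sess.Red (.par (.part p (.out q ℓ e P) h) M) (.par (.part p P (h ++ [(q, ℓ, v)])) M)
  | rcv (p q : Participant) (I : Finset Label) (P : I → Proc) (Q : Proc) (k : I) (v : Val)
      (hp h : Queue) (M : Sess) :
      Sess.Red
        (.par (.part p (.ext q I P) hp) (.par (.part q Q ((p, k.1, v) :: h)) M))
        (.par (.part p ((P k).instE v) hp) (.par (.part q Q h) M))
  | condT (p : Participant) (e : Expr) (P Q : Proc) (h : Queue) (M : Sess) :
      Eval e (.bool true) →
      Sess.Red (.par (.part p (.cond e P Q) h) M) (.par (.part p P h) M)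
  | condF (p : Participant) (e : Expr) (P Q : Proc) (h : Queue) (M : Sess) :
      Eval e (.bool false) →
      Sess.Red (.par (.part p (.cond e P Q) h) M) (.par (.part p Q h) M)
  | struct {M₁ M₁' M₂' M₂ : Sess} : M₁.Cong M₁' → Sess.Red M₁' M₂' → M₂'.Cong M₂ →
      Sess.Red M₁ M₂
  | errMism (p q : Participant) (I : Finset Label) (P : I → Proc) (Q : Proc) (ℓ : Label) (v : Val)
      (hp h : Queue) (M : Sess) : ℓ ∉ I →
      Sess.Red (.par (.part p (.ext q I P) hp) (.par (.part q Q ((p, ℓ, v) :: h)) M)) .error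
  | errOphn (p q : Participant) (P Q : Proc) (ℓ : Label) (v : Val) (hp h : Queue) (M : Sess) :
      Action.recv q ∉ P.actions →
      Sess.Red (.par (.part p P hp) (.par (.part q Q ((p, ℓ, v) :: h)) M)) .error
  | errStrv (p q : Participant) (I : Finset Label) (P : I → Proc) (Q : Proc) (hp hq : Queue)
      (M : Sess) : Action.send p ∉ Q.actions → ¬ hq.HasMsg p →
      Sess.Red (.par (.part p (.ext q I P) hp) (.par (.part q Q hq) M)) .error
  | errEval (p : Participant) (e : Expr) (P Q : Proc) (h : Queue) (M : Sess) :
      ¬ Eval e (.bool true) → ¬ Eval e (.bool false) →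
      Sess.Red (.par (.part p (.cond e P Q) h) M) .error
  | errEval2 (p q : Participant) (ℓ : Label) (e : Expr) (P : Proc) (h : Queue) (M : Sess) :
      (¬ ∃ v, Eval e v) →
      Sess.Red (.par (.part p (.out q ℓ e P) h) M) .error
  | errDlock (M : Sess) : M.NoError →
      (∀ c ∈ M.comps, (∃ q I P, c.2.1 = .ext q I P) ∨ c.2.1 = .nil) →
      (∃ c ∈ M.comps, ∃ q I P, c.2.1 = .ext q I P) →
      (∀ c ∈ M.comps, (∃ q I P, c.2.1 = .ext q I P) →
        ∀ c' ∈ M.comps, ¬ Queue.HasMsg c'.2.2 c.1) →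
      Sess.Red M .error

/-! ## Session types -/

/-- Session types, with de Bruijn indices for recursion variables. In `ext p I hI S T` (external
choice) and `int p I hI S T` (internal choice) the nonempty index set `I` is the set of labels
itself, so that labels are pairwise distinct. -/
inductive Ty where
  | ext (p : Participant) (I : Finset Label) (hI : I.Nonempty) (S : I → Srt) (T : I → Ty)
  | int (p : Participant) (I : Finset Label) (hI : I.Nonempty) (S : I → Srt) (T : I → Ty)
  | done
  | mu (T : Ty)
  | var (t : ℕ)

/-- An input with a single label. -/
def Ty.inp1 (p : Participant) (ℓ : Label) (S : Srt) (T : Ty) : Ty :=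
  .ext p {ℓ} (Finset.singleton_nonempty ℓ) (fun _ => S) (fun _ => T)

/-- An output with a single label. -/
def Ty.out1 (p : Participant) (ℓ : Label) (S : Srt) (T : Ty) : Ty :=
  .int p {ℓ} (Finset.singleton_nonempty ℓ) (fun _ => S) (fun _ => T)

def Ty.rename : (ℕ → ℕ) → Ty → Ty
  | ρ, .ext p I hI S T => .ext p I hI S (fun i => (T i).rename ρ)
  | ρ, .int p I hI S T => .int p I hI S (fun i => (T i).rename ρ)
  | _, .done => .done
  | ρ, .mu T => .mu (T.rename (upRen ρ))
  | ρ, .var t => .var (ρ t)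

/-- Extension of a substitution of types under one binder. -/
def upTy (σ : ℕ → Ty) : ℕ → Ty
  | 0 => .var 0
  | n + 1 => (σ n).rename Nat.succ

def Ty.subst : (ℕ → Ty) → Ty → Ty
  | σ, .ext p I hI S T => .ext p I hI S (fun i => (T i).subst σ)
  | σ, .int p I hI S T => .int p I hI S (fun i => (T i).subst σ)
  | _, .done => .done
  | σ, .mu T => .mu (T.subst (upTy σ))
  | σ, .var t => σ t

/-- `T.inst U` is `T` with the type `U` for its recursion variable `0`. -/
def Ty.inst (T U : Ty) : Ty :=
  T.subst (fun n => match n with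
    | 0 => U
    | n + 1 => .var n)

/-- All free recursion variables are below `n`. -/
def Ty.ClosedAt : ℕ → Ty → Prop
  | n, .ext _ _ _ _ T => ∀ i, (T i).ClosedAt n
  | n, .int _ _ _ _ T => ∀ i, (T i).ClosedAt n
  | _, .done => True
  | n, .mu T => T.ClosedAt (n + 1)
  | n, .var t => t < n

/-- Guarded recursion: the body of a recursive type is never a recursion variable. -/
def Ty.Guarded : Ty → Prop
  | .ext _ _ _ _ T => ∀ i, (T i).Guarded
  | .int _ _ _ _ T => ∀ i, (T i).Guarded
  | .done => True
  | .mu T => (∀ t, T ≠ .var t) ∧ T.Guarded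
  | .var _ => True

/-- Well-formed session types: closed, with guarded recursion. -/
def Ty.WF (T : Ty) : Prop := T.ClosedAt 0 ∧ T.Guarded

/-- Structural congruence of types: the least congruence that contains the unfolding of
recursion. -/
inductive Ty.Cong : Ty → Ty → Prop
  | refl (T : Ty) : Ty.Cong T T
  | symm {T U : Ty} : Ty.Cong T U → Ty.Cong U T
  | trans {T U V : Ty} : Ty.Cong T U → Ty.Cong U V → Ty.Cong T V
  | unfold (T : Ty) : Ty.Cong (.mu T) (T.inst (.mu T))
  | ext (p : Participant) (I : Finset Label) (hI : I.Nonempty) (S : I → Srt) {T U : I → Ty} :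
      (∀ i, Ty.Cong (T i) (U i)) → Ty.Cong (.ext p I hI S T) (.ext p I hI S U)
  | int (p : Participant) (I : Finset Label) (hI : I.Nonempty) (S : I → Srt) {T U : I → Ty} :
      (∀ i, Ty.Cong (T i) (U i)) → Ty.Cong (.int p I hI S T) (.int p I hI S U)
  | mu {T U : Ty} : Ty.Cong T U → Ty.Cong (.mu T) (.mu U)

/-! ## Session trees -/

/-- The label of a node of a session tree, with the sorts of its payloads. -/
inductive Node where
  | done
  | inp (p : Participant) (I : Finset Label) (hI : I.Nonempty) (S : I → Srt)
  | out (p : Participant) (I : Finset Label) (hI : I.Nonempty) (S : I → Srt)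

/-- The directions in which a node has continuations. -/
def Node.Dir : Node → Type
  | .done => Empty
  | .inp _ I _ _ => I
  | .out _ I _ _ => I

/-- The signature of session trees. -/
def treeSig : PFunctor := ⟨Node, Node.Dir⟩

/-- Session trees: the possibly infinite (coinductive) trees over this signature. -/
abbrev Tree := treeSig.M

def Tree.done : Tree := PFunctor.M.mk ⟨Node.done, Empty.elim⟩

def Tree.inp (p : Participant) (I : Finset Label) (hI : I.Nonempty) (S : I → Srt)
    (T : I → Tree) : Tree :=
  PFunctor.M.mk ⟨Node.inp p I hI S, T⟩

def Tree.out (p : Participant) (I : Finset Label) (hI : I.Nonempty) (S : I → Srt)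
    (T : I → Tree) : Tree :=
  PFunctor.M.mk ⟨Node.out p I hI S, T⟩

/-- A branching with a single label. -/
def Tree.inp1 (p : Participant) (ℓ : Label) (S : Srt) (W : Tree) : Tree :=
  Tree.inp p {ℓ} (Finset.singleton_nonempty ℓ) (fun _ => S) (fun _ => W)

/-- A selection with a single label. -/
def Tree.out1 (p : Participant) (ℓ : Label) (S : Srt) (W : Tree) : Tree :=
  Tree.out p {ℓ} (Finset.singleton_nonempty ℓ) (fun _ => S) (fun _ => W)

/-- The number of recursion binders at the head of a type. -/
def Ty.muHeight : Ty → ℕ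
  | .mu T => T.muHeight + 1
  | _ => 0

/-- Unfolding of one recursion binder at the head of a type. -/
def Ty.unfoldOnce : Ty → Ty
  | .mu T => T.inst (.mu T)
  | T => T

/-- Unfolding of all recursion binders at the head of a type. A guarded type `T` has no recursion
binder at its head after `T.muHeight` unfoldings. -/
def Ty.unfoldHead (T : Ty) : Ty := Ty.unfoldOnce^[T.muHeight] T

/-- The root of the tree of a type, with the types of the subtrees. (The last case does not arise
for well-formed types.) -/
def Ty.step (T : Ty) : treeSig Ty :=
  match T.unfoldHead with
  | .ext p I hI S U => ⟨Node.inp p I hI S, U⟩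
  | .int p I hI S U => ⟨Node.out p I hI S, U⟩
  | .done => ⟨Node.done, Empty.elim⟩
  | _ => ⟨Node.done, Empty.elim⟩

/-- The session tree of a session type. -/
def Ty.tree (T : Ty) : Tree := PFunctor.M.corec Ty.step T

/-- The action `a` occurs in a tree. -/
inductive Tree.Occurs : Action → Tree → Prop
  | inp (p : Participant) (I : Finset Label) (hI : I.Nonempty) (S : I → Srt) (T : I → Tree) :
      Tree.Occurs (.recv p) (Tree.inp p I hI S T)
  | out (p : Participant) (I : Finset Label) (hI : I.Nonempty) (S : I → Srt) (T : I → Tree) :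
      Tree.Occurs (.send p) (Tree.out p I hI S T)
  | inpCont (a : Action) (p : Participant) (I : Finset Label) (hI : I.Nonempty) (S : I → Srt)
      (T : I → Tree) (i : I) : Tree.Occurs a (T i) → Tree.Occurs a (Tree.inp p I hI S T)
  | outCont (a : Action) (p : Participant) (I : Finset Label) (hI : I.Nonempty) (S : I → Srt)
      (T : I → Tree) (i : I) : Tree.Occurs a (T i) → Tree.Occurs a (Tree.out p I hI S T)

/-- The set of input and output actions of a tree. -/
def Tree.actions (W : Tree) : Set Action := {a | Tree.Occurs a W}

/-! ## Refinement of SISO trees -/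

/-- A single input or output in a prefix of a SISO tree. -/
inductive Pre where
  | inp (p : Participant) (ℓ : Label) (S : Srt)
  | out (p : Participant) (ℓ : Label) (S : Srt)

/-- The tree that starts with a finite sequence of inputs and outputs. -/
def Tree.prepend : List Pre → Tree → Tree
  | [], W => W
  | .inp p ℓ S :: A, W => Tree.inp1 p ℓ S (Tree.prepend A W)
  | .out p ℓ S :: A, W => Tree.out1 p ℓ S (Tree.prepend A W)

/-- Nonempty sequences of inputs from participants other than `p`. -/
def IsACtx (p : Participant) (A : List Pre) : Prop :=
  A ≠ [] ∧ ∀ a ∈ A, ∃ q ℓ S, q ≠ p ∧ a = .inp q ℓ S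

/-- Nonempty sequences of inputs from any participants and outputs to participants other than
`p`. -/
def IsBCtx (p : Participant) (B : List Pre) : Prop :=
  B ≠ [] ∧ ∀ a ∈ B, (∃ r ℓ S, a = .inp r ℓ S) ∨ ∃ q ℓ S, q ≠ p ∧ a = .out q ℓ S

/-- One rule of SISO tree refinement, with `R` for the premises on trees. -/
inductive RefStep (R : Tree → Tree → Prop) : Tree → Tree → Prop
  | refIn (p : Participant) (ℓ : Label) (S S' : Srt) (W W' : Tree) : S'.Le S → R W W' →
      RefStep R (Tree.inp1 p ℓ S W) (Tree.inp1 p ℓ S' W')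
  | refA (p : Participant) (ℓ : Label) (S S' : Srt) (W W' : Tree) (A : List Pre) :
      IsACtx p A → S'.Le S → R W (Tree.prepend A W') →
      W.actions = (Tree.prepend A W').actions →
      RefStep R (Tree.inp1 p ℓ S W) (Tree.prepend A (Tree.inp1 p ℓ S' W'))
  | refOut (p : Participant) (ℓ : Label) (S S' : Srt) (W W' : Tree) : S.Le S' → R W W' →
      RefStep R (Tree.out1 p ℓ S W) (Tree.out1 p ℓ S' W')
  | refB (p : Participant) (ℓ : Label) (S S' : Srt) (W W' : Tree) (B : List Pre) :
      IsBCtx p B → S.Le S' → R W (Tree.prepend B W') →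
      W.actions = (Tree.prepend B W').actions →
      RefStep R (Tree.out1 p ℓ S W) (Tree.prepend B (Tree.out1 p ℓ S' W'))
  | refEnd : RefStep R Tree.done Tree.done

/-- The SISO tree refinement relation: the largest relation closed backward under the rules. -/
def Tree.Refines (W W' : Tree) : Prop :=
  ∃ R : Tree → Tree → Prop, (∀ X Y, R X Y → RefStep R X Y) ∧ R W W'

/-! ## Decompositions and subtyping -/

/-- One step of the decomposition into single-output trees. -/
inductive SOStep (R : Tree → Tree → Prop) : Tree → Tree → Prop
  | done : SOStep R Tree.done Tree.done
  | out (p : Participant) (I : Finset Label) (hI : I.Nonempty) (S : I → Srt) (T : I → Tree)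
      (i : I) (U : Tree) : R (T i) U →
      SOStep R (Tree.out p I hI S T) (Tree.out1 p i.1 (S i) U)
  | inp (p : Participant) (I : Finset Label) (hI : I.Nonempty) (S : I → Srt) (T U : I → Tree) :
      (∀ i, R (T i) (U i)) → SOStep R (Tree.inp p I hI S T) (Tree.inp p I hI S U)

/-- One step of the decomposition into single-input trees. -/
inductive SIStep (R : Tree → Tree → Prop) : Tree → Tree → Prop
  | done : SIStep R Tree.done Tree.done
  | out (p : Participant) (I : Finset Label) (hI : I.Nonempty) (S : I → Srt) (T V : I → Tree) :
      (∀ i, R (T i) (V i)) → SIStep R (Tree.out p I hI S T) (Tree.out p I hI S V)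
  | inp (p : Participant) (I : Finset Label) (hI : I.Nonempty) (S : I → Srt) (T : I → Tree)
      (i : I) (V : Tree) : R (T i) V →
      SIStep R (Tree.inp p I hI S T) (Tree.inp1 p i.1 (S i) V)

/-- The set of single-output trees of a tree (coinductively). -/
def Tree.SO (T : Tree) : Set Tree :=
  {U | ∃ R : Tree → Tree → Prop, (∀ X Y, R X Y → SOStep R X Y) ∧ R T U}

/-- The set of single-input trees of a tree (coinductively). -/
def Tree.SI (T : Tree) : Set Tree :=
  {V | ∃ R : Tree → Tree → Prop, (∀ X Y, R X Y → SIStep R X Y) ∧ R T V}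

/-- Asynchronous subtyping of session trees. -/
def Tree.Subtype (T T' : Tree) : Prop :=
  ∀ U ∈ T.SO, ∀ V' ∈ T'.SI, ∃ W ∈ U.SI, ∃ W' ∈ V'.SO, W.Refines W'

/-- Asynchronous subtyping of session types. -/
def Ty.Subtype (T T' : Ty) : Prop := T.tree.Subtype T'.tree

/-! ## Typing -/

/-- Sorting of expressions; the environment lists the sorts of the variables. -/
inductive HasSort : List Srt → Expr → Srt → Prop
  | pos (Θ : List Srt) (n : ℤ) : 0 < n → HasSort Θ (.val (.int n)) .nat
  | nonpos (Θ : List Srt) (n : ℤ) : n ≤ 0 → HasSort Θ (.val (.int n)) .int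
  | bool (Θ : List Srt) (b : Bool) : HasSort Θ (.val (.bool b)) .bool
  | unit (Θ : List Srt) : HasSort Θ (.val .unit) .unit
  | var (Θ : List Srt) (x : ℕ) (S : Srt) : Θ[x]? = some S → HasSort Θ (.var x) S
  | succ {Θ : List Srt} {e : Expr} : HasSort Θ e .nat → HasSort Θ (.succ e) .nat
  | inv {Θ : List Srt} {e : Expr} : HasSort Θ e .int → HasSort Θ (.inv e) .int
  | neg {Θ : List Srt} {e : Expr} : HasSort Θ e .bool → HasSort Θ (.neg e) .bool
  | gtz {Θ : List Srt} {e : Expr} : HasSort Θ e .int → HasSort Θ (.gtz e) .bool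
  | isUnit {Θ : List Srt} {e : Expr} : HasSort Θ e .unit → HasSort Θ (.isUnit e) .bool
  | sub {Θ : List Srt} {e : Expr} {S S' : Srt} : HasSort Θ e S → S.Le S' → HasSort Θ e S'

/-- Queue types: a queued message has a recipient, a label and a payload sort. -/
abbrev QTy := List (Participant × Label × Srt)

/-- Typing of queues. -/
def QueueTyped : Queue → QTy → Prop :=
  List.Forall₂ (fun m t => m.1 = t.1 ∧ m.2.1 = t.2.1 ∧ HasSort [] (.val m.2.2) t.2.2)

/-- Typing of processes. The two environments list the sorts of the expression variables and the
(closed) types of the process variables. Recursive processes are guarded. -/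
inductive Typed : List Srt → List Ty → Proc → Ty → Prop
  | nil (Θ : List Srt) (Ξ : List Ty) : Typed Θ Ξ .nil .done
  | var (Θ : List Srt) (Ξ : List Ty) (X : ℕ) (T : Ty) : Ξ[X]? = some T → Typed Θ Ξ (.var X) T
  | mu {Θ : List Srt} {Ξ : List Ty} {P : Proc} {T : Ty} : T.WF → P.GuardedVar 0 →
      Typed Θ (T :: Ξ) P T → Typed Θ Ξ (.mu P) T
  | out {Θ : List Srt} {Ξ : List Ty} {e : Expr} {P : Proc} {S : Srt} {T : Ty}
      (q : Participant) (ℓ : Label) : HasSort Θ e S → Typed Θ Ξ P T →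
      Typed Θ Ξ (.out q ℓ e P) (.out1 q ℓ S T)
  | ext {Θ : List Srt} {Ξ : List Ty} (q : Participant) (I : Finset Label) (hI : I.Nonempty)
      (S : I → Srt) {P : I → Proc} {T : I → Ty} :
      (∀ i, Typed (S i :: Θ) Ξ (P i) (T i)) → Typed Θ Ξ (.ext q I P) (.ext q I hI S T)
  | cond {Θ : List Srt} {Ξ : List Ty} {e : Expr} {P Q : Proc} {T : Ty} :
      HasSort Θ e .bool → Typed Θ Ξ P T → Typed Θ Ξ Q T → Typed Θ Ξ (.cond e P Q) T
  | sub {Θ : List Srt} {Ξ : List Ty} {P : Proc} {T T' : Ty} :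
      Typed Θ Ξ P T → T'.WF → T.Subtype T' → Typed Θ Ξ P T'

/-- Typing environments: finite maps from participants to a queue type and a session type. -/
abbrev Env := Finmap (fun _ : Participant => QTy × Ty)

/-- Typing of sessions: a composition of pairwise distinct participants, which are exactly those of
the environment, each with its process and its queue of the types that the environment gives. -/
def SessTyped (Γ : Env) (M : Sess) : Prop :=
  M.NoError ∧ M.WF ∧ (∀ p, p ∈ Γ ↔ p ∈ M.comps.map Prod.fst) ∧
    ∀ c ∈ M.comps, ∃ (σ : QTy) (T : Ty), Γ.lookup c.1 = some (σ, T) ∧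
      Typed [] [] c.2.1 T ∧ QueueTyped c.2.2 σ

/-! ## Reduction and liveness of typing environments -/

def PairCong (x y : QTy × Ty) : Prop := QCong x.1 y.1 ∧ x.2.Cong y.2

/-- Congruence of typing environments: common entries are congruent, and all other entries, on
either side, are congruent to the pair of the empty queue type and the ended type. -/
def Env.Cong (Γ Γ' : Env) : Prop :=
  (∀ p x x', Γ.lookup p = some x → Γ'.lookup p = some x' → PairCong x x') ∧
  (∀ p x, Γ.lookup p = some x → p ∉ Γ' → PairCong x ([], .done)) ∧
  (∀ p x', Γ'.lookup p = some x' → p ∉ Γ → PairCong x' ([], .done))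

/-- Labels of reductions: `recv p q ℓ` is `p:q?ℓ` (`p` receives from `q`) and `send p q ℓ` is
`p:q!ℓ` (`p` sends to `q`). -/
inductive ELabel where
  | recv (p q : Participant) (ℓ : Label)
  | send (p q : Participant) (ℓ : Label)

/-- Labelled reduction of typing environments. -/
inductive Env.Red : Env → ELabel → Env → Prop
  | rcv (Γ : Env) (p q : Participant) (I : Finset Label) (hI : I.Nonempty) (S : I → Srt)
      (T : I → Ty) (k : I) (S' : Srt) (σ σq : QTy) (Tp : Ty) :
      p ≠ q → Γ.lookup p = some ((q, k.1, S') :: σ, Tp) →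
      Γ.lookup q = some (σq, .ext p I hI S T) → S'.Le (S k) →
      Env.Red Γ (.recv q p k.1) ((Γ.insert p (σ, Tp)).insert q (σq, T k))
  | send (Γ : Env) (p q : Participant) (I : Finset Label) (hI : I.Nonempty) (S : I → Srt)
      (T : I → Ty) (k : I) (σ : QTy) :
      Γ.lookup p = some (σ, .int q I hI S T) →
      Env.Red Γ (.send p q k.1) (Γ.insert p (σ ++ [(q, k.1, S k)], T k))
  | struct {Γ Γ₁ Γ₁' Γ' : Env} {α : ELabel} :
      Env.Cong Γ Γ₁ → Env.Red Γ₁ α Γ₁' → Env.Cong Γ₁' Γ' → Env.Red Γ α Γ'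

/-- A path `(γ i)` over the nonempty set `I` of consecutive natural numbers from `0` on (finite or
infinite). The values of `γ` outside `I` are irrelevant. -/
def IsPath (I : Set ℕ) (γ : ℕ → Env) : Prop :=
  0 ∈ I ∧ (∀ i, i + 1 ∈ I → i ∈ I) ∧ ∀ i, i + 1 ∈ I → ∃ α, Env.Red (γ i) α (γ (i + 1))

def FairPath (I : Set ℕ) (γ : ℕ → Env) : Prop :=
  ∀ i ∈ I,
    (∀ p q ℓ Γ', Env.Red (γ i) (.send p q ℓ) Γ' →
      ∃ k ℓ', k + 1 ∈ I ∧ i < k + 1 ∧ Env.Red (γ k) (.send p q ℓ') (γ (k + 1))) ∧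
    (∀ p q ℓ Γ', Env.Red (γ i) (.recv p q ℓ) Γ' →
      ∃ k, k + 1 ∈ I ∧ i < k + 1 ∧ Env.Red (γ k) (.recv p q ℓ) (γ (k + 1)))

def LivePath (I : Set ℕ) (γ : ℕ → Env) : Prop :=
  ∀ i ∈ I,
    (∀ p q ℓ S σ T x, (γ i).lookup p = some x → PairCong x ((q, ℓ, S) :: σ, T) →
      ∃ k, k + 1 ∈ I ∧ i < k + 1 ∧ Env.Red (γ k) (.recv q p ℓ) (γ (k + 1))) ∧
    (∀ p q J hJ S T σ x, (γ i).lookup p = some x → PairCong x (σ, .ext q J hJ S T) →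
      ∃ k ℓ', k + 1 ∈ I ∧ i < k + 1 ∧ Env.Red (γ k) (.recv p q ℓ') (γ (k + 1)))

/-- A typing environment is live when all fair paths that begin with it are live. -/
def Env.Live (Γ : Env) : Prop :=
  ∀ I γ, IsPath I γ → γ 0 = Γ → FairPath I γ → LivePath I γ

/-! ## The batch-processing protocol -/

open Participant Label

/-- The type of both processors. -/
def tyBp (S : Srt) : Ty :=
  .mu (.inp1 src data S (.out1 sk data S (.var 0)))

/-- The type of the source. -/
def tySrc (S : Srt) : Ty :=
  .mu (.ext ctl {b1, b2} (Finset.insert_nonempty _ _) (fun _ => .unit) (fun i =>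
    if i.1 = b1 then .out1 ctl b1 .unit (.out1 bp1 data S (.var 0))
    else .out1 ctl b2 .unit (.out1 bp2 data S (.var 0))))

/-- The type of the sink. -/
def tySk (S : Srt) : Ty :=
  .mu (.out1 ctl b1 .unit (.inp1 ctl b1 .unit (.inp1 bp1 data S
    (.out1 ctl b2 .unit (.inp1 ctl b2 .unit (.inp1 bp2 data S (.var 0)))))))

/-- The type of the unoptimised control. -/
def tyCtl : Ty :=
  .mu (.out1 src b1 .unit (.inp1 src b1 .unit (.inp1 sk b1 .unit (.out1 sk b1 .unit
    (.out1 src b2 .unit (.inp1 src b2 .unit (.inp1 sk b2 .unit (.out1 sk b2 .unit (.var 0)))))))))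

/-- The type of the optimised (double-buffering) control. -/
def tyCtlOpt : Ty :=
  .out1 src b1 .unit (.out1 src b2 .unit
    (.mu (.inp1 src b1 .unit (.inp1 sk b1 .unit (.out1 sk b1 .unit (.out1 src b1 .unit
      (.inp1 src b2 .unit (.inp1 sk b2 .unit (.out1 sk b2 .unit (.out1 src b2 .unit
        (.var 0)))))))))))

/-- The process of both processors; `f` is an expression in the received value, variable `0`. -/
def prBp (f : Expr) : Proc :=
  .mu (.ext1 src data (.out sk data f (.var 0)))

/-- The process of the source; `datum` is a closed expression. -/
def prSrc (datum : Expr) : Proc :=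
  .mu (.ext ctl {b1, b2} (fun i =>
    if i.1 = b1 then .out ctl b1 (.val .unit) (.out bp1 data datum (.var 0))
    else .out ctl b2 (.val .unit) (.out bp2 data datum (.var 0))))

/-- The process of the optimised control. -/
def prCtl : Proc :=
  .out src b1 (.val .unit) (.out src b2 (.val .unit)
    (.mu (.ext1 src b1 (.ext1 sk b1 (.out sk b1 (.val .unit) (.out src b1 (.val .unit)
      (.ext1 src b2 (.ext1 sk b2 (.out sk b2 (.val .unit) (.out src b2 (.val .unit)
        (.var 0)))))))))))

/-- The process of the sink. -/
def prSk : Proc :=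
  .mu (.out ctl b1 (.val .unit) (.ext1 ctl b1 (.ext1 bp1 data
    (.out ctl b2 (.val .unit) (.ext1 ctl b2 (.ext1 bp2 data (.var 0)))))))

/-- The five-party typing environment with the unoptimised control and empty queues. -/
def batchEnv (S : Srt) : Env :=
  ((((Finmap.singleton bp1 (([] : QTy), tyBp S)).insert bp2 ([], tyBp S)).insert
    src ([], tySrc S)).insert ctl ([], tyCtl)).insert sk ([], tySk S)

/-- The five-party session with the optimised control and empty queues. -/
def batchSess (f datum : Expr) : Sess :=
  .par (.part bp1 (prBp f) []) (.par (.part bp2 (prBp f) []) (.par (.part src (prSrc datum) [])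
    (.par (.part ctl prCtl []) (.part sk prSk []))))

end AsyncMPST

/-! Subtyping. Both control types have only singleton choices, so each is its own unique
decomposition and subtyping becomes refinement of two SISO trees (`Tree.Refines.subtype`). A
relation with nine pairs, `CtlRel`, witnesses the refinement. The optimised control always runs one
output to `src` ahead; such an output is matched by moving it, with the rule for nonempty output
contexts, across the inputs from `src` and `sk` and the output to `sk` that precede it in the
ordinary control. The side condition on actions holds because every tree involved shows all four
actions of the control.

Determinism. The source offers a choice, but the control resolves it in a fixed alternation, so
every participant performs a fixed infinite sequence of actions and every channel carries a fixed
sequence of messages. `Protocol` abstracts this situation: a state is given, up to congruence, by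
the number of actions that each participant has performed, and a rank function schedules every
reception after the transmission of its message.

Liveness. Each reduction of an environment advances one counter (`Protocol.EnvAt.red`). By strong
induction on the rank, fairness forces every action to be performed eventually
(`Protocol.exists_advance_lt`): the earlier action of the same participant and, for a reception, the
matching send have smaller rank. Liveness follows, since a queued message or a pending branching
points to a definite future reception.

Absence of errors. No general subject reduction theorem is used. The session with the optimised
control is an instance of the same abstraction, and `Protocol.SessAt.red` shows that the counter
invariant survives every reduction while every error rule contradicts it. A deadlock, for example,
is excluded by the next action of least rank, which is always enabled.

Congruence. Reductions are taken up to a congruence that folds and unfolds recursion anywhere. What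
makes inversion possible is that congruent types, or processes, without a binder at the head agree
at the head (`Ty.Cong.sameHead`, `Proc.Cong.sameHead`).

Typing. It is syntax-directed, with subsumption used to fold recursive types, and once more, through
the refinement above, to give the optimised control the type of the ordinary one. -/

namespace AsyncMPST

/-! ## Substitution in types -/

/-- The substitution of `U` for the recursion variable `0`. -/
def Ty.single (U : Ty) : ℕ → Ty
  | 0 => U
  | n + 1 => .var n

theorem Ty.inst_eq (T U : Ty) : T.inst U = T.subst (Ty.single U) := by
  unfold Ty.inst
  congr 1

theorem Ty.rename_rename (T : Ty) (ρ τ : ℕ → ℕ) :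
    (T.rename ρ).rename τ = T.rename (fun n => τ (ρ n)) := by
  induction T generalizing ρ τ with
  | ext p I hI S T ih => simp [Ty.rename, ih]
  | int p I hI S T ih => simp [Ty.rename, ih]
  | done => rfl
  | mu T ih =>
    simp only [Ty.rename, ih]
    congr 2
    funext n
    cases n <;> rfl
  | var t => rfl

theorem Ty.subst_rename (T : Ty) (ρ : ℕ → ℕ) (σ : ℕ → Ty) :
    (T.rename ρ).subst σ = T.subst (fun n => σ (ρ n)) := by
  induction T generalizing ρ σ with
  | ext p I hI S T ih => simp [Ty.rename, Ty.subst, ih]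
  | int p I hI S T ih => simp [Ty.rename, Ty.subst, ih]
  | done => rfl
  | mu T ih =>
    simp only [Ty.rename, Ty.subst, ih]
    congr 2
    funext n
    cases n <;> rfl
  | var t => rfl

theorem Ty.rename_subst (T : Ty) (σ : ℕ → Ty) (ρ : ℕ → ℕ) :
    (T.subst σ).rename ρ = T.subst (fun n => (σ n).rename ρ) := by
  induction T generalizing ρ σ with
  | ext p I hI S T ih => simp [Ty.rename, Ty.subst, ih]
  | int p I hI S T ih => simp [Ty.rename, Ty.subst, ih]
  | done => rfl
  | mu T ih =>
    simp only [Ty.rename, Ty.subst, ih]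
    congr 2
    funext n
    cases n with
    | zero => rfl
    | succ n => simp [upTy, Ty.rename_rename, upRen]
  | var t => rfl

theorem Ty.subst_subst (T : Ty) (σ τ : ℕ → Ty) :
    (T.subst σ).subst τ = T.subst (fun n => (σ n).subst τ) := by
  induction T generalizing σ τ with
  | ext p I hI S T ih => simp [Ty.subst, ih]
  | int p I hI S T ih => simp [Ty.subst, ih]
  | done => rfl
  | mu T ih =>
    simp only [Ty.subst, ih]
    congr 2
    funext n
    cases n with
    | zero => rfl
    | succ n => simp [upTy, Ty.rename_subst, Ty.subst_rename]
  | var t => rfl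

theorem Ty.subst_var (T : Ty) : T.subst Ty.var = T := by
  induction T with
  | ext p I hI S T ih => simp [Ty.subst, ih]
  | int p I hI S T ih => simp [Ty.subst, ih]
  | done => rfl
  | mu T ih =>
    have : upTy Ty.var = Ty.var := by
      funext n
      cases n <;> rfl
    rw [Ty.subst, this, ih]
  | var t => rfl

/-- Unfolding commutes with substitution; this is what makes congruence stable under substitution
and lets unfoldings at the head be tracked through one. -/
theorem Ty.inst_subst (T U : Ty) (σ : ℕ → Ty) :
    (T.inst U).subst σ = (T.subst (upTy σ)).inst (U.subst σ) := by
  simp only [Ty.inst_eq, Ty.subst_subst]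
  congr 1
  funext n
  cases n with
  | zero => rfl
  | succ n =>
    simp only [Ty.single, Ty.subst, upTy, Ty.subst_rename]
    exact (Ty.subst_var _).symm

theorem Ty.Cong.subst {T U : Ty} (h : T.Cong U) (σ : ℕ → Ty) :
    (T.subst σ).Cong (U.subst σ) := by
  induction h generalizing σ with
  | refl T => exact .refl _
  | symm _ ih => exact (ih σ).symm
  | trans _ _ ih₁ ih₂ => exact (ih₁ σ).trans (ih₂ σ)
  | unfold T =>
    rw [Ty.inst_subst]
    exact .unfold _
  | ext p I hI S _ ih => exact .ext p I hI S fun i => ih i σ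
  | int p I hI S _ ih => exact .int p I hI S fun i => ih i σ
  | mu _ ih => exact .mu (ih _)

theorem Ty.rename_eq_subst (T : Ty) (ρ : ℕ → ℕ) :
    T.rename ρ = T.subst (fun n => .var (ρ n)) := by
  rw [← Ty.subst_var (T.rename ρ), Ty.subst_rename]

theorem Ty.Cong.rename {T U : Ty} (h : T.Cong U) (ρ : ℕ → ℕ) :
    (T.rename ρ).Cong (U.rename ρ) := by
  simpa only [Ty.rename_eq_subst] using h.subst _

theorem Ty.cong_subst (T : Ty) {σ τ : ℕ → Ty} (h : ∀ n, (σ n).Cong (τ n)) :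
    (T.subst σ).Cong (T.subst τ) := by
  induction T generalizing σ τ with
  | ext p I hI S T ih => exact .ext p I hI S fun i => ih i h
  | int p I hI S T ih => exact .int p I hI S fun i => ih i h
  | done => exact .refl _
  | mu T ih =>
    refine .mu (ih fun n => ?_)
    cases n with
    | zero => exact .refl _
    | succ n => exact (h n).rename _
  | var t => exact h t

theorem Ty.Cong.inst {T T' U U' : Ty} (h : T.Cong T') (h' : U.Cong U') :
    (T.inst U).Cong (T'.inst U') := by
  rw [Ty.inst_eq, Ty.inst_eq]
  refine (h.subst _).trans (Ty.cong_subst _ fun n => ?_)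
  cases n with
  | zero => exact h'
  | succ n => exact .refl _

/-! ## Heads of types -/

/-- The type has no recursion binder at its head. -/
def Ty.IsHead : Ty → Prop
  | .mu _ => False
  | _ => True

/-- `T.HeadIn k N`: `k` unfoldings of recursion binders at the head of `T` lead to `N`, which has no
recursion binder at its head. -/
inductive Ty.HeadIn : ℕ → Ty → Ty → Prop
  | head {N : Ty} : N.IsHead → Ty.HeadIn 0 N N
  | mu {k : ℕ} {T N : Ty} : Ty.HeadIn k (T.inst (.mu T)) N → Ty.HeadIn (k + 1) (.mu T) N

/-- Two types without recursion binder at the head agree at the head, up to congruence of the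
continuations. -/
inductive Ty.SameHead : Ty → Ty → Prop
  | ext (p : Participant) (I : Finset Label) (hI : I.Nonempty) (S : I → Srt) {T U : I → Ty} :
      (∀ i, (T i).Cong (U i)) → Ty.SameHead (.ext p I hI S T) (.ext p I hI S U)
  | int (p : Participant) (I : Finset Label) (hI : I.Nonempty) (S : I → Srt) {T U : I → Ty} :
      (∀ i, (T i).Cong (U i)) → Ty.SameHead (.int p I hI S T) (.int p I hI S U)
  | done : Ty.SameHead .done .done
  | var (t : ℕ) : Ty.SameHead (.var t) (.var t)

theorem Ty.SameHead.refl {N : Ty} (h : N.IsHead) : N.SameHead N := by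
  cases N with
  | ext p I hI S T => exact .ext p I hI S fun _ => .refl _
  | int p I hI S T => exact .int p I hI S fun _ => .refl _
  | done => exact .done
  | mu T => exact h.elim
  | var t => exact .var t

theorem Ty.SameHead.trans {M N O : Ty} (h : M.SameHead N) (h' : N.SameHead O) :
    M.SameHead O := by
  cases h with
  | ext p I hI S h =>
    cases h' with
    | ext _ _ _ _ h' => exact .ext p I hI S fun i => (h i).trans (h' i)
  | int p I hI S h =>
    cases h' with
    | int _ _ _ _ h' => exact .int p I hI S fun i => (h i).trans (h' i)
  | done => exact h'
  | var t => exact h'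

theorem Ty.HeadIn.isHead {k : ℕ} {T N : Ty} (h : T.HeadIn k N) : N.IsHead := by
  induction h with
  | head h => exact h
  | mu _ ih => exact ih

theorem Ty.HeadIn.eq_of_isHead {k : ℕ} {T N : Ty} (h : Ty.HeadIn k T N) (hT : T.IsHead) :
    N = T := by
  cases h with
  | head h => rfl
  | mu _ => exact hT.elim

theorem Ty.HeadIn.subst {a b : ℕ} {T N₀ N : Ty} {σ : ℕ → Ty} (h : Ty.HeadIn a T N₀)
    (h' : Ty.HeadIn b (N₀.subst σ) N) : ∃ k, Ty.HeadIn k (T.subst σ) N := by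
  induction h with
  | head _ => exact ⟨b, h'⟩
  | mu _ ih =>
    obtain ⟨k, hk⟩ := ih h'
    rw [Ty.inst_subst] at hk
    exact ⟨k + 1, .mu hk⟩

/-- Unfolding a substituted type first exhausts the binders of `T` itself; only if that ends in a
variable can the substituted types contribute more. The equation `a + b = k` is kept because
`Ty.HeadIn.mu_cong` is an induction on the number of unfoldings. -/
theorem Ty.HeadIn.of_subst {k : ℕ} {X N : Ty} (h : Ty.HeadIn k X N) (T : Ty) (σ : ℕ → Ty)
    (hX : X = T.subst σ) :
    ∃ (N₀ : Ty) (a b : ℕ), Ty.HeadIn a T N₀ ∧ Ty.HeadIn b (N₀.subst σ) N ∧ a + b = k := by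
  induction h generalizing T with
  | head hN =>
    subst hX
    refine ⟨T, 0, 0, .head ?_, .head hN, rfl⟩
    cases T <;> trivial
  | @mu k T' N h ih =>
    by_cases hT : T.IsHead
    · exact ⟨T, 0, k + 1, .head hT, hX ▸ .mu h, by omega⟩
    · cases T with
      | mu T =>
        simp only [Ty.subst, Ty.mu.injEq] at hX
        subst hX
        obtain ⟨N₀, a, b, ha, hb, hab⟩ := ih (T.inst (.mu T)) (Ty.inst_subst T (.mu T) σ).symm
        exact ⟨N₀, a + 1, b, .mu ha, hb, by omega⟩
      | _ => exact (hT trivial).elim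

/-- The head of a recursive type comes from the head of its body, where the hypothesis on the bodies
applies. Counting unfoldings replaces any assumption of guardedness. -/
theorem Ty.HeadIn.mu_cong {T U : Ty} (hc : T.Cong U)
    (ih : ∀ k N, Ty.HeadIn k T N → ∃ k' N', Ty.HeadIn k' U N' ∧ N.SameHead N') (k : ℕ) :
    ∀ N, Ty.HeadIn k (.mu T) N → ∃ k' N', Ty.HeadIn k' (.mu U) N' ∧ N.SameHead N' := by
  induction k using Nat.strong_induction_on with
  | _ k IH =>
    intro N h
    cases h with
    | head h => exact h.elim
    | @mu k _ _ h =>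
      obtain ⟨N₀, a, b, ha, hb, hab⟩ := h.of_subst T _ (Ty.inst_eq _ _)
      obtain ⟨a', N₁, ha', hs⟩ := ih a N₀ ha
      suffices H : ∃ b' N', Ty.HeadIn b' (N₁.subst (Ty.single (.mu U))) N' ∧ N.SameHead N' by
        obtain ⟨b', N', hb', hs'⟩ := H
        obtain ⟨k', hk'⟩ := ha'.subst hb'
        rw [← Ty.inst_eq] at hk'
        exact ⟨k' + 1, N', .mu hk', hs'⟩
      cases hs with
      | ext p I hI S hi =>
        obtain rfl := hb.eq_of_isHead trivial
        refine ⟨0, _, .head trivial, .ext p I hI S fun i => ?_⟩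
        simpa only [Ty.inst_eq] using (hi i).inst (.mu hc)
      | int p I hI S hi =>
        obtain rfl := hb.eq_of_isHead trivial
        refine ⟨0, _, .head trivial, .int p I hI S fun i => ?_⟩
        simpa only [Ty.inst_eq] using (hi i).inst (.mu hc)
      | done =>
        obtain rfl := hb.eq_of_isHead trivial
        exact ⟨0, _, .head trivial, .done⟩
      | var t =>
        cases t with
        -- An unguarded body leads back to the recursive type itself, with strictly fewer unfoldings
        -- left.
        | zero => exact IH b (by omega) N hb
        | succ t =>
          obtain rfl := hb.eq_of_isHead trivial
          exact ⟨0, _, .head trivial, .var t⟩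

/-- Both directions are proved together so that the symmetry rule of congruence is immediate;
induction on a one-sided statement would get stuck there. -/
theorem Ty.Cong.headIn {T U : Ty} (h : T.Cong U) :
    (∀ k N, Ty.HeadIn k T N → ∃ k' N', Ty.HeadIn k' U N' ∧ N.SameHead N') ∧
      ∀ k N, Ty.HeadIn k U N → ∃ k' N', Ty.HeadIn k' T N' ∧ N.SameHead N' := by
  induction h with
  | refl T => exact ⟨fun k N h => ⟨k, N, h, .refl h.isHead⟩, fun k N h => ⟨k, N, h, .refl h.isHead⟩⟩
  | symm _ ih => exact ⟨ih.2, ih.1⟩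
  | trans _ _ ih₁ ih₂ =>
    constructor
    · intro k N h
      obtain ⟨k', N', h', hs⟩ := ih₁.1 k N h
      obtain ⟨k'', N'', h'', hs'⟩ := ih₂.1 k' N' h'
      exact ⟨k'', N'', h'', hs.trans hs'⟩
    · intro k N h
      obtain ⟨k', N', h', hs⟩ := ih₂.2 k N h
      obtain ⟨k'', N'', h'', hs'⟩ := ih₁.2 k' N' h'
      exact ⟨k'', N'', h'', hs.trans hs'⟩
  | unfold T =>
    constructor
    · intro k N h
      cases h with
      | head h => exact h.elim
      | mu h => exact ⟨_, N, h, .refl h.isHead⟩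
    · intro k N h
      exact ⟨k + 1, N, .mu h, .refl h.isHead⟩
  | ext p I hI S h _ =>
    constructor
    · intro k N hk
      obtain rfl := hk.eq_of_isHead trivial
      exact ⟨0, _, .head trivial, .ext p I hI S h⟩
    · intro k N hk
      obtain rfl := hk.eq_of_isHead trivial
      exact ⟨0, _, .head trivial, .ext p I hI S fun i => (h i).symm⟩
  | int p I hI S h _ =>
    constructor
    · intro k N hk
      obtain rfl := hk.eq_of_isHead trivial
      exact ⟨0, _, .head trivial, .int p I hI S h⟩
    · intro k N hk
      obtain rfl := hk.eq_of_isHead trivial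
      exact ⟨0, _, .head trivial, .int p I hI S fun i => (h i).symm⟩
  | mu h ih => exact ⟨Ty.HeadIn.mu_cong h ih.1, Ty.HeadIn.mu_cong h.symm ih.2⟩

/-- The inversion principle for congruence: case analysis on its conclusion refutes, for instance, a
congruence between an input and an output. -/
theorem Ty.Cong.sameHead {T U : Ty} (h : T.Cong U) (hT : T.IsHead) (hU : U.IsHead) :
    T.SameHead U := by
  obtain ⟨k, N, hN, hs⟩ := h.headIn.1 0 T (.head hT)
  obtain rfl := hN.eq_of_isHead hU
  exact hs

end AsyncMPST

/-! ### Processes up to congruence, and evaluation of well-sorted expressions. -/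

namespace AsyncMPST

/-! ## Substitution in processes -/

/-- The substitution of `Q` for the process variable `0`. -/
def Proc.single (Q : Proc) : ℕ → Proc
  | 0 => Q
  | n + 1 => .var n

theorem Proc.instP_eq (P Q : Proc) : P.instP Q = P.substP (Proc.single Q) := by
  unfold Proc.instP
  congr 1

theorem Expr.rename_rename (e : Expr) (ρ τ : ℕ → ℕ) :
    (e.rename ρ).rename τ = e.rename (fun n => τ (ρ n)) := by
  induction e <;> simp_all [Expr.rename]

theorem Expr.subst_rename (e : Expr) (ρ : ℕ → ℕ) (σ : ℕ → Expr) :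
    (e.rename ρ).subst σ = e.subst (fun n => σ (ρ n)) := by
  induction e <;> simp_all [Expr.rename, Expr.subst]

theorem Expr.rename_subst (e : Expr) (σ : ℕ → Expr) (ρ : ℕ → ℕ) :
    (e.subst σ).rename ρ = e.subst (fun n => (σ n).rename ρ) := by
  induction e <;> simp_all [Expr.rename, Expr.subst]

theorem Expr.subst_var (e : Expr) : e.subst Expr.var = e := by
  induction e <;> simp_all [Expr.subst]

theorem upExpr_var : upExpr Expr.var = Expr.var := by
  funext n
  cases n <;> rfl

theorem upProc_var : upProc Proc.var = Proc.var := by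
  funext n
  cases n <;> rfl

theorem Proc.substE_renE (P : Proc) (ρ : ℕ → ℕ) (σ : ℕ → Expr) :
    (P.renE ρ).substE σ = P.substE (fun n => σ (ρ n)) := by
  induction P generalizing ρ σ with
  | ext q I P ih =>
    simp only [Proc.renE, Proc.substE, ih]
    congr 2
    funext i
    congr 1
    funext n
    cases n <;> rfl
  | out q ℓ e P ih => simp [Proc.renE, Proc.substE, ih, Expr.subst_rename]
  | cond e P Q ih₁ ih₂ => simp [Proc.renE, Proc.substE, ih₁, ih₂, Expr.subst_rename]
  | var X => rfl
  | mu P ih => simp [Proc.renE, Proc.substE, ih]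
  | nil => rfl

theorem Proc.renE_substE (P : Proc) (σ : ℕ → Expr) (ρ : ℕ → ℕ) :
    (P.substE σ).renE ρ = P.substE (fun n => (σ n).rename ρ) := by
  induction P generalizing ρ σ with
  | ext q I P ih =>
    simp only [Proc.renE, Proc.substE, ih]
    congr 2
    funext i
    congr 1
    funext n
    cases n with
    | zero => rfl
    | succ n => simp [upExpr, Expr.rename_rename, upRen]
  | out q ℓ e P ih => simp [Proc.renE, Proc.substE, ih, Expr.rename_subst]
  | cond e P Q ih₁ ih₂ => simp [Proc.renE, Proc.substE, ih₁, ih₂, Expr.rename_subst]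
  | var X => rfl
  | mu P ih => simp [Proc.renE, Proc.substE, ih]
  | nil => rfl

theorem Proc.substE_var (P : Proc) : P.substE Expr.var = P := by
  induction P with
  | ext q I P ih => simp [Proc.substE, ih, upExpr_var]
  | out q ℓ e P ih => simp [Proc.substE, ih, Expr.subst_var]
  | cond e P Q ih₁ ih₂ => simp [Proc.substE, ih₁, ih₂, Expr.subst_var]
  | var X => rfl
  | mu P ih => simp [Proc.substE, ih]
  | nil => rfl

theorem Proc.renE_eq_substE (P : Proc) (ρ : ℕ → ℕ) :
    P.renE ρ = P.substE (fun n => .var (ρ n)) := by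
  rw [← Proc.substE_var (P.renE ρ), Proc.substE_renE]

theorem Proc.renP_renP (P : Proc) (ρ τ : ℕ → ℕ) :
    (P.renP ρ).renP τ = P.renP (fun n => τ (ρ n)) := by
  induction P generalizing ρ τ with
  | ext q I P ih => simp [Proc.renP, ih]
  | out q ℓ e P ih => simp [Proc.renP, ih]
  | cond e P Q ih₁ ih₂ => simp [Proc.renP, ih₁, ih₂]
  | var X => rfl
  | mu P ih =>
    simp only [Proc.renP, ih]
    congr 2
    funext n
    cases n <;> rfl
  | nil => rfl

theorem Proc.substE_renP (P : Proc) (ρ : ℕ → ℕ) (σ : ℕ → Expr) :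
    (P.renP ρ).substE σ = (P.substE σ).renP ρ := by
  induction P generalizing ρ σ <;> simp_all [Proc.renP, Proc.substE]

theorem Proc.renE_renP (P : Proc) (ρ τ : ℕ → ℕ) :
    (P.renP ρ).renE τ = (P.renE τ).renP ρ := by
  simp only [Proc.renE_eq_substE, Proc.substE_renP]

theorem Proc.substP_renP (P : Proc) (ρ : ℕ → ℕ) (σ : ℕ → Proc) :
    (P.renP ρ).substP σ = P.substP (fun n => σ (ρ n)) := by
  induction P generalizing ρ σ with
  | ext q I P ih => simp [Proc.renP, Proc.substP, ih]
  | out q ℓ e P ih => simp [Proc.renP, Proc.substP, ih]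
  | cond e P Q ih₁ ih₂ => simp [Proc.renP, Proc.substP, ih₁, ih₂]
  | var X => rfl
  | mu P ih =>
    simp only [Proc.renP, Proc.substP, ih]
    congr 2
    funext n
    cases n <;> rfl
  | nil => rfl

theorem Proc.renP_substP (P : Proc) (σ : ℕ → Proc) (ρ : ℕ → ℕ) :
    (P.substP σ).renP ρ = P.substP (fun n => (σ n).renP ρ) := by
  induction P generalizing ρ σ with
  | ext q I P ih => simp [Proc.renP, Proc.substP, ih, Proc.renE_renP]
  | out q ℓ e P ih => simp [Proc.renP, Proc.substP, ih]
  | cond e P Q ih₁ ih₂ => simp [Proc.renP, Proc.substP, ih₁, ih₂]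
  | var X => rfl
  | mu P ih =>
    simp only [Proc.renP, Proc.substP, ih]
    congr 2
    funext n
    cases n with
    | zero => rfl
    | succ n => simp [upProc, Proc.renP_renP, upRen]
  | nil => rfl

/-- The expression substitution must also act on the substituted processes. Under an input binder
the shift of these processes cancels against the lifting of `σ`. -/
theorem Proc.substE_substP (P : Proc) (τ : ℕ → Proc) (σ : ℕ → Expr) :
    (P.substP τ).substE σ = (P.substE σ).substP (fun n => (τ n).substE σ) := by
  induction P generalizing τ σ with
  | ext q I P ih =>
    simp only [Proc.substP, Proc.substE, ih]
    congr 2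
    funext i
    congr 1
    funext n
    simp [Proc.substE_renE, Proc.renE_substE, upExpr]
  | out q ℓ e P ih => simp [Proc.substE, Proc.substP, ih]
  | cond e P Q ih₁ ih₂ => simp [Proc.substE, Proc.substP, ih₁, ih₂]
  | var X => rfl
  | mu P ih =>
    simp only [Proc.substE, Proc.substP, ih]
    congr 2
    funext n
    cases n with
    | zero => rfl
    | succ n => simp [upProc, Proc.substE_renP]
  | nil => rfl

theorem Proc.renE_substP (P : Proc) (τ : ℕ → Proc) (ρ : ℕ → ℕ) :
    (P.substP τ).renE ρ = (P.renE ρ).substP (fun n => (τ n).renE ρ) := by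
  simp only [Proc.renE_eq_substE, Proc.substE_substP]

theorem Proc.substP_substP (P : Proc) (σ τ : ℕ → Proc) :
    (P.substP σ).substP τ = P.substP (fun n => (σ n).substP τ) := by
  induction P generalizing σ τ with
  | ext q I P ih => simp [Proc.substP, ih, Proc.renE_substP]
  | out q ℓ e P ih => simp [Proc.substP, ih]
  | cond e P Q ih₁ ih₂ => simp [Proc.substP, ih₁, ih₂]
  | var X => rfl
  | mu P ih =>
    simp only [Proc.substP, ih]
    congr 2
    funext n
    cases n with
    | zero => rfl
    | succ n => simp [upProc, Proc.renP_substP, Proc.substP_renP]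
  | nil => rfl

theorem Proc.substP_var (P : Proc) : P.substP Proc.var = P := by
  induction P with
  | ext q I P ih => simpa [Proc.substP, Proc.renE] using funext ih
  | out q ℓ e P ih => simp [Proc.substP, ih]
  | cond e P Q ih₁ ih₂ => simp [Proc.substP, ih₁, ih₂]
  | var X => rfl
  | mu P ih => rw [Proc.substP, upProc_var, ih]
  | nil => rfl

theorem Proc.renP_eq_substP (P : Proc) (ρ : ℕ → ℕ) :
    P.renP ρ = P.substP (fun n => .var (ρ n)) := by
  rw [← Proc.substP_var (P.renP ρ), Proc.substP_renP]

theorem Proc.instP_substP (P Q : Proc) (σ : ℕ → Proc) :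
    (P.instP Q).substP σ = (P.substP (upProc σ)).instP (Q.substP σ) := by
  simp only [Proc.instP_eq, Proc.substP_substP]
  congr 1
  funext n
  cases n with
  | zero => rfl
  | succ n =>
    simp only [Proc.single, Proc.substP, upProc, Proc.substP_renP]
    exact (Proc.substP_var _).symm

theorem Proc.instP_substE (P Q : Proc) (σ : ℕ → Expr) :
    (P.instP Q).substE σ = (P.substE σ).instP (Q.substE σ) := by
  simp only [Proc.instP_eq, Proc.substE_substP]
  congr 1
  funext n
  cases n <;> rfl

theorem Proc.Cong.substE {P Q : Proc} (h : P.Cong Q) (σ : ℕ → Expr) :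
    (P.substE σ).Cong (Q.substE σ) := by
  induction h generalizing σ with
  | refl P => exact .refl _
  | symm _ ih => exact (ih σ).symm
  | trans _ _ ih₁ ih₂ => exact (ih₁ σ).trans (ih₂ σ)
  | unfold P =>
    rw [Proc.instP_substE]
    exact .unfold _
  | ext q I _ ih => exact .ext q I fun i => ih i _
  | out q ℓ e _ ih => exact .out q ℓ _ (ih σ)
  | cond e _ _ ih₁ ih₂ => exact .cond _ (ih₁ σ) (ih₂ σ)
  | mu _ ih => exact .mu (ih σ)

theorem Proc.Cong.renE {P Q : Proc} (h : P.Cong Q) (ρ : ℕ → ℕ) :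
    (P.renE ρ).Cong (Q.renE ρ) := by
  simpa only [Proc.renE_eq_substE] using h.substE _

theorem Proc.Cong.substP {P Q : Proc} (h : P.Cong Q) (σ : ℕ → Proc) :
    (P.substP σ).Cong (Q.substP σ) := by
  induction h generalizing σ with
  | refl P => exact .refl _
  | symm _ ih => exact (ih σ).symm
  | trans _ _ ih₁ ih₂ => exact (ih₁ σ).trans (ih₂ σ)
  | unfold P =>
    rw [Proc.instP_substP]
    exact .unfold _
  | ext q I _ ih => exact .ext q I fun i => ih i _
  | out q ℓ e _ ih => exact .out q ℓ _ (ih σ)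
  | cond e _ _ ih₁ ih₂ => exact .cond _ (ih₁ σ) (ih₂ σ)
  | mu _ ih => exact .mu (ih _)

theorem Proc.Cong.renP {P Q : Proc} (h : P.Cong Q) (ρ : ℕ → ℕ) :
    (P.renP ρ).Cong (Q.renP ρ) := by
  simpa only [Proc.renP_eq_substP] using h.substP _

theorem Proc.cong_substP (P : Proc) {σ τ : ℕ → Proc} (h : ∀ n, (σ n).Cong (τ n)) :
    (P.substP σ).Cong (P.substP τ) := by
  induction P generalizing σ τ with
  | ext q I P ih => exact .ext q I fun i => ih i fun n => (h n).renE _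
  | out q ℓ e P ih => exact .out q ℓ e (ih h)
  | cond e P Q ih₁ ih₂ => exact .cond e (ih₁ h) (ih₂ h)
  | var X => exact h X
  | mu P ih =>
    refine .mu (ih fun n => ?_)
    cases n with
    | zero => exact .refl _
    | succ n => exact (h n).renP _
  | nil => exact .refl _

/-! ## Heads of processes -/

/-- The process has no recursion binder at its head. -/
def Proc.IsHead : Proc → Prop
  | .mu _ => False
  | _ => True

/-- `P.HeadIn k N`: `k` unfoldings of recursion binders at the head of `P` lead to `N`, which has no
recursion binder at its head. -/
inductive Proc.HeadIn : ℕ → Proc → Proc → Prop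
  | head {N : Proc} : N.IsHead → Proc.HeadIn 0 N N
  | mu {k : ℕ} {P N : Proc} : Proc.HeadIn k (P.instP (.mu P)) N → Proc.HeadIn (k + 1) (.mu P) N

/-- Two processes without recursion binder at the head agree at the head, up to congruence of the
continuations. -/
inductive Proc.SameHead : Proc → Proc → Prop
  | ext (q : Participant) (I : Finset Label) {P Q : I → Proc} :
      (∀ i, (P i).Cong (Q i)) → Proc.SameHead (.ext q I P) (.ext q I Q)
  | out (q : Participant) (ℓ : Label) (e : Expr) {P Q : Proc} :
      P.Cong Q → Proc.SameHead (.out q ℓ e P) (.out q ℓ e Q)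
  | cond (e : Expr) {P P' Q Q' : Proc} : P.Cong P' → Q.Cong Q' →
      Proc.SameHead (.cond e P Q) (.cond e P' Q')
  | var (X : ℕ) : Proc.SameHead (.var X) (.var X)
  | nil : Proc.SameHead .nil .nil

theorem Proc.SameHead.refl {N : Proc} (h : N.IsHead) : N.SameHead N := by
  cases N with
  | ext q I P => exact .ext q I fun _ => .refl _
  | out q ℓ e P => exact .out q ℓ e (.refl _)
  | cond e P Q => exact .cond e (.refl _) (.refl _)
  | var X => exact .var X
  | mu P => exact h.elim
  | nil => exact .nil

theorem Proc.SameHead.trans {M N O : Proc} (h : M.SameHead N) (h' : N.SameHead O) :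
    M.SameHead O := by
  cases h with
  | ext q I h =>
    cases h' with
    | ext _ _ h' => exact .ext q I fun i => (h i).trans (h' i)
  | out q ℓ e h =>
    cases h' with
    | out _ _ _ h' => exact .out q ℓ e (h.trans h')
  | cond e h₁ h₂ =>
    cases h' with
    | cond _ h₁' h₂' => exact .cond e (h₁.trans h₁') (h₂.trans h₂')
  | var X => exact h'
  | nil => exact h'

theorem Proc.HeadIn.isHead {k : ℕ} {P N : Proc} (h : P.HeadIn k N) : N.IsHead := by
  induction h with
  | head h => exact h
  | mu _ ih => exact ih

theorem Proc.HeadIn.eq_of_isHead {k : ℕ} {P N : Proc} (h : Proc.HeadIn k P N) (hP : P.IsHead) :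
    N = P := by
  cases h with
  | head h => rfl
  | mu _ => exact hP.elim

theorem Proc.HeadIn.substP {a b : ℕ} {P N₀ N : Proc} {σ : ℕ → Proc} (h : Proc.HeadIn a P N₀)
    (h' : Proc.HeadIn b (N₀.substP σ) N) : ∃ k, Proc.HeadIn k (P.substP σ) N := by
  induction h with
  | head _ => exact ⟨b, h'⟩
  | mu _ ih =>
    obtain ⟨k, hk⟩ := ih h'
    rw [Proc.instP_substP] at hk
    exact ⟨k + 1, .mu hk⟩

theorem Proc.HeadIn.of_substP {k : ℕ} {X N : Proc} (h : Proc.HeadIn k X N) (P : Proc)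
    (σ : ℕ → Proc) (hX : X = P.substP σ) :
    ∃ (N₀ : Proc) (a b : ℕ), Proc.HeadIn a P N₀ ∧ Proc.HeadIn b (N₀.substP σ) N ∧ a + b = k := by
  induction h generalizing P with
  | head hN =>
    subst hX
    refine ⟨P, 0, 0, .head ?_, .head hN, rfl⟩
    cases P <;> trivial
  | @mu k P' N h ih =>
    by_cases hP : P.IsHead
    · exact ⟨P, 0, k + 1, .head hP, hX ▸ .mu h, by omega⟩
    · cases P with
      | mu P =>
        simp only [Proc.substP, Proc.mu.injEq] at hX
        subst hX
        obtain ⟨N₀, a, b, ha, hb, hab⟩ := ih (P.instP (.mu P)) (Proc.instP_substP P (.mu P) σ).symm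
        exact ⟨N₀, a + 1, b, .mu ha, hb, by omega⟩
      | _ => exact (hP trivial).elim

theorem Proc.HeadIn.mu_cong {P Q : Proc} (hc : P.Cong Q)
    (ih : ∀ k N, Proc.HeadIn k P N → ∃ k' N', Proc.HeadIn k' Q N' ∧ N.SameHead N') (k : ℕ) :
    ∀ N, Proc.HeadIn k (.mu P) N → ∃ k' N', Proc.HeadIn k' (.mu Q) N' ∧ N.SameHead N' := by
  induction k using Nat.strong_induction_on with
  | _ k IH =>
    intro N h
    cases h with
    | head h => exact h.elim
    | @mu k _ _ h =>
      obtain ⟨N₀, a, b, ha, hb, hab⟩ := h.of_substP P _ (Proc.instP_eq _ _)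
      obtain ⟨a', N₁, ha', hs⟩ := ih a N₀ ha
      suffices H : ∃ b' N', Proc.HeadIn b' (N₁.substP (Proc.single (.mu Q))) N' ∧ N.SameHead N' by
        obtain ⟨b', N', hb', hs'⟩ := H
        obtain ⟨k', hk'⟩ := ha'.substP hb'
        rw [← Proc.instP_eq] at hk'
        exact ⟨k' + 1, N', .mu hk', hs'⟩
      have key : ∀ n, (Proc.single (.mu P) n).Cong (Proc.single (.mu Q) n) := by
        intro n
        cases n with
        | zero => exact .mu hc
        | succ n => exact .refl _
      cases hs with
      | ext q I hi =>
        obtain rfl := hb.eq_of_isHead trivial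
        exact ⟨0, _, .head trivial, .ext q I fun i =>
          ((hi i).substP _).trans (Proc.cong_substP _ fun n => (key n).renE _)⟩
      | out q ℓ e hi =>
        obtain rfl := hb.eq_of_isHead trivial
        exact ⟨0, _, .head trivial, .out q ℓ e ((hi.substP _).trans (Proc.cong_substP _ key))⟩
      | cond e h₁ h₂ =>
        obtain rfl := hb.eq_of_isHead trivial
        exact ⟨0, _, .head trivial, .cond e ((h₁.substP _).trans (Proc.cong_substP _ key))
          ((h₂.substP _).trans (Proc.cong_substP _ key))⟩
      | nil =>
        obtain rfl := hb.eq_of_isHead trivial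
        exact ⟨0, _, .head trivial, .nil⟩
      | var X =>
        cases X with
        | zero => exact IH b (by omega) N hb
        | succ X =>
          obtain rfl := hb.eq_of_isHead trivial
          exact ⟨0, _, .head trivial, .var X⟩

theorem Proc.Cong.headIn {P Q : Proc} (h : P.Cong Q) :
    (∀ k N, Proc.HeadIn k P N → ∃ k' N', Proc.HeadIn k' Q N' ∧ N.SameHead N') ∧
      ∀ k N, Proc.HeadIn k Q N → ∃ k' N', Proc.HeadIn k' P N' ∧ N.SameHead N' := by
  induction h with
  | refl P => exact ⟨fun k N h => ⟨k, N, h, .refl h.isHead⟩, fun k N h => ⟨k, N, h, .refl h.isHead⟩⟩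
  | symm _ ih => exact ⟨ih.2, ih.1⟩
  | trans _ _ ih₁ ih₂ =>
    constructor
    · intro k N h
      obtain ⟨k', N', h', hs⟩ := ih₁.1 k N h
      obtain ⟨k'', N'', h'', hs'⟩ := ih₂.1 k' N' h'
      exact ⟨k'', N'', h'', hs.trans hs'⟩
    · intro k N h
      obtain ⟨k', N', h', hs⟩ := ih₂.2 k N h
      obtain ⟨k'', N'', h'', hs'⟩ := ih₁.2 k' N' h'
      exact ⟨k'', N'', h'', hs.trans hs'⟩
  | unfold P =>
    constructor
    · intro k N h
      cases h with
      | head h => exact h.elim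
      | mu h => exact ⟨_, N, h, .refl h.isHead⟩
    · intro k N h
      exact ⟨k + 1, N, .mu h, .refl h.isHead⟩
  | ext q I h _ =>
    constructor
    · intro k N hk
      obtain rfl := hk.eq_of_isHead trivial
      exact ⟨0, _, .head trivial, .ext q I h⟩
    · intro k N hk
      obtain rfl := hk.eq_of_isHead trivial
      exact ⟨0, _, .head trivial, .ext q I fun i => (h i).symm⟩
  | out q ℓ e h _ =>
    constructor
    · intro k N hk
      obtain rfl := hk.eq_of_isHead trivial
      exact ⟨0, _, .head trivial, .out q ℓ e h⟩
    · intro k N hk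
      obtain rfl := hk.eq_of_isHead trivial
      exact ⟨0, _, .head trivial, .out q ℓ e h.symm⟩
  | cond e h₁ h₂ _ _ =>
    constructor
    · intro k N hk
      obtain rfl := hk.eq_of_isHead trivial
      exact ⟨0, _, .head trivial, .cond e h₁ h₂⟩
    · intro k N hk
      obtain rfl := hk.eq_of_isHead trivial
      exact ⟨0, _, .head trivial, .cond e h₁.symm h₂.symm⟩
  | mu h ih => exact ⟨Proc.HeadIn.mu_cong h ih.1, Proc.HeadIn.mu_cong h.symm ih.2⟩

/-- As for types, this is the tool that reads off the next action of a process known only up to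
congruence. -/
theorem Proc.Cong.sameHead {P Q : Proc} (h : P.Cong Q) (hP : P.IsHead) (hQ : Q.IsHead) :
    P.SameHead Q := by
  obtain ⟨k, N, hN, hs⟩ := h.headIn.1 0 P (.head hP)
  obtain rfl := hN.eq_of_isHead hQ
  exact hs

/-! ## Actions of congruent processes -/

theorem Proc.actions_substE (P : Proc) (σ : ℕ → Expr) : (P.substE σ).actions = P.actions := by
  induction P generalizing σ <;> simp_all [Proc.substE, Proc.actions]

theorem Proc.actions_renP (P : Proc) (ρ : ℕ → ℕ) : (P.renP ρ).actions = P.actions := by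
  induction P generalizing ρ <;> simp_all [Proc.renP, Proc.actions]

theorem Proc.actions_subset_substP (P : Proc) (σ : ℕ → Proc) :
    P.actions ⊆ (P.substP σ).actions := by
  induction P generalizing σ with
  | ext q I P ih =>
    exact Set.union_subset_union_right _ (Set.iUnion_mono fun i => ih i _)
  | out q ℓ e P ih => exact Set.union_subset_union_right _ (ih σ)
  | cond e P Q ih₁ ih₂ => exact Set.union_subset_union (ih₁ σ) (ih₂ σ)
  | var X => exact Set.empty_subset _
  | mu P ih => exact ih _
  | nil => exact Set.empty_subset _

theorem Proc.actions_substP_subset (P : Proc) (σ : ℕ → Proc) (A : Set Action)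
    (hP : P.actions ⊆ A) (h : ∀ n, (σ n).actions ⊆ A) : (P.substP σ).actions ⊆ A := by
  induction P generalizing σ with
  | ext q I P ih =>
    simp only [Proc.actions, Set.union_subset_iff, Set.iUnion_subset_iff, Proc.substP] at hP ⊢
    refine ⟨hP.1, fun i => ih i _ (hP.2 i) fun n => ?_⟩
    rw [Proc.renE_eq_substE, Proc.actions_substE]
    exact h n
  | out q ℓ e P ih =>
    simp only [Proc.actions, Set.union_subset_iff, Proc.substP] at hP ⊢
    exact ⟨hP.1, ih _ hP.2 h⟩
  | cond e P Q ih₁ ih₂ =>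
    simp only [Proc.actions, Set.union_subset_iff, Proc.substP] at hP ⊢
    exact ⟨ih₁ _ hP.1 h, ih₂ _ hP.2 h⟩
  | var X => exact h X
  | mu P ih =>
    refine ih _ hP fun n => ?_
    cases n with
    | zero => exact Set.empty_subset _
    | succ n =>
      rw [upProc, Proc.actions_renP]
      exact h n
  | nil => exact Set.empty_subset _

/-- The rules for orphan messages and starvation inspect the actions of a process, so these must not
depend on the representative. Unfolding adds nothing, as the inserted copy has the actions of the
body. -/
theorem Proc.Cong.actions_eq {P Q : Proc} (h : P.Cong Q) : P.actions = Q.actions := by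
  induction h with
  | refl P => rfl
  | symm _ ih => exact ih.symm
  | trans _ _ ih₁ ih₂ => exact ih₁.trans ih₂
  | unfold P =>
    rw [Proc.instP_eq]
    refine (Proc.actions_subset_substP P _).antisymm
      (Proc.actions_substP_subset P _ _ (le_refl _) fun n => ?_)
    cases n with
    | zero => exact le_refl _
    | succ n => exact Set.empty_subset _
  | ext q I _ ih => simp [Proc.actions, ih]
  | out q ℓ e _ ih => simp [Proc.actions, ih]
  | cond e _ _ ih₁ ih₂ => simp [Proc.actions, ih₁, ih₂]
  | mu _ ih => exact ih

/-! ## Sorting and evaluation of expressions -/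

/-- Sorting bounds the variables of `e` by the length of `Θ`; this is how `f` and `datum` are
recognised as closed under the relevant binders. -/
theorem HasSort.subst_eq_self {Θ : List Srt} {e : Expr} {S : Srt} (h : HasSort Θ e S)
    {σ : ℕ → Expr} (hσ : ∀ x < Θ.length, σ x = .var x) : e.subst σ = e := by
  induction h with
  | var x S hx =>
    obtain ⟨hx, -⟩ := List.getElem?_eq_some_iff.1 hx
    exact hσ x hx
  | sub _ _ ih => exact ih
  | _ => simp_all [Expr.subst]

theorem HasSort.subst {Θ Θ' : List Srt} {e : Expr} {S : Srt} (h : HasSort Θ e S)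
    {σ : ℕ → Expr} (hσ : ∀ x S, Θ[x]? = some S → HasSort Θ' (σ x) S) :
    HasSort Θ' (e.subst σ) S := by
  induction h with
  | pos n hn => exact .pos _ n hn
  | nonpos n hn => exact .nonpos _ n hn
  | bool b => exact .bool _ b
  | unit => exact .unit _
  | var x S hx => exact hσ x S hx
  | succ _ ih => exact .succ ih
  | inv _ ih => exact .inv ih
  | neg _ ih => exact .neg ih
  | gtz _ ih => exact .gtz ih
  | isUnit _ ih => exact .isUnit ih
  | sub _ hS ih => exact .sub ih hS

/-- The values of a sort. -/
def Val.HasSrt : Val → Srt → Prop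
  | .int n, .nat => 0 < n
  | .int _, .int => True
  | .bool _, .bool => True
  | .unit, .unit => True
  | _, _ => False

theorem Val.HasSrt.mono {v : Val} {S S' : Srt} (h : v.HasSrt S) (hS : S.Le S') : v.HasSrt S' := by
  cases hS with
  | refl => exact h
  | natInt =>
    cases v with
    | int n => trivial
    | bool b => exact h
    | unit => exact h

theorem HasSort.val_int (Θ : List Srt) (n : ℤ) : HasSort Θ (.val (.int n)) .int := by
  rcases lt_or_ge 0 n with h | h
  · exact .sub (.pos Θ n h) .natInt
  · exact .nonpos Θ n h

theorem hasSort_val_iff {Θ : List Srt} {v : Val} {S : Srt} :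
    HasSort Θ (.val v) S ↔ v.HasSrt S := by
  constructor
  · intro h
    generalize he : Expr.val v = e at h
    induction h with
    | pos n hn => cases he; exact hn
    | nonpos n hn => cases he; trivial
    | bool b => cases he; trivial
    | unit => cases he; trivial
    | sub _ hS ih => exact (ih he).mono hS
    | _ => cases he
  · intro h
    cases v with
    | int n =>
      cases S with
      | nat => exact .pos _ _ h
      | int => exact .val_int _ _
      | bool => exact h.elim
      | unit => exact h.elim
    | bool b =>
      cases S with
      | bool => exact .bool _ _
      | _ => exact h.elim
    | unit =>
      cases S with
      | unit => exact .unit _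
      | _ => exact h.elim

/-- Every sort has a value. -/
theorem exists_hasSort_val (Θ : List Srt) (S : Srt) : ∃ v, HasSort Θ (.val v) S := by
  cases S with
  | nat => exact ⟨.int 1, .pos _ _ one_pos⟩
  | int => exact ⟨.int 0, .val_int _ _⟩
  | bool => exact ⟨.bool true, .bool _ _⟩
  | unit => exact ⟨.unit, .unit _⟩

/-- The replacement property behind the context rule of evaluation. Subsumption may end the
derivation at any level, hence the inner induction on derivations for every constructor. -/
theorem HasSort.fill_inv {Θ : List Srt} (E : ECtx) {e : Expr} {S : Srt}
    (h : HasSort Θ (E.fill e) S) :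
    ∃ S', HasSort Θ e S' ∧ ∀ e', HasSort Θ e' S' → HasSort Θ (E.fill e') S := by
  induction E generalizing S with
  | hole => exact ⟨S, h, fun _ h => h⟩
  | succ E ih =>
    generalize hx : (ECtx.succ E).fill e = x at h
    induction h with
    | succ h _ =>
      cases hx
      obtain ⟨S', h₁, h₂⟩ := ih h
      exact ⟨S', h₁, fun e' h' => .succ (h₂ e' h')⟩
    | sub _ hS ih' =>
      obtain ⟨S', h₁, h₂⟩ := ih' hx
      exact ⟨S', h₁, fun e' h' => .sub (h₂ e' h') hS⟩
    | _ => cases hx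
  | inv E ih =>
    generalize hx : (ECtx.inv E).fill e = x at h
    induction h with
    | inv h _ =>
      cases hx
      obtain ⟨S', h₁, h₂⟩ := ih h
      exact ⟨S', h₁, fun e' h' => .inv (h₂ e' h')⟩
    | sub _ hS ih' =>
      obtain ⟨S', h₁, h₂⟩ := ih' hx
      exact ⟨S', h₁, fun e' h' => .sub (h₂ e' h') hS⟩
    | _ => cases hx
  | neg E ih =>
    generalize hx : (ECtx.neg E).fill e = x at h
    induction h with
    | neg h _ =>
      cases hx
      obtain ⟨S', h₁, h₂⟩ := ih h
      exact ⟨S', h₁, fun e' h' => .neg (h₂ e' h')⟩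
    | sub _ hS ih' =>
      obtain ⟨S', h₁, h₂⟩ := ih' hx
      exact ⟨S', h₁, fun e' h' => .sub (h₂ e' h') hS⟩
    | _ => cases hx
  | gtz E ih =>
    generalize hx : (ECtx.gtz E).fill e = x at h
    induction h with
    | gtz h _ =>
      cases hx
      obtain ⟨S', h₁, h₂⟩ := ih h
      exact ⟨S', h₁, fun e' h' => .gtz (h₂ e' h')⟩
    | sub _ hS ih' =>
      obtain ⟨S', h₁, h₂⟩ := ih' hx
      exact ⟨S', h₁, fun e' h' => .sub (h₂ e' h') hS⟩
    | _ => cases hx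

/-- The premises of the sorting rule for the outermost operation of an expression. -/
def Expr.SortInv (Θ : List Srt) (S : Srt) : Expr → Prop
    | .succ e => HasSort Θ e .nat ∧ Srt.Le .nat S
    | .inv e => HasSort Θ e .int ∧ S = .int
    | .neg e => HasSort Θ e .bool ∧ S = .bool
    | .gtz e => HasSort Θ e .int ∧ S = .bool
    | .isUnit e => HasSort Θ e .unit ∧ S = .bool
    | _ => True

/-- Subsumption can only turn `nat` into `int`, so the successor is the only operation whose result
sort is not determined. -/
theorem HasSort.sortInv {Θ : List Srt} {x : Expr} {S : Srt} (h : HasSort Θ x S) :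
    x.SortInv Θ S := by
  induction h with
  | @sub e _ _ h hS ih =>
    cases hS with
    | refl => exact ih
    | natInt => cases e <;> simp_all [Expr.SortInv, Srt.Le.natInt]
  | succ h => exact ⟨h, .refl _⟩
  | inv h => exact ⟨h, rfl⟩
  | neg h => exact ⟨h, rfl⟩
  | gtz h => exact ⟨h, rfl⟩
  | isUnit h => exact ⟨h, rfl⟩
  | _ => trivial

/-- Preservation of sorts by evaluation. -/
theorem Eval.hasSort {e : Expr} {v : Val} (h : Eval e v) {S : Srt} (hS : HasSort [] e S) :
    HasSort [] (.val v) S := by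
  induction h generalizing S with
  | val v => exact hS
  | succ n hn => exact .sub (.pos _ _ (by omega)) hS.sortInv.2
  | inv i =>
    obtain ⟨-, rfl⟩ := hS.sortInv
    exact .val_int _ _
  | neg b =>
    obtain ⟨-, rfl⟩ := hS.sortInv
    exact .bool _ _
  | isUnit =>
    obtain ⟨-, rfl⟩ := hS.sortInv
    exact .bool _ _
  | gtzTrue e n _ _ _ =>
    obtain ⟨-, rfl⟩ := hS.sortInv
    exact .bool _ _
  | gtzFalse e n _ _ _ =>
    obtain ⟨-, rfl⟩ := hS.sortInv
    exact .bool _ _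
  | ctx E e v v' _ _ ih₁ ih₂ =>
    obtain ⟨S', h₁, h₂⟩ := hS.fill_inv
    exact ih₂ (h₂ _ (ih₁ h₁))

/-- Well-sorted closed expressions evaluate. -/
theorem HasSort.exists_eval {e : Expr} {S : Srt} (h : HasSort [] e S) : ∃ v, Eval e v := by
  induction h with
  | pos n _ => exact ⟨_, .val _⟩
  | nonpos n _ => exact ⟨_, .val _⟩
  | bool b => exact ⟨_, .val _⟩
  | unit => exact ⟨_, .val _⟩
  | var x S hx =>
    simp at hx
  | @succ e h ih =>
    obtain ⟨v, hv⟩ := ih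
    -- A value of sort `nat` is a positive integer, which is exactly where the successor is defined.
    have := hasSort_val_iff.1 (hv.hasSort h)
    cases v with
    | int n => exact ⟨_, .ctx (.succ .hole) e _ _ hv (.succ n this)⟩
    | _ => exact this.elim
  | @inv e h ih =>
    obtain ⟨v, hv⟩ := ih
    have := hasSort_val_iff.1 (hv.hasSort h)
    cases v with
    | int n => exact ⟨_, .ctx (.inv .hole) e _ _ hv (.inv n)⟩
    | _ => exact this.elim
  | @neg e h ih =>
    obtain ⟨v, hv⟩ := ih
    have := hasSort_val_iff.1 (hv.hasSort h)
    cases v with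
    | bool b => exact ⟨_, .ctx (.neg .hole) e _ _ hv (.neg b)⟩
    | _ => exact this.elim
  | @gtz e h ih =>
    obtain ⟨v, hv⟩ := ih
    have := hasSort_val_iff.1 (hv.hasSort h)
    cases v with
    | int n =>
      rcases lt_or_ge 0 n with hn | hn
      · exact ⟨_, .gtzTrue e n hn hv⟩
      · exact ⟨_, .gtzFalse e n hn hv⟩
    | _ => exact this.elim
  | @isUnit e h _ =>
    -- No evaluation context enters `≈`, so the argument must already be the unit value. It is: no
    -- operation produces sort `unit`, a closed expression has no variables, and no other sort lies
    -- below `unit`.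
    obtain rfl : e = .val .unit := by
      generalize hS : Srt.unit = S at h
      induction h with
      | unit => rfl
      | var x S hx =>
        simp at hx
      | sub _ hS' ih =>
        subst hS
        cases hS'
        exact ih ‹_› rfl
      | _ => cases hS
    exact ⟨_, .isUnit⟩
  | sub _ _ ih => exact ih

end AsyncMPST

/-! ### Queues, deterministic protocols and liveness of their environments. -/

namespace AsyncMPST

/-! ## Queues up to congruence -/

section Queues

variable {α : Type}

/-- The messages to `q` in a queue, from the oldest to the newest. -/
def proj (q : Participant) (h : List (Participant × α)) : List α :=
  h.filterMap fun m => if m.1 = q then some m.2 else none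

@[simp] theorem proj_nil (q : Participant) : proj q ([] : List (Participant × α)) = [] := rfl

theorem proj_append (q : Participant) (h h' : List (Participant × α)) :
    proj q (h ++ h') = proj q h ++ proj q h' :=
  List.filterMap_append

theorem proj_cons_self (q : Participant) (a : α) (h : List (Participant × α)) :
    proj q ((q, a) :: h) = a :: proj q h := by
  simp [proj]

theorem proj_cons_of_ne {q p : Participant} (hpq : p ≠ q) (a : α)
    (h : List (Participant × α)) : proj q ((p, a) :: h) = proj q h := by
  simp [proj, hpq]

/-- A swap exchanges messages to different recipients, so the order seen by one recipient never
changes. Projections thus serve as invariants of queues up to congruence. -/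
theorem QCong.proj_eq {h h' : List (Participant × α)} (hh : QCong h h') (q : Participant) :
    proj q h = proj q h' := by
  induction hh with
  | rel _ _ hs =>
    obtain ⟨h₁, h₂, ⟨p₁, a₁⟩, ⟨p₂, a₂⟩, hne⟩ := hs
    simp only [proj_append]
    congr 1
    by_cases h₁ : p₁ = q
    · subst h₁
      rw [proj_cons_self, proj_cons_of_ne (Ne.symm hne), proj_cons_of_ne (Ne.symm hne),
        proj_cons_self]
    · rw [proj_cons_of_ne h₁]
      by_cases h₂ : p₂ = q
      · subst h₂
        rw [proj_cons_self, proj_cons_self, proj_cons_of_ne h₁]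
      · rw [proj_cons_of_ne h₂, proj_cons_of_ne h₂, proj_cons_of_ne h₁]
  | refl _ => rfl
  | symm _ _ _ ih => exact ih.symm
  | trans _ _ _ _ _ ih₁ ih₂ => exact ih₁.trans ih₂

theorem QCong.cons {h h' : List (Participant × α)} (hh : QCong h h') (m : Participant × α) :
    QCong (m :: h) (m :: h') := by
  induction hh with
  | rel _ _ hs =>
    obtain ⟨h₁, h₂, m₁, m₂, hne⟩ := hs
    exact .rel _ _ (.swap (m :: h₁) h₂ m₁ m₂ hne)
  | refl _ => exact .refl _
  | symm _ _ _ ih => exact ih.symm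
  | trans _ _ _ _ _ ih₁ ih₂ => exact ih₁.trans _ _ _ ih₂

/-- The first message to `q` can be moved to the head of the queue. -/
theorem exists_qcong_cons {q : Participant} {h : List (Participant × α)} {a : α} {l : List α}
    (hq : proj q h = a :: l) : ∃ h', QCong h ((q, a) :: h') := by
  induction h with
  | nil => cases hq
  | cons m h ih =>
    obtain ⟨p, b⟩ := m
    by_cases hp : p = q
    · subst hp
      rw [proj_cons_self] at hq
      obtain ⟨rfl, rfl⟩ := List.cons.inj hq
      exact ⟨h, .refl _⟩
    · rw [proj_cons_of_ne hp] at hq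
      obtain ⟨h', hh'⟩ := ih hq
      exact ⟨(p, b) :: h', (hh'.cons _).trans _ _ _ (.rel _ _ (.swap [] h' _ _ hp))⟩

end Queues

/-! ## Deterministic protocols -/

/-- What a participant does next. -/
inductive Act where
  | idle
  | send (q : Participant)
  | recv (q : Participant)
  deriving DecidableEq

/-- A protocol in which every participant `p` performs a fixed sequence of actions `act p`, the
channel from `p` to `q` carries a fixed sequence of messages `msg p q`, and every reception comes
after the transmission of its message with respect to a ranking of the actions.
`sent p q n` (resp. `rcvd p q n`) counts the messages that `p` has sent to `q` (resp. received from
`q`) in its first `n` actions. -/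
structure Protocol where
  act : Participant → ℕ → Act
  msg : Participant → Participant → ℕ → Label × Srt
  sent : Participant → Participant → ℕ → ℕ
  rcvd : Participant → Participant → ℕ → ℕ
  rank : Participant → ℕ → ℕ
  sent_zero : ∀ p q, sent p q 0 = 0
  rcvd_zero : ∀ p q, rcvd p q 0 = 0
  sent_succ : ∀ p q n, sent p q (n + 1) = sent p q n + if act p n = .send q then 1 else 0
  rcvd_succ : ∀ p q n, rcvd p q (n + 1) = rcvd p q n + if act p n = .recv q then 1 else 0
  rank_lt : ∀ p n, rank p n < rank p (n + 1)
  rcvd_lt_sent : ∀ p q n m, act p n = .recv q → rank p n ≤ rank q m → rcvd p q n < sent q p m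
  ne_of_recv : ∀ p q n, act p n = .recv q → p ≠ q
  -- A participant acts always or never, and on each channel in use sends and receptions recur
  -- forever. Liveness and the exclusion of orphans, starvation and deadlocks rest on this.
  idle_of_idle : ∀ p n m, act p n = .idle → act p m = .idle
  recv_later : ∀ p q m N, act p m = .send q → ∃ n, N ≤ n ∧ act q n = .recv p
  send_later : ∀ p q m N, act p m = .recv q → ∃ n, N ≤ n ∧ act q n = .send p

/-- One more action of `p`. -/
def tick (c : Participant → ℕ) (p : Participant) : Participant → ℕ :=
  Function.update c p (c p + 1)

@[simp] theorem tick_self (c : Participant → ℕ) (p : Participant) : tick c p p = c p + 1 :=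
  Function.update_self ..

theorem tick_of_ne (c : Participant → ℕ) {p q : Participant} (h : q ≠ p) : tick c p q = c q :=
  Function.update_of_ne h ..

namespace Protocol

variable (P : Protocol)

/-- No participant has received more than was sent. -/
def Consistent (c : Participant → ℕ) : Prop :=
  ∀ p q, P.rcvd q p (c q) ≤ P.sent p q (c p)

/-- The messages from `p` to `q` in transit, after `c r` actions of every participant `r`. -/
def pending (c : Participant → ℕ) (p q : Participant) : List (Label × Srt) :=
  (List.range' (P.rcvd q p (c q)) (P.sent p q (c p) - P.rcvd q p (c q))).map (P.msg p q)

theorem sent_mono (p q : Participant) : Monotone (P.sent p q) :=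
  monotone_nat_of_le_succ fun n => by rw [P.sent_succ]; omega

theorem le_rank (p : Participant) (n : ℕ) : n ≤ P.rank p n :=
  (strictMono_nat_of_lt_succ (P.rank_lt p)).le_apply

theorem consistent_zero : P.Consistent fun _ => 0 := fun p q => by
  rw [P.rcvd_zero]
  exact Nat.zero_le _

theorem pending_zero (p q : Participant) : P.pending (fun _ => 0) p q = [] := by
  simp [pending, P.sent_zero]

variable {P}

theorem pending_eq_cons {c : Participant → ℕ} {p q : Participant}
    (h : P.rcvd q p (c q) < P.sent p q (c p)) :
    ∃ l, P.pending c p q = P.msg p q (P.rcvd q p (c q)) :: l := by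
  obtain ⟨k, hk⟩ : ∃ k, P.sent p q (c p) - P.rcvd q p (c q) = k + 1 :=
    ⟨P.sent p q (c p) - P.rcvd q p (c q) - 1, by omega⟩
  rw [pending, hk, List.range'_succ, List.map_cons]
  exact ⟨_, rfl⟩

theorem lt_of_pending_eq_cons {c : Participant → ℕ} {p q : Participant} {m : Label × Srt}
    {l : List (Label × Srt)} (h : P.pending c p q = m :: l) :
    P.rcvd q p (c q) < P.sent p q (c p) ∧ m = P.msg p q (P.rcvd q p (c q)) := by
  have hlt : P.rcvd q p (c q) < P.sent p q (c p) := by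
    by_contra hle
    rw [pending, Nat.sub_eq_zero_of_le (not_lt.1 hle)] at h
    cases h
  obtain ⟨l', hl'⟩ := pending_eq_cons hlt
  rw [hl'] at h
  exact ⟨hlt, (List.cons.inj h).1.symm⟩

theorem exists_send_of_lt {p q : Participant} {n k : ℕ} (h : k < P.sent p q n) :
    ∃ m, P.act p m = .send q := by
  by_contra hne
  push Not at hne
  have h0 : ∀ n, P.sent p q n = 0 := by
    intro n
    induction n with
    | zero => exact P.sent_zero p q
    | succ n ih => rw [P.sent_succ, ih, if_neg (hne n)]
  rw [h0] at h
  omega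

theorem consistent_send {c : Participant → ℕ} {p q : Participant} (hc : P.Consistent c)
    (ha : P.act p (c p) = .send q) : P.Consistent (tick c p) := by
  intro r s
  have h₁ : P.sent r s (c r) ≤ P.sent r s (tick c p r) := by
    refine P.sent_mono r s ?_
    by_cases h : r = p
    · subst h; simp
    · rw [tick_of_ne _ h]
  have h₂ : P.rcvd s r (tick c p s) = P.rcvd s r (c s) := by
    by_cases h : s = p
    · subst h; simp [P.rcvd_succ, ha]
    · rw [tick_of_ne _ h]
  have := hc r s
  omega

theorem pending_send_self {c : Participant → ℕ} {p q : Participant} (hc : P.Consistent c)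
    (ha : P.act p (c p) = .send q) :
    P.pending (tick c p) p q = P.pending c p q ++ [P.msg p q (P.sent p q (c p))] := by
  have h₂ : P.rcvd q p (tick c p q) = P.rcvd q p (c q) := by
    by_cases h : q = p
    · subst h; simp [P.rcvd_succ, ha]
    · rw [tick_of_ne _ h]
  have hle := hc p q
  rw [pending, pending, h₂, tick_self, P.sent_succ, if_pos ha,
    show P.sent p q (c p) + 1 - P.rcvd q p (c q) = P.sent p q (c p) - P.rcvd q p (c q) + 1 by omega,
    List.range'_concat, List.map_append]
  congr 3
  simp only [List.map_cons, List.map_nil, one_mul]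
  congr
  omega

theorem pending_send_of_ne {c : Participant → ℕ} {p q : Participant}
    (ha : P.act p (c p) = .send q) {r s : Participant} (h : r ≠ p ∨ s ≠ q) :
    P.pending (tick c p) r s = P.pending c r s := by
  have h₁ : P.sent r s (tick c p r) = P.sent r s (c r) := by
    by_cases hr : r = p
    · subst hr
      have hs : q ≠ s := fun e => h.elim (fun h => h rfl) (fun h => h e.symm)
      simp [P.sent_succ, ha, hs]
    · rw [tick_of_ne _ hr]
  have h₂ : P.rcvd s r (tick c p s) = P.rcvd s r (c s) := by
    by_cases hs : s = p
    · subst hs; simp [P.rcvd_succ, ha]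
    · rw [tick_of_ne _ hs]
  rw [pending, pending, h₁, h₂]

/-- In contrast to a send, a reception preserves consistency only if its message is in transit. -/
theorem consistent_recv {c : Participant → ℕ} {p q : Participant} (hc : P.Consistent c)
    (ha : P.act p (c p) = .recv q) (hlt : P.rcvd p q (c p) < P.sent q p (c q)) :
    P.Consistent (tick c p) := by
  intro r s
  have h₁ : P.sent r s (tick c p r) = P.sent r s (c r) := by
    by_cases h : r = p
    · subst h; simp [P.sent_succ, ha]
    · rw [tick_of_ne _ h]
  rw [h₁]
  by_cases h : s = p
  · subst h
    rw [tick_self, P.rcvd_succ, ha]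
    by_cases hr : r = q
    · subst hr
      simpa using hlt
    · have := hc r s
      simpa [Ne.symm hr] using this
  · rw [tick_of_ne _ h]
    exact hc r s

theorem pending_recv_self {c : Participant → ℕ} {p q : Participant}
    (ha : P.act p (c p) = .recv q) (hlt : P.rcvd p q (c p) < P.sent q p (c q)) :
    P.pending c q p = P.msg q p (P.rcvd p q (c p)) :: P.pending (tick c p) q p := by
  have hne := P.ne_of_recv _ _ _ ha
  rw [pending, pending, tick_of_ne _ hne.symm, tick_self, P.rcvd_succ, if_pos ha,
    show P.sent q p (c q) - P.rcvd p q (c p) = P.sent q p (c q) - (P.rcvd p q (c p) + 1) + 1 by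
      omega, List.range'_succ, List.map_cons]

theorem pending_recv_of_ne {c : Participant → ℕ} {p q : Participant}
    (ha : P.act p (c p) = .recv q) {r s : Participant} (h : r ≠ q ∨ s ≠ p) :
    P.pending (tick c p) r s = P.pending c r s := by
  have h₁ : P.sent r s (tick c p r) = P.sent r s (c r) := by
    by_cases hr : r = p
    · subst hr; simp [P.sent_succ, ha]
    · rw [tick_of_ne _ hr]
  have h₂ : P.rcvd s r (tick c p s) = P.rcvd s r (c s) := by
    by_cases hs : s = p
    · subst hs
      have hr : q ≠ r := fun e => h.elim (fun h => h e.symm) (fun h => h rfl)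
      simp [P.rcvd_succ, ha, hr]
    · rw [tick_of_ne _ hs]
  rw [pending, pending, h₁, h₂]

end Protocol

/-! ## Typing environments of a deterministic protocol -/

/-- The entry of a participant in an environment; absent participants have an empty queue and the
ended type. -/
def Env.view (Γ : Env) (p : Participant) : QTy × Ty := (Γ.lookup p).getD ([], .done)

theorem Env.view_of_lookup {Γ : Env} {p : Participant} {x : QTy × Ty} (h : Γ.lookup p = some x) :
    Γ.view p = x := by
  simp [Env.view, h]

theorem Env.view_insert_self (Γ : Env) (p : Participant) (x : QTy × Ty) :
    Env.view (Γ.insert p x) p = x := by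
  simp [Env.view]

theorem Env.view_insert_of_ne (Γ : Env) {p q : Participant} (h : q ≠ p) (x : QTy × Ty) :
    Env.view (Γ.insert p x) q = Γ.view q := by
  simp [Env.view, Finmap.lookup_insert_of_ne _ h]

theorem PairCong.refl (x : QTy × Ty) : PairCong x x := ⟨.refl _, .refl _⟩

theorem PairCong.symm {x y : QTy × Ty} (h : PairCong x y) : PairCong y x :=
  ⟨h.1.symm, h.2.symm⟩

theorem Env.Cong.view {Γ Γ' : Env} (h : Env.Cong Γ Γ') (p : Participant) :
    PairCong (Γ.view p) (Γ'.view p) := by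
  obtain ⟨h₁, h₂, h₃⟩ := h
  cases hΓ : Γ.lookup p with
  | none =>
    cases hΓ' : Γ'.lookup p with
    | none => simpa [Env.view, hΓ, hΓ'] using PairCong.refl _
    | some x' =>
      have := h₃ p x' hΓ' (Finmap.lookup_eq_none.1 hΓ)
      simpa [Env.view, hΓ, hΓ'] using this.symm
  | some x =>
    cases hΓ' : Γ'.lookup p with
    | none =>
      have := h₂ p x hΓ (Finmap.lookup_eq_none.1 hΓ')
      simpa [Env.view, hΓ, hΓ'] using this
    | some x' => simpa [Env.view, hΓ, hΓ'] using h₁ p x x' hΓ hΓ'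

/-- The default entry for absent participants turns the three clauses of `Env.Cong` into one
pointwise condition. A reduction can then be applied to a representative whose entries have
literally the form that the rule wants. -/
theorem Env.cong_of_view {Γ Γ' : Env} (h : ∀ p, PairCong (Γ.view p) (Γ'.view p)) :
    Env.Cong Γ Γ' := by
  refine ⟨fun p x x' hx hx' => ?_, fun p x hx hp => ?_, fun p x' hx' hp => ?_⟩
  · simpa [Env.view, hx, hx'] using h p
  · simpa [Env.view, hx, Finmap.lookup_eq_none.2 hp] using h p
  · simpa [Env.view, hx', Finmap.lookup_eq_none.2 hp] using (h p).symm

/-- `tyAt p n` is the type of `p` after `n` actions in the protocol. -/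
structure Protocol.TypedBy (P : Protocol) (tyAt : Participant → ℕ → Ty) : Prop where
  idle : ∀ p n, P.act p n = .idle → (tyAt p n).Cong .done
  send : ∀ p q n, P.act p n = .send q → (tyAt p n).Cong
    (.out1 q (P.msg p q (P.sent p q n)).1 (P.msg p q (P.sent p q n)).2 (tyAt p (n + 1)))
  recv : ∀ p q n, P.act p n = .recv q → ∃ (I : Finset Label) (hI : I.Nonempty) (S : I → Srt)
    (T : I → Ty) (h : (P.msg q p (P.rcvd p q n)).1 ∈ I), (tyAt p n).Cong (.ext q I hI S T) ∧
      S ⟨_, h⟩ = (P.msg q p (P.rcvd p q n)).2 ∧ (T ⟨_, h⟩).Cong (tyAt p (n + 1))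

/-- `Γ` is the environment, up to congruence, after `c r` actions of every participant `r`. -/
def Protocol.EnvAt (P : Protocol) (tyAt : Participant → ℕ → Ty) (Γ : Env)
    (c : Participant → ℕ) : Prop :=
  P.Consistent c ∧ ∀ p, (Γ.view p).2.Cong (tyAt p (c p)) ∧
    ∀ q, proj q (Γ.view p).1 = P.pending c p q

/-- The label of the reduction of environments for the action `n` of `p`. -/
def Protocol.HasLabel (P : Protocol) (p : Participant) (n : ℕ) (α : ELabel) : Prop :=
  (∃ q, P.act p n = .send q ∧ α = .send p q (P.msg p q (P.sent p q n)).1) ∨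
    ∃ q, P.act p n = .recv q ∧ α = .recv p q (P.msg q p (P.rcvd p q n)).1

namespace Protocol

variable {P : Protocol} {tyAt : Participant → ℕ → Ty}

theorem EnvAt.cong {Γ Γ' : Env} {c : Participant → ℕ} (h : P.EnvAt tyAt Γ c)
    (hΓ : Env.Cong Γ Γ') : P.EnvAt tyAt Γ' c :=
  ⟨h.1, fun p => ⟨(hΓ.view p).2.symm.trans (h.2 p).1, fun q => by
    rw [← (hΓ.view p).1.proj_eq, (h.2 p).2]⟩⟩

/-- A type congruent to an input cannot be congruent to the ended type or to an output, so the
protocol can only prescribe this very reception. -/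
theorem TypedBy.act_of_cong_ext (hP : P.TypedBy tyAt) {p q : Participant} {n : ℕ}
    {I : Finset Label} {hI : I.Nonempty} {S : I → Srt} {T : I → Ty}
    (h : (Ty.ext q I hI S T).Cong (tyAt p n)) :
    P.act p n = .recv q ∧ ∃ h : (P.msg q p (P.rcvd p q n)).1 ∈ I,
      S ⟨_, h⟩ = (P.msg q p (P.rcvd p q n)).2 ∧ (T ⟨_, h⟩).Cong (tyAt p (n + 1)) := by
  cases ha : P.act p n with
  | idle => cases (h.trans (hP.idle p n ha)).sameHead trivial trivial
  | send r => cases (h.trans (hP.send p r n ha)).sameHead trivial trivial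
  | recv r =>
    obtain ⟨J, hJ, S', T', hl, hc, hS, hT⟩ := hP.recv p r n ha
    cases (h.trans hc).sameHead trivial trivial with
    | ext _ _ _ _ hi => exact ⟨rfl, hl, hS, (hi _).trans hT⟩

theorem TypedBy.act_of_cong_int (hP : P.TypedBy tyAt) {p q : Participant} {n : ℕ}
    {I : Finset Label} {hI : I.Nonempty} {S : I → Srt} {T : I → Ty}
    (h : (Ty.int q I hI S T).Cong (tyAt p n)) (i : I) :
    P.act p n = .send q ∧ (i.1, S i) = P.msg p q (P.sent p q n) ∧
      (T i).Cong (tyAt p (n + 1)) := by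
  cases ha : P.act p n with
  | idle => cases (h.trans (hP.idle p n ha)).sameHead trivial trivial
  | recv r =>
    obtain ⟨J, hJ, S', T', hl, hc, hS, hT⟩ := hP.recv p r n ha
    cases (h.trans hc).sameHead trivial trivial
  | send r =>
    cases (h.trans (hP.send p r n ha)).sameHead trivial trivial with
    | int _ _ _ _ hi =>
      refine ⟨rfl, ?_, hi i⟩
      -- The selections of the protocol are singletons, so the chosen alternative is the prescribed
      -- one.
      have := Finset.mem_singleton.1 i.2
      rw [this]

/-- Reductions of an environment of the protocol are actions of the protocol. -/
theorem EnvAt.red (hP : P.TypedBy tyAt) {Γ Γ' : Env} {α : ELabel} (hr : Env.Red Γ α Γ')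
    {c : Participant → ℕ} (h : P.EnvAt tyAt Γ c) :
    ∃ p, P.HasLabel p (c p) α ∧ P.EnvAt tyAt Γ' (tick c p) := by
  induction hr generalizing c with
  | rcv Γ p q I hI S T k S' σ σq Tp hpq hp hq _ =>
    -- In this rule `p` is the sender and `q` the receiver, so the counter that advances is the one
    -- of `q`.
    have hp' := h.2 p
    have hq' := h.2 q
    rw [Env.view_of_lookup hp] at hp'
    rw [Env.view_of_lookup hq] at hq'
    obtain ⟨ha, hl, hS, hT⟩ := hP.act_of_cong_ext hq'.1
    have hm := (hp'.2 q).symm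
    rw [proj_cons_self] at hm
    obtain ⟨hlt, hm'⟩ := lt_of_pending_eq_cons hm
    obtain ⟨k, hk⟩ := k
    have hkl : k = (P.msg p q (P.rcvd q p (c q))).1 := congrArg Prod.fst hm'
    subst hkl
    refine ⟨q, .inr ⟨p, ha, rfl⟩, consistent_recv h.1 ha hlt, fun r => ?_⟩
    by_cases hr : r = q
    · subst hr
      rw [Env.view_insert_self, tick_self]
      refine ⟨hT, fun s => ?_⟩
      rw [pending_recv_of_ne ha (.inl hpq.symm)]
      exact hq'.2 s
    · rw [Env.view_insert_of_ne _ hr, tick_of_ne _ hr]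
      by_cases hr' : r = p
      · subst hr'
        rw [Env.view_insert_self]
        refine ⟨hp'.1, fun s => ?_⟩
        by_cases hs : s = q
        · subst hs
          rw [pending_recv_self ha hlt] at hm
          exact (List.cons.inj hm).2.symm
        · rw [pending_recv_of_ne ha (.inr hs), ← hp'.2 s, proj_cons_of_ne (Ne.symm hs)]
      · rw [Env.view_insert_of_ne _ hr']
        refine ⟨(h.2 r).1, fun s => ?_⟩
        rw [pending_recv_of_ne ha (.inl hr')]
        exact (h.2 r).2 s
  | send Γ p q I hI S T k σ hp =>
    have hp' := h.2 p
    rw [Env.view_of_lookup hp] at hp'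
    obtain ⟨ha, hm, hT⟩ := hP.act_of_cong_int hp'.1 k
    refine ⟨p, .inl ⟨q, ha, by rw [← hm]⟩, consistent_send h.1 ha, fun r => ?_⟩
    by_cases hr : r = p
    · subst hr
      rw [Env.view_insert_self, tick_self]
      refine ⟨hT, fun s => ?_⟩
      simp only [proj_append, hp'.2 s]
      by_cases hs : s = q
      · subst hs
        rw [pending_send_self h.1 ha, ← hm, proj_cons_self, proj_nil]
      · rw [pending_send_of_ne ha (.inr hs), proj_cons_of_ne (Ne.symm hs), proj_nil,
          List.append_nil]
    · rw [Env.view_insert_of_ne _ hr, tick_of_ne _ hr]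
      refine ⟨(h.2 r).1, fun s => ?_⟩
      rw [pending_send_of_ne ha (.inl hr)]
      exact (h.2 r).2 s
  | struct h₁ _ h₂ ih =>
    obtain ⟨p, hα, hp⟩ := ih (h.cong h₁)
    exact ⟨p, hα, hp.cong h₂⟩

/-- Fairness speaks only about enabled reductions, so what the counters permit must be shown to be
enabled. The type is brought to the form of an output by congruence before the rule is applied. -/
theorem EnvAt.red_send (hP : P.TypedBy tyAt) {Γ : Env} {c : Participant → ℕ}
    (h : P.EnvAt tyAt Γ c) {p q : Participant} (ha : P.act p (c p) = .send q) :
    ∃ Γ', Env.Red Γ (.send p q (P.msg p q (P.sent p q (c p))).1) Γ' := by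
  have hc := (h.2 p).1.trans (hP.send p q _ ha)
  refine ⟨_, .struct (Γ₁ := Γ.insert p ((Γ.view p).1, .out1 q
      (P.msg p q (P.sent p q (c p))).1 (P.msg p q (P.sent p q (c p))).2 (tyAt p (c p + 1))))
      (Env.cong_of_view fun r => ?_)
    (.send _ p q {_} (Finset.singleton_nonempty _) _ _ ⟨_, Finset.mem_singleton_self _⟩ _
      (Finmap.lookup_insert _)) (Env.cong_of_view fun r => .refl _)⟩
  by_cases hr : r = p
  · subst hr
    rw [Env.view_insert_self]
    exact ⟨.refl _, hc⟩
  · rw [Env.view_insert_of_ne _ hr]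
    exact .refl _

theorem EnvAt.red_recv (hP : P.TypedBy tyAt) {Γ : Env} {c : Participant → ℕ}
    (h : P.EnvAt tyAt Γ c) {p q : Participant} (ha : P.act p (c p) = .recv q)
    (hlt : P.rcvd p q (c p) < P.sent q p (c q)) :
    ∃ Γ', Env.Red Γ (.recv p q (P.msg q p (P.rcvd p q (c p))).1) Γ' := by
  obtain ⟨I, hI, S, T, hl, hc, hS, -⟩ := hP.recv p q _ ha
  have hne := P.ne_of_recv _ _ _ ha
  obtain ⟨l, hm⟩ := pending_eq_cons hlt
  rw [← (h.2 q).2 p] at hm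
  -- The message may be queued behind messages to others; congruence of queues brings it to the
  -- front, as the rule requires.
  obtain ⟨σ, hσ⟩ := exists_qcong_cons hm
  refine ⟨_, .struct (Γ₁ := (Γ.insert q ((p, P.msg q p (P.rcvd p q (c p))) :: σ,
      (Γ.view q).2)).insert p ((Γ.view p).1, .ext q I hI S T)) (Env.cong_of_view fun r => ?_)
    (.rcv _ q p I hI S T ⟨_, hl⟩ (P.msg q p (P.rcvd p q (c p))).2 σ (Γ.view p).1 (Γ.view q).2
      hne.symm ?_ (Finmap.lookup_insert _) (hS ▸ .refl _)) (Env.cong_of_view fun r => .refl _)⟩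
  · by_cases hr : r = p
    · subst hr
      rw [Env.view_insert_self]
      exact ⟨.refl _, (h.2 r).1.trans hc⟩
    · rw [Env.view_insert_of_ne _ hr]
      by_cases hr' : r = q
      · subst hr'
        rw [Env.view_insert_self]
        exact ⟨hσ, .refl _⟩
      · rw [Env.view_insert_of_ne _ hr']
        exact .refl _
  · rw [Finmap.lookup_insert_of_ne _ hne.symm, Finmap.lookup_insert]

/-! ## Liveness of a deterministic protocol -/

/-- Progress along a path from `(i, c)`, where `c` counts the actions performed at index `i`. -/
def Advance (P : Protocol) (tyAt : Participant → ℕ → Ty) (I : Set ℕ) (γ : ℕ → Env)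
    (x y : ℕ × (Participant → ℕ)) : Prop :=
  x.1 + 1 ∈ I ∧ P.EnvAt tyAt (γ (x.1 + 1)) y.2 ∧ ∃ p α, P.HasLabel p (x.2 p) α ∧
    Env.Red (γ x.1) α (γ (x.1 + 1)) ∧ y = (x.1 + 1, tick x.2 p)

variable {I : Set ℕ} {γ : ℕ → Env}

theorem envAt_of_advance {x y : ℕ × (Participant → ℕ)}
    (h : Relation.ReflTransGen (Advance P tyAt I γ) x y) (hx : x.1 ∈ I)
    (hx' : P.EnvAt tyAt (γ x.1) x.2) : y.1 ∈ I ∧ P.EnvAt tyAt (γ y.1) y.2 ∧ x.1 ≤ y.1 := by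
  induction h with
  | refl => exact ⟨hx, hx', le_refl _⟩
  | tail _ hs ih =>
    obtain ⟨hI, hE, p, α, -, -, rfl⟩ := hs
    exact ⟨hI, hE, by simp only; omega⟩

theorem le_of_advance {x y : ℕ × (Participant → ℕ)}
    (h : Relation.ReflTransGen (Advance P tyAt I γ) x y) (q : Participant) : x.2 q ≤ y.2 q := by
  induction h with
  | refl => exact le_refl _
  | tail _ hs ih =>
    obtain ⟨-, -, p, α, -, -, rfl⟩ := hs
    refine ih.trans ?_
    by_cases hq : q = p
    · subst hq; simp
    · exact (tick_of_ne _ hq).ge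

/-- If the action `n` of `p` is performed between two points of a path then the path has a step for
it. -/
theorem exists_red_of_advance {x y : ℕ × (Participant → ℕ)}
    (h : Relation.ReflTransGen (Advance P tyAt I γ) x y) {p : Participant} {n : ℕ}
    (hx : x.2 p ≤ n) (hy : n < y.2 p) :
    ∃ k α, k + 1 ∈ I ∧ x.1 < k + 1 ∧ P.HasLabel p n α ∧ Env.Red (γ k) α (γ (k + 1)) := by
  induction h with
  | refl => omega
  | @tail z y hz hs ih =>
    by_cases hn : n < z.2 p
    · exact ih hn
    · have hle : x.1 ≤ z.1 := by
        clear ih hs hn hy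
        induction hz with
        | refl => exact le_refl _
        | tail _ hs ih =>
          obtain ⟨-, -, p, α, -, -, rfl⟩ := hs
          exact ih.trans (Nat.le_succ _)
      obtain ⟨hI, hE, r, α, hα, hr, rfl⟩ := hs
      by_cases hp : p = r
      · subst hp
        simp only [tick_self] at hy
        obtain rfl : n = z.2 p := by omega
        exact ⟨z.1, α, hI, by omega, hα, hr⟩
      · simp only [tick_of_ne _ hp] at hy
        exact (hn hy).elim

/-- The environment need not determine the counters, since types recur, so the counters are carried
along the path together with the index. -/
theorem exists_advance_to (hP : P.TypedBy tyAt) (hpath : IsPath I γ) {i j : ℕ} (hij : i ≤ j)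
    (hj : j ∈ I) {c : Participant → ℕ} (h : P.EnvAt tyAt (γ i) c) :
    ∃ c', Relation.ReflTransGen (Advance P tyAt I γ) (i, c) (j, c') ∧
      P.EnvAt tyAt (γ j) c' := by
  induction j, hij using Nat.le_induction with
  | base => exact ⟨c, .refl, h⟩
  | succ j hij ih =>
    obtain ⟨c', hc', hE⟩ := ih (hpath.2.1 j hj)
    obtain ⟨α, hα⟩ := hpath.2.2 j hj
    obtain ⟨p, hp, hE'⟩ := hE.red hP hα
    exact ⟨tick c' p, hc'.tail ⟨hj, hE', p, α, hp, hα, rfl⟩, hE'⟩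

/-- Along a fair path every action is eventually performed. -/
theorem exists_advance_lt (hP : P.TypedBy tyAt) (hpath : IsPath I γ) (hfair : FairPath I γ)
    (p : Participant) (n : ℕ) (ha : P.act p n ≠ .idle) {i : ℕ} (hi : i ∈ I) {c : Participant → ℕ}
    (h : P.EnvAt tyAt (γ i) c) :
    ∃ y, Relation.ReflTransGen (Advance P tyAt I γ) (i, c) y ∧ n < y.2 p := by
  -- Strong induction on the rank: what the action waits for, the previous action of `p` and the
  -- transmission of its message, ranks lower.
  obtain ⟨N, hN⟩ : ∃ N, P.rank p n = N := ⟨_, rfl⟩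
  induction N using Nat.strong_induction_on generalizing p n i c with
  | _ N IH =>
    subst hN
    obtain ⟨⟨j, c₁⟩, hy, hn⟩ : ∃ y, Relation.ReflTransGen (Advance P tyAt I γ) (i, c) y ∧
        n ≤ y.2 p := by
      cases n with
      | zero => exact ⟨_, .refl, Nat.zero_le _⟩
      | succ n =>
        exact IH _ (P.rank_lt p n) p n (fun h => ha (P.idle_of_idle _ _ _ h)) hi h rfl
    obtain ⟨hj, hE, -⟩ := envAt_of_advance hy hi h
    -- Once fairness supplies a later reduction whose label can only stem from `p`, the counter of
    -- `p` exceeds `n` after it, whether this is action `n` itself or a later one.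
    have step : ∀ {j : ℕ} {c₁ : Participant → ℕ}, P.EnvAt tyAt (γ j) c₁ → c₁ p = n →
        (∃ k α, k + 1 ∈ I ∧ j < k + 1 ∧ Env.Red (γ k) α (γ (k + 1)) ∧
          ∀ r m, P.HasLabel r m α → r = p) →
        ∃ y, Relation.ReflTransGen (Advance P tyAt I γ) (j, c₁) y ∧ n < y.2 p := by
      rintro j c₁ hE hn ⟨k, α, hk, hjk, hr, hα⟩
      obtain ⟨c₂, hc₂, hE₂⟩ :=
        exists_advance_to hP hpath (Nat.le_of_lt_succ hjk) (hpath.2.1 k hk) hE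
      obtain ⟨r, hl, hE₃⟩ := hE₂.red hP hr
      obtain rfl := hα _ _ hl
      refine ⟨_, hc₂.tail ⟨hk, hE₃, r, α, hl, hr, rfl⟩, ?_⟩
      have := le_of_advance hc₂ r
      simp only [tick_self] at this ⊢
      omega
    rcases hn.lt_or_eq with hn | hn
    · exact ⟨_, hy, hn⟩
    cases hact : P.act p n with
    | idle => exact (ha hact).elim
    | send q =>
      simp only at hn hE hj
      rw [hn] at hact
      obtain ⟨Γ', hΓ'⟩ := hE.red_send hP hact
      obtain ⟨k, ℓ', hk, hjk, hr⟩ := (hfair j hj).1 _ _ _ _ hΓ'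
      obtain ⟨y, hy', hlt⟩ := step hE hn.symm ⟨k, _, hk, hjk, hr, by
        rintro r m (⟨q, -, h⟩ | ⟨q, -, h⟩)
        · injection h with h
          exact h.symm
        · cases h⟩
      exact ⟨y, hy.trans hy', hlt⟩
    | recv q =>
      obtain ⟨⟨j, c₁⟩, hy, hn, hs⟩ : ∃ y, Relation.ReflTransGen (Advance P tyAt I γ) (i, c) y ∧
          n ≤ y.2 p ∧ P.rcvd p q n < P.sent q p (y.2 q) := by
        -- Take the least number of actions of `q` that includes the transmission of the awaited
        -- message. The last of them ranks below the reception, since otherwise `rcvd_lt_sent` would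
        -- contradict minimality; so the induction hypothesis applies to it.
        have hex : ∃ M, P.rcvd p q n < P.sent q p M :=
          ⟨P.rank p n, P.rcvd_lt_sent _ _ _ _ hact (P.le_rank _ _)⟩
        classical
        obtain ⟨M, hM⟩ : ∃ M, Nat.find hex = M := ⟨_, rfl⟩
        have hM₁ := Nat.find_spec hex
        rw [hM] at hM₁
        cases M with
        | zero => rw [P.sent_zero] at hM₁; omega
        | succ M =>
          have hM₂ := Nat.find_min hex (m := M) (by omega)
          have hrank : P.rank q M < P.rank p n := by
            by_contra hle
            exact hM₂ (P.rcvd_lt_sent _ _ _ _ hact (not_lt.1 hle))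
          have hidle : P.act q M ≠ .idle := by
            intro h
            rw [P.sent_succ, h] at hM₁
            simp at hM₁
            omega
          obtain ⟨z, hz, hlt⟩ := IH _ hrank q M hidle hj hE rfl
          exact ⟨z, hy.trans hz, hn.le.trans (le_of_advance hz p),
            hM₁.trans_le (P.sent_mono _ _ hlt)⟩
      obtain ⟨hj, hE, -⟩ := envAt_of_advance hy hi h
      simp only at hn hs hE hj
      -- While the path advanced to that transmission, `p` may already have performed the action.
      rcases hn.lt_or_eq with hn | hn
      · exact ⟨_, hy, hn⟩
      rw [hn] at hact hs
      obtain ⟨Γ', hΓ'⟩ := hE.red_recv hP hact hs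
      obtain ⟨k, hk, hjk, hr⟩ := (hfair j hj).2 _ _ _ _ hΓ'
      obtain ⟨y, hy', hlt⟩ := step hE hn.symm ⟨k, _, hk, hjk, hr, by
        rintro r m (⟨q, -, h⟩ | ⟨q, -, h⟩)
        · cases h
        · injection h with h
          exact h.symm⟩
      exact ⟨y, hy.trans hy', hlt⟩

theorem exists_red_of_envAt (hP : P.TypedBy tyAt) (hpath : IsPath I γ) (hfair : FairPath I γ)
    {p : Participant} {n : ℕ} (ha : P.act p n ≠ .idle) {i : ℕ} (hi : i ∈ I)
    {c : Participant → ℕ} (h : P.EnvAt tyAt (γ i) c) (hn : c p ≤ n) :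
    ∃ k α, k + 1 ∈ I ∧ i < k + 1 ∧ P.HasLabel p n α ∧ Env.Red (γ k) α (γ (k + 1)) := by
  obtain ⟨y, hy, hlt⟩ := exists_advance_lt hP hpath hfair p n ha hi h
  exact exists_red_of_advance hy hn hlt

/-- Take the first reception of `q` from `p` at or after `N`. As none occurs in between, it consumes
the message that is the next one of the channel now. -/
theorem exists_next_recv {p q : Participant} {m : ℕ} (h : P.act p m = .send q) (N : ℕ) :
    ∃ n, N ≤ n ∧ P.act q n = .recv p ∧ P.rcvd q p n = P.rcvd q p N := by
  classical
  have hex := P.recv_later p q m N h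
  obtain ⟨h₁, h₂⟩ := Nat.find_spec hex
  refine ⟨Nat.find hex, h₁, h₂, ?_⟩
  have key : ∀ n, N ≤ n → n ≤ Nat.find hex → P.rcvd q p n = P.rcvd q p N := by
    intro n hn
    induction n, hn using Nat.le_induction with
    | base => exact fun _ => rfl
    | succ n hn ih =>
      intro hle
      have := Nat.find_min hex (m := n) (by omega)
      rw [P.rcvd_succ, ih (by omega), if_neg fun h => this ⟨hn, h⟩, add_zero]
  exact key _ h₁ le_rfl

/-- A message at the head of a queue is consumed by the next reception on its channel, and a pending
branching is itself the next action of its participant. Along a fair path both are eventually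
performed. -/
theorem EnvAt.live (hP : P.TypedBy tyAt) {Γ : Env} (h : P.EnvAt tyAt Γ fun _ => 0) :
    Γ.Live := by
  intro I γ hpath hγ hfair i hi
  subst hγ
  obtain ⟨c, -, hE⟩ := exists_advance_to hP hpath (Nat.zero_le i) hi h
  constructor
  · intro p q ℓ S σ T x hx hxc
    have hm := (hE.2 p).2 q
    rw [Env.view_of_lookup hx, hxc.1.proj_eq, proj_cons_self] at hm
    obtain ⟨hlt, hmsg⟩ := lt_of_pending_eq_cons hm.symm
    obtain ⟨m, hm⟩ := exists_send_of_lt hlt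
    obtain ⟨n, hn, ha, hrc⟩ := exists_next_recv hm (c q)
    obtain ⟨k, α, hk, hik, hα, hr⟩ :=
      exists_red_of_envAt hP hpath hfair (by simp [ha]) hi hE hn
    refine ⟨k, hk, hik, ?_⟩
    rcases hα with ⟨s, hs, rfl⟩ | ⟨s, hs, rfl⟩
    · simp [ha] at hs
    · obtain rfl : p = s := by simpa [ha] using hs
      rw [hrc, ← hmsg] at hr
      exact hr
  · intro p q J hJ S T σ x hx hxc
    have hT := (hE.2 p).1
    rw [Env.view_of_lookup hx] at hT
    obtain ⟨ha, -⟩ := hP.act_of_cong_ext (hxc.2.symm.trans hT)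
    obtain ⟨k, α, hk, hik, hα, hr⟩ :=
      exists_red_of_envAt hP hpath hfair (p := p) (by simp [ha]) hi hE le_rfl
    rcases hα with ⟨s, hs, rfl⟩ | ⟨s, hs, rfl⟩
    · simp [ha] at hs
    · obtain rfl : q = s := by simpa [ha] using hs
      exact ⟨k, _, hk, hik, hr⟩

end Protocol

end AsyncMPST

/-! ### Safety of sessions that follow a deterministic protocol. -/

namespace AsyncMPST

/-! ## Sessions of a deterministic protocol -/

/-- The process and the queue of a participant in a session; absent participants have the inactive
process and an empty queue. -/
def Sess.view (M : Sess) (p : Participant) : Proc × Queue := (M.comps.lookup p).getD (.nil, [])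

theorem Sess.view_par (M N : Sess) (p : Participant) :
    (Sess.par M N).view p = (M.comps.lookup p).getD (N.view p) := by
  rw [Sess.view, Sess.comps, List.lookup_append, Sess.view]
  cases M.comps.lookup p <;> simp

theorem Sess.view_part_par_self (p : Participant) (P : Proc) (h : Queue) (M : Sess) :
    (Sess.par (.part p P h) M).view p = (P, h) := by
  simp [Sess.view_par, Sess.comps]

theorem Sess.view_part_par_of_ne {p q : Participant} (hq : q ≠ p) (P : Proc) (h : Queue)
    (M : Sess) : (Sess.par (.part p P h) M).view q = M.view q := by
  have hq' : (q == p) = false := by simpa using hq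
  simp [Sess.view_par, Sess.comps, List.lookup, hq']

theorem Sess.lookup_eq_none {M : Sess} {p : Participant} (h : p ∉ M.comps.map Prod.fst) :
    M.comps.lookup p = none := by
  rw [List.lookup_eq_none_iff]
  intro c hc
  simp only [bne_iff_ne]
  rintro rfl
  exact h (List.mem_map_of_mem hc)

theorem Sess.view_eq_of_notMem {M : Sess} {p : Participant} (h : p ∉ M.comps.map Prod.fst) :
    M.view p = (.nil, []) := by
  rw [Sess.view, Sess.lookup_eq_none h, Option.getD_none]

theorem Sess.mem_comps_of_view {M : Sess} {p : Participant} (h : M.view p ≠ (.nil, [])) :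
    (p, M.view p) ∈ M.comps := by
  rw [Sess.view] at h ⊢
  cases hl : M.comps.lookup p with
  | none => simp [hl] at h
  | some x =>
    rw [List.lookup_eq_some_iff] at hl
    obtain ⟨l₁, l₂, hl, -⟩ := hl
    simp [hl]

/-- Congruence of processes with queues. -/
def ProcQueueCong (x y : Proc × Queue) : Prop := x.1.Cong y.1 ∧ QCong x.2 y.2

theorem ProcQueueCong.refl (x : Proc × Queue) : ProcQueueCong x x := ⟨.refl _, .refl _⟩

theorem Sess.WF.of_par_left {M N : Sess} (h : (Sess.par M N).WF) : M.WF := by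
  rw [Sess.WF, Sess.comps, List.map_append] at h
  exact h.of_append_left

theorem Sess.WF.disjoint {M N : Sess} (h : (Sess.par M N).WF) {p : Participant}
    (hM : p ∈ M.comps.map Prod.fst) : p ∉ N.comps.map Prod.fst := by
  rw [Sess.WF, Sess.comps, List.map_append] at h
  exact fun hN => List.disjoint_of_nodup_append h hM hN

/-- Read from left to right, only the unit law changes the set of participants, and what it drops is
inactive with an empty queue, hence indistinguishable from an absent participant. -/
theorem Sess.CongStep.map_fst {M N : Sess} (h : Sess.CongStep M N) (p : Participant) :
    (∀ q ∈ N.comps.map Prod.fst, q ∈ M.comps.map Prod.fst) ∧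
      (p ∈ M.comps.map Prod.fst → p ∉ N.comps.map Prod.fst → M.WF → M.view p = (.nil, [])) := by
  induction h with
  | unit q M =>
    refine ⟨fun _ h => List.mem_cons_of_mem _ h, fun h₁ h₂ _ => ?_⟩
    simp only [Sess.comps, List.map_append, List.map_cons, List.map_nil, List.mem_append,
      List.mem_singleton] at h₁
    obtain rfl := h₁.resolve_right h₂
    exact Sess.view_part_par_self _ _ _ _
  | comm M N =>
    simp only [Sess.comps, List.map_append, List.mem_append]
    exact ⟨fun _ h => h.symm, fun h h' => (h' h.symm).elim⟩
  | assoc M₁ M₂ M₃ =>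
    simp only [Sess.comps, List.map_append, List.mem_append]
    exact ⟨fun _ h => or_assoc.2 h, fun h h' => (h' (or_assoc.1 h)).elim⟩
  | part q _ _ =>
    simp only [Sess.comps]
    exact ⟨fun _ h => h, fun h h' => (h' h).elim⟩
  | @par M M' N _ ih =>
    simp only [Sess.comps, List.map_append, List.mem_append, not_or]
    refine ⟨fun q h => h.imp_left (ih.1 q), fun h h' hWF => ?_⟩
    have hM := h.resolve_right h'.2
    have := ih.2 hM h'.1 hWF.of_par_left
    rw [Sess.view_par]
    rw [Sess.view] at this
    cases hl : M.comps.lookup p with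
    | none => simpa using Sess.view_eq_of_notMem h'.2
    | some x => simpa [hl] using this

/-- A lookup returns the first entry of a participant, so commutation is harmless only because
participants are distinct. -/
theorem Sess.CongStep.view {M N : Sess} (h : Sess.CongStep M N) (hM : M.WF) (hN : N.WF)
    (p : Participant) : ProcQueueCong (M.view p) (N.view p) := by
  induction h with
  | unit q M =>
    by_cases hp : p = q
    · subst hp
      rw [Sess.view_part_par_self, Sess.view_eq_of_notMem]
      · exact .refl _
      · exact hM.disjoint (by simp [Sess.comps])
    · rw [Sess.view_part_par_of_ne hp]
      exact .refl _
  | comm M N =>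
    rw [Sess.view_par, Sess.view_par]
    by_cases hp : p ∈ M.comps.map Prod.fst
    · have hp' := hM.disjoint hp
      rw [Sess.lookup_eq_none hp', Sess.view_eq_of_notMem hp']
      exact .refl _
    · rw [Sess.lookup_eq_none hp, Sess.view_eq_of_notMem hp]
      exact .refl _
  | assoc M₁ M₂ M₃ =>
    simp only [Sess.view, Sess.comps, List.append_assoc]
    exact .refl _
  | part q hP hq =>
    by_cases hp : p = q
    · subst hp
      simpa [Sess.view, Sess.comps, List.lookup] using ⟨hP, hq⟩
    · have hp' : (p == q) = false := by simpa using hp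
      simpa [Sess.view, Sess.comps, List.lookup, hp'] using ProcQueueCong.refl _
  | @par M M' N hs ih =>
    have ih := ih hM.of_par_left hN.of_par_left
    rw [Sess.view_par, Sess.view_par]
    rw [Sess.view, Sess.view] at ih
    have h₁ := hs.map_fst p
    by_cases hpM : p ∈ M.comps.map Prod.fst
    · have hN0 := Sess.view_eq_of_notMem (hM.disjoint hpM)
      simpa only [hN0] using ih
    · have hpM' := fun h => hpM (h₁.1 p h)
      rw [Sess.lookup_eq_none hpM, Sess.lookup_eq_none hpM']
      exact .refl _

theorem Sess.CongStep.noError_iff {M N : Sess} (h : Sess.CongStep M N) :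
    M.NoError ↔ N.NoError := by
  induction h with
  | unit q M => simp [Sess.NoError]
  | comm M N => exact and_comm
  | assoc M₁ M₂ M₃ => exact and_assoc
  | part q _ _ => exact Iff.rfl
  | par N _ ih => exact and_congr_left' ih

/-- The messages of a queue have the given labels and values of the given sorts. -/
def Carries (l : List (Label × Val)) (l' : List (Label × Srt)) : Prop :=
  List.Forall₂ (fun m t => m.1 = t.1 ∧ HasSort [] (.val m.2) t.2) l l'

/-- `procAt p n` are the processes of `p`, up to congruence, after `n` actions in the protocol. -/
structure Protocol.ImplementedBy (P : Protocol) (procAt : Participant → ℕ → Set Proc) : Prop where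
  idle : ∀ p n X, P.act p n = .idle → X ∈ procAt p n → X.Cong .nil
  send : ∀ p q n X, P.act p n = .send q → X ∈ procAt p n → ∃ e, ∃ Y ∈ procAt p (n + 1),
    HasSort [] e (P.msg p q (P.sent p q n)).2 ∧
      X.Cong (.out q (P.msg p q (P.sent p q n)).1 e Y)
  recv : ∀ p q n X, P.act p n = .recv q → X ∈ procAt p n → ∃ (I : Finset Label) (R : I → Proc)
    (h : (P.msg q p (P.rcvd p q n)).1 ∈ I), X.Cong (.ext q I R) ∧
      ∀ v, HasSort [] (.val v) (P.msg q p (P.rcvd p q n)).2 →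
        ∃ Y ∈ procAt p (n + 1), ((R ⟨_, h⟩).instE v).Cong Y

/-- The process `Q` is one of `p` after `n` actions, up to congruence. -/
def Runs (procAt : Participant → ℕ → Set Proc) (p : Participant) (n : ℕ) (Q : Proc) : Prop :=
  ∃ X ∈ procAt p n, Q.Cong X

/-- `M` is the session, up to congruence, after `c r` actions of every participant `r`. -/
def Protocol.SessAt (P : Protocol) (procAt : Participant → ℕ → Set Proc) (M : Sess)
    (c : Participant → ℕ) : Prop :=
  M.NoError ∧ M.WF ∧ P.Consistent c ∧ ∀ p, Runs procAt p (c p) (M.view p).1 ∧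
    ∀ q, Carries (proj q (M.view p).2) (P.pending c p q)

namespace Protocol

variable {P : Protocol} {procAt : Participant → ℕ → Set Proc}

theorem SessAt.of_view {M N : Sess} {c : Participant → ℕ} (h : P.SessAt procAt M c)
    (hE : N.NoError) (hWF : N.WF) (hv : ∀ p, ProcQueueCong (M.view p) (N.view p)) :
    P.SessAt procAt N c := by
  refine ⟨hE, hWF, h.2.2.1, fun p => ⟨?_, fun q => ?_⟩⟩
  · obtain ⟨X, hX, hc⟩ := (h.2.2.2 p).1
    exact ⟨X, hX, (hv p).1.symm.trans hc⟩
  · rw [← (hv p).2.proj_eq]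
    exact (h.2.2.2 p).2 q

theorem sessAt_iff_of_cong {M N : Sess} (hMN : M.Cong N) {c : Participant → ℕ} :
    P.SessAt procAt M c ↔ P.SessAt procAt N c := by
  induction hMN with
  | rel M N hs =>
    obtain ⟨hM, hN, hs⟩ := hs
    exact ⟨fun h => h.of_view (hs.noError_iff.1 h.1) hN fun p => hs.view hM hN p,
      fun h => h.of_view (hs.noError_iff.2 h.1) hM fun p =>
        ⟨(hs.view hM hN p).1.symm, (hs.view hM hN p).2.symm⟩⟩
  | refl M => exact Iff.rfl
  | symm _ _ _ ih => exact ih.symm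
  | trans _ _ _ _ _ ih₁ ih₂ => exact ih₁.trans ih₂

/-- Agreement of heads excludes all but a reception from `q` as the prescribed action; the branch
taken then leads, for every well-sorted value, to a prescribed process. -/
theorem ImplementedBy.act_of_ext (hP : P.ImplementedBy procAt) {p q : Participant} {n : ℕ}
    {I : Finset Label} {R : I → Proc} (h : Runs procAt p n (.ext q I R)) :
    P.act p n = .recv q ∧ ∃ h : (P.msg q p (P.rcvd p q n)).1 ∈ I,
      ∀ v, HasSort [] (.val v) (P.msg q p (P.rcvd p q n)).2 →
        Runs procAt p (n + 1) ((R ⟨_, h⟩).instE v) := by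
  obtain ⟨X, hX, hc⟩ := h
  cases ha : P.act p n with
  | idle => cases (hc.trans (hP.idle p n X ha hX)).sameHead trivial trivial
  | send r =>
    obtain ⟨e, Y, -, -, hc'⟩ := hP.send p r n X ha hX
    cases (hc.trans hc').sameHead trivial trivial
  | recv r =>
    obtain ⟨J, R', hl, hc', hR⟩ := hP.recv p r n X ha hX
    cases (hc.trans hc').sameHead trivial trivial with
    | ext _ _ hi =>
      refine ⟨rfl, hl, fun v hv => ?_⟩
      obtain ⟨Y, hY, hc''⟩ := hR v hv
      exact ⟨Y, hY, ((hi _).substE _).trans hc''⟩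

theorem ImplementedBy.act_of_out (hP : P.ImplementedBy procAt) {p q : Participant} {n : ℕ}
    {ℓ : Label} {e : Expr} {Q : Proc} (h : Runs procAt p n (.out q ℓ e Q)) :
    P.act p n = .send q ∧ ℓ = (P.msg p q (P.sent p q n)).1 ∧
      HasSort [] e (P.msg p q (P.sent p q n)).2 ∧ Runs procAt p (n + 1) Q := by
  obtain ⟨X, hX, hc⟩ := h
  cases ha : P.act p n with
  | idle => cases (hc.trans (hP.idle p n X ha hX)).sameHead trivial trivial
  | send r =>
    obtain ⟨e', Y, hY, he, hc'⟩ := hP.send p r n X ha hX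
    cases (hc.trans hc').sameHead trivial trivial with
    | out _ _ _ hQ => exact ⟨rfl, rfl, he, Y, hY, hQ⟩
  | recv r =>
    obtain ⟨J, R', hl, hc', hR⟩ := hP.recv p r n X ha hX
    cases (hc.trans hc').sameHead trivial trivial

/-- Prescribed processes are inactive, inputs or outputs up to congruence. This disposes of both
conditional reductions and of the evaluation error for conditions. -/
theorem ImplementedBy.not_runs_cond (hP : P.ImplementedBy procAt) {p : Participant} {n : ℕ}
    {e : Expr} {Q R : Proc} : ¬ Runs procAt p n (.cond e Q R) := by
  rintro ⟨X, hX, hc⟩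
  cases ha : P.act p n with
  | idle => cases (hc.trans (hP.idle p n X ha hX)).sameHead trivial trivial
  | send r =>
    obtain ⟨e', Y, hY, he, hc'⟩ := hP.send p r n X ha hX
    cases (hc.trans hc').sameHead trivial trivial
  | recv r =>
    obtain ⟨J, R', hl, hc', hR⟩ := hP.recv p r n X ha hX
    cases (hc.trans hc').sameHead trivial trivial

theorem ImplementedBy.act_of_nil (hP : P.ImplementedBy procAt) {p : Participant} {n : ℕ}
    (h : Runs procAt p n .nil) : P.act p n = .idle := by
  obtain ⟨X, hX, hc⟩ := h
  cases ha : P.act p n with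
  | idle => rfl
  | send r =>
    obtain ⟨e', Y, hY, he, hc'⟩ := hP.send p r n X ha hX
    cases (hc.trans hc').sameHead trivial trivial
  | recv r =>
    obtain ⟨J, R', hl, hc', hR⟩ := hP.recv p r n X ha hX
    cases (hc.trans hc').sameHead trivial trivial

/-- A continuation only has actions of the process it comes from. After an input the continuation
exists for a given value, so some value of the payload sort is needed, and every sort has one. -/
theorem ImplementedBy.actions_succ (hP : P.ImplementedBy procAt) {p : Participant} {n : ℕ}
    {Q : Proc} (h : Runs procAt p n Q) : ∃ Q', Runs procAt p (n + 1) Q' ∧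
      Q'.actions ⊆ Q.actions ∨ P.act p n = .idle := by
  obtain ⟨X, hX, hc⟩ := h
  cases ha : P.act p n with
  | idle => exact ⟨Q, .inr rfl⟩
  | send r =>
    obtain ⟨e', Y, hY, he, hc'⟩ := hP.send p r n X ha hX
    refine ⟨Y, .inl ⟨⟨Y, hY, .refl _⟩, ?_⟩⟩
    rw [(hc.trans hc').actions_eq]
    exact Set.subset_union_right
  | recv r =>
    obtain ⟨J, R, hl, hc', hR⟩ := hP.recv p r n X ha hX
    obtain ⟨v, hv⟩ := exists_hasSort_val [] (P.msg r p (P.rcvd p r n)).2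
    obtain ⟨Y, hY, hcY⟩ := hR v hv
    refine ⟨Y, .inl ⟨⟨Y, hY, .refl _⟩, ?_⟩⟩
    rw [(hc.trans hc').actions_eq, ← hcY.actions_eq, Proc.instE, Proc.actions_substE]
    exact (Set.subset_iUnion (fun i => (R i).actions) _).trans Set.subset_union_right

theorem ImplementedBy.actions_of_le (hP : P.ImplementedBy procAt) {p : Participant} {n m : ℕ}
    (hnm : n ≤ m) {Q : Proc} (h : Runs procAt p n Q) (hm : P.act p m ≠ .idle) :
    ∃ Q', Runs procAt p m Q' ∧ Q'.actions ⊆ Q.actions := by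
  induction m, hnm using Nat.le_induction with
  | base => exact ⟨Q, h, subset_rfl⟩
  | succ m hnm ih =>
    have hm' : P.act p m ≠ .idle := fun h => hm (P.idle_of_idle _ _ _ h)
    obtain ⟨Q', hQ', hs⟩ := ih hm'
    obtain ⟨Q'', h | h⟩ := hP.actions_succ hQ'
    · exact ⟨Q'', h.1, h.2.trans hs⟩
    · exact (hm' h).elim

/-- A reception due at any later stage must already occur in the current process, as actions never
grow. This refutes orphan messages; the analogue for sends refutes starvation. -/
theorem ImplementedBy.recv_mem_actions (hP : P.ImplementedBy procAt) {p q : Participant}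
    {n m : ℕ} (hnm : n ≤ m) {Q : Proc} (h : Runs procAt p n Q) (hm : P.act p m = .recv q) :
    Action.recv q ∈ Q.actions := by
  obtain ⟨Q', ⟨X, hX, hc⟩, hs⟩ := hP.actions_of_le hnm h (by simp [hm])
  obtain ⟨J, R, hl, hc', hR⟩ := hP.recv p q m X hm hX
  refine hs ?_
  rw [(hc.trans hc').actions_eq]
  exact .inl rfl

theorem ImplementedBy.send_mem_actions (hP : P.ImplementedBy procAt) {p q : Participant}
    {n m : ℕ} (hnm : n ≤ m) {Q : Proc} (h : Runs procAt p n Q) (hm : P.act p m = .send q) :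
    Action.send q ∈ Q.actions := by
  obtain ⟨Q', ⟨X, hX, hc⟩, hs⟩ := hP.actions_of_le hnm h (by simp [hm])
  obtain ⟨e, Y, hY, he, hc'⟩ := hP.send p q m X hm hX
  refine hs ?_
  rw [(hc.trans hc').actions_eq]
  exact .inl rfl

/-- The message at the head of a queue is the next one of its channel. -/
theorem SessAt.head_msg {M : Sess} {c : Participant → ℕ} (h : P.SessAt procAt M c)
    {p q : Participant} {ℓ : Label} {v : Val} {l : Queue} (hq : (M.view q).2 = (p, ℓ, v) :: l) :
    P.rcvd p q (c p) < P.sent q p (c q) ∧ ℓ = (P.msg q p (P.rcvd p q (c p))).1 ∧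
      HasSort [] (.val v) (P.msg q p (P.rcvd p q (c p))).2 := by
  have hm := (h.2.2.2 q).2 p
  rw [hq, proj_cons_self] at hm
  generalize hl : P.pending c q p = l' at hm
  cases hm with
  | cons hm _ =>
    obtain ⟨hlt, rfl⟩ := lt_of_pending_eq_cons hl
    exact ⟨hlt, hm⟩

/-- Some participant that is not idle can perform its next action. -/
theorem exists_enabled (P : Protocol) {r : Participant} (hr : P.act r 0 ≠ .idle)
    (c : Participant → ℕ) : ∃ p, P.act p (c p) ≠ .idle ∧
      ∀ q, P.act p (c p) = .recv q → P.rcvd p q (c p) < P.sent q p (c q) := by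
  classical
  -- Choose a next action of least rank among the participants that are not idle. If it is a
  -- reception, the next action of its partner does not rank lower, so the message has already been
  -- sent.
  have hex : ∃ k p, P.act p (c p) ≠ .idle ∧ P.rank p (c p) = k :=
    ⟨_, r, fun h => hr (P.idle_of_idle _ _ _ h), rfl⟩
  obtain ⟨p, hp, hk⟩ := Nat.find_spec hex
  refine ⟨p, hp, fun q hq => ?_⟩
  refine P.rcvd_lt_sent _ _ _ _ hq ?_
  rw [hk]
  -- The partner competes in the minimum because it must send to `p` at some time and is therefore
  -- never idle.
  have hqi : P.act q (c q) ≠ .idle := by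
    obtain ⟨n, -, hn⟩ := P.send_later p q _ 0 hq
    intro h
    rw [P.idle_of_idle q _ n h] at hn
    cases hn
  exact Nat.find_min' hex ⟨q, hqi, rfl⟩

/-- Reductions of a session of the protocol are actions of the protocol; in particular they do not
lead to an error. -/
theorem SessAt.red (hP : P.ImplementedBy procAt) {r : Participant} (hr : P.act r 0 ≠ .idle)
    {M M' : Sess} (hM : Sess.Red M M') {c : Participant → ℕ} (h : P.SessAt procAt M c) :
    ∃ c', P.SessAt procAt M' c' := by
  induction hM generalizing c with
  | send p q ℓ e v Q l M he =>
    have hp := h.2.2.2 p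
    rw [Sess.view_part_par_self] at hp
    obtain ⟨ha, rfl, hs, hQ⟩ := hP.act_of_out hp.1
    refine ⟨tick c p, h.1, h.2.1, consistent_send h.2.2.1 ha, fun s => ?_⟩
    by_cases hsp : s = p
    · subst hsp
      rw [Sess.view_part_par_self, tick_self]
      refine ⟨hQ, fun t => ?_⟩
      simp only [proj_append]
      by_cases ht : t = q
      · subst ht
        rw [pending_send_self h.2.2.1 ha, proj_cons_self, proj_nil]
        exact List.rel_append (hp.2 t) (.cons ⟨rfl, he.hasSort hs⟩ .nil)
      · rw [pending_send_of_ne ha (.inr ht), proj_cons_of_ne (Ne.symm ht), proj_nil,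
          List.append_nil]
        exact hp.2 t
    · have hs' := h.2.2.2 s
      rw [Sess.view_part_par_of_ne hsp] at hs' ⊢
      rw [tick_of_ne _ hsp]
      refine ⟨hs'.1, fun t => ?_⟩
      rw [pending_send_of_ne ha (.inl hsp)]
      exact hs'.2 t
  | rcv p q I R Q k v hp hq M =>
    -- The rule does not demand distinct parties; well-formedness of the session does.
    have hpq : q ≠ p := by
      rintro rfl
      exact h.2.1.disjoint (p := q) (by simp [Sess.comps]) (by simp [Sess.comps])
    have h₁ := h.2.2.2 p
    rw [Sess.view_part_par_self] at h₁
    have h₂ := h.2.2.2 q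
    rw [Sess.view_part_par_of_ne hpq, Sess.view_part_par_self] at h₂
    obtain ⟨ha, hl, hR⟩ := hP.act_of_ext h₁.1
    obtain ⟨hlt, hℓ, hv⟩ := h.head_msg (p := p) (q := q) (by
      rw [Sess.view_part_par_of_ne hpq, Sess.view_part_par_self])
    obtain ⟨k, hk⟩ := k
    simp only at hℓ
    subst hℓ
    refine ⟨tick c p, h.1, h.2.1, consistent_recv h.2.2.1 ha hlt, fun s => ?_⟩
    by_cases hsp : s = p
    · subst hsp
      rw [Sess.view_part_par_self, tick_self]
      refine ⟨hR v hv, fun t => ?_⟩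
      rw [pending_recv_of_ne ha (.inl hpq.symm)]
      exact h₁.2 t
    · have hs := h.2.2.2 s
      rw [Sess.view_part_par_of_ne hsp] at hs ⊢
      rw [tick_of_ne _ hsp]
      by_cases hsq : s = q
      · subst hsq
        rw [Sess.view_part_par_self]
        refine ⟨h₂.1, fun t => ?_⟩
        have h₃ := h₂.2 t
        by_cases ht : t = p
        · subst ht
          simp only [proj_cons_self] at h₃
          rw [pending_recv_self ha hlt] at h₃
          exact (List.forall₂_cons.1 h₃).2
        · simp only [proj_cons_of_ne (Ne.symm ht)] at h₃
          rwa [pending_recv_of_ne ha (.inr ht)]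
      · rw [Sess.view_part_par_of_ne hsq] at hs ⊢
        refine ⟨hs.1, fun t => ?_⟩
        rw [pending_recv_of_ne ha (.inl hsq)]
        exact hs.2 t
  | condT p e Q R l M _ =>
    have hp := (h.2.2.2 p).1
    rw [Sess.view_part_par_self] at hp
    exact (hP.not_runs_cond hp).elim
  | condF p e Q R l M _ =>
    have hp := (h.2.2.2 p).1
    rw [Sess.view_part_par_self] at hp
    exact (hP.not_runs_cond hp).elim
  | struct h₁ _ h₂ ih =>
    obtain ⟨c', hc'⟩ := ih ((sessAt_iff_of_cong h₁).1 h)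
    exact ⟨c', (sessAt_iff_of_cong h₂).1 hc'⟩
  | errMism p q I R Q ℓ v hp hq M hℓ =>
    have hpq : q ≠ p := by
      rintro rfl
      exact h.2.1.disjoint (p := q) (by simp [Sess.comps]) (by simp [Sess.comps])
    have h₁ := (h.2.2.2 p).1
    rw [Sess.view_part_par_self] at h₁
    obtain ⟨ha, hl, -⟩ := hP.act_of_ext h₁
    obtain ⟨-, rfl, -⟩ := h.head_msg (p := p) (q := q) (by
      rw [Sess.view_part_par_of_ne hpq, Sess.view_part_par_self])
    exact (hℓ hl).elim
  | errOphn p q Q R ℓ v hp hq M hact =>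
    have hpq : q ≠ p := by
      rintro rfl
      exact h.2.1.disjoint (p := q) (by simp [Sess.comps]) (by simp [Sess.comps])
    have h₁ := (h.2.2.2 p).1
    rw [Sess.view_part_par_self] at h₁
    obtain ⟨hlt, -, -⟩ := h.head_msg (p := p) (q := q) (by
      rw [Sess.view_part_par_of_ne hpq, Sess.view_part_par_self])
    obtain ⟨m, hm⟩ := exists_send_of_lt hlt
    -- The channel is in use, so `p` receives from `q` again at or after its present stage.
    obtain ⟨n, hn, ha⟩ := P.recv_later q p m (c p) hm
    exact (hact (hP.recv_mem_actions hn h₁ ha)).elim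
  | errStrv p q I R Q hp hq M hact _ =>
    have hpq : q ≠ p := by
      rintro rfl
      exact h.2.1.disjoint (p := q) (by simp [Sess.comps]) (by simp [Sess.comps])
    have h₁ := (h.2.2.2 p).1
    rw [Sess.view_part_par_self] at h₁
    obtain ⟨ha, -⟩ := hP.act_of_ext h₁
    have h₂ := (h.2.2.2 q).1
    rw [Sess.view_part_par_of_ne hpq, Sess.view_part_par_self] at h₂
    obtain ⟨n, hn, ha'⟩ := P.send_later p q _ (c q) ha
    exact (hact (hP.send_mem_actions hn h₂ ha')).elim
  | errEval p e Q R l M _ _ =>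
    have hp := (h.2.2.2 p).1
    rw [Sess.view_part_par_self] at hp
    exact (hP.not_runs_cond hp).elim
  | errEval2 p q ℓ e Q l M he =>
    have hp := (h.2.2.2 p).1
    rw [Sess.view_part_par_self] at hp
    obtain ⟨-, -, hs, -⟩ := hP.act_of_out hp
    exact (he hs.exists_eval).elim
  | errDlock M _ hall _ hmsg =>
    exfalso
    -- The enabled participant is not inactive, so in a deadlock it would be waiting; but the
    -- message it waits for is in transit.
    obtain ⟨p, hidle, hp⟩ := P.exists_enabled hr c
    have hv := (h.2.2.2 p).1
    have hmem : (p, M.view p) ∈ M.comps := Sess.mem_comps_of_view fun hnil => by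
      rw [hnil] at hv
      exact hidle (hP.act_of_nil hv)
    rcases hall _ hmem with ⟨q, I, R, hq⟩ | hq
    · simp only at hq
      rw [hq] at hv
      obtain ⟨ha, -⟩ := hP.act_of_ext hv
      have hm := (h.2.2.2 q).2 p
      obtain ⟨l, hl⟩ := pending_eq_cons (hp q ha)
      rw [hl] at hm
      generalize hl' : proj p (M.view q).2 = l' at hm
      cases hm with
      | @cons a _ l' _ _ _ =>
        obtain ⟨ℓ, v⟩ := a
        have hmem' : (q, M.view q) ∈ M.comps := Sess.mem_comps_of_view fun hnil => by
          rw [hnil] at hl'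
          cases hl'
        obtain ⟨h', hh'⟩ := exists_qcong_cons hl'
        exact hmsg _ hmem ⟨q, I, R, hq⟩ _ hmem' ⟨ℓ, v, h', hh'⟩
    · simp only at hq
      rw [hq] at hv
      exact hidle (hP.act_of_nil hv)

theorem SessAt.not_red_error (hP : P.ImplementedBy procAt) {r : Participant}
    (hr : P.act r 0 ≠ .idle) {M : Sess} {c : Participant → ℕ} (h : P.SessAt procAt M c) :
    ¬ Relation.ReflTransGen Sess.Red M .error := by
  intro hred
  have key : ∀ N, Relation.ReflTransGen Sess.Red M N → ∃ c, P.SessAt procAt N c := by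
    intro N hN
    induction hN with
    | refl => exact ⟨c, h⟩
    | tail _ hs ih =>
      obtain ⟨c', hc'⟩ := ih
      exact hc'.red hP hr hs
  obtain ⟨c', hc'⟩ := key _ hred
  exact hc'.1

end Protocol

end AsyncMPST

/-! ### The batch-processing protocol as an instance, and liveness of its environment. -/

namespace AsyncMPST

open Participant Label

/-! ## The batch-processing protocol as a deterministic protocol -/

/-- The label of the message number `j` between the control and the source or the sink. -/
def bLabel (j : ℕ) : Label := if j % 2 = 0 then b1 else b2

/-- The actions of the parties, with the optimised control if `opt` is true. -/
def batchAct (opt : Bool) : Participant → ℕ → Act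
  | bp1, n => if n % 2 = 0 then .recv src else .send sk
  | bp2, n => if n % 2 = 0 then .recv src else .send sk
  | src, n => if n % 3 = 0 then .recv ctl else if n % 3 = 1 then .send ctl else
      if n % 6 = 2 then .send bp1 else .send bp2
  | ctl, n => match opt with
    | false => if n % 4 = 0 then .send src else if n % 4 = 1 then .recv src else
        if n % 4 = 2 then .recv sk else .send sk
    | true => if n = 0 then .send src else if n % 4 = 1 then .send src else
        if n % 4 = 2 then .recv src else if n % 4 = 3 then .recv sk else .send sk
  | sk, n => if n % 3 = 0 then .send ctl else if n % 3 = 1 then .recv ctl else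
      if n % 6 = 2 then .recv bp1 else .recv bp2
  | .other _, _ => .idle

def batchMsg (S : Srt) : Participant → Participant → ℕ → Label × Srt
  | ctl, _, j => (bLabel j, .unit)
  | src, ctl, j => (bLabel j, .unit)
  | sk, _, j => (bLabel j, .unit)
  | _, _, _ => (data, S)

/-- Closed forms, for which the recurrences are linear arithmetic; the offsets come from the
position of the first send in the cycle. The optimised control sends twice to `src` at the start,
and its formula would give `1` at `n = 0`, hence the exception. -/
def batchSent (opt : Bool) : Participant → Participant → ℕ → ℕ
  | bp1, sk, n => n / 2
  | bp2, sk, n => n / 2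
  | src, ctl, n => (n + 1) / 3
  | src, bp1, n => (n + 3) / 6
  | src, bp2, n => n / 6
  | ctl, src, n => match opt with
    | false => (n + 3) / 4
    | true => if n = 0 then 0 else (n + 6) / 4
  | ctl, sk, n => match opt with
    | false => n / 4
    | true => (n - 1) / 4
  | sk, ctl, n => (n + 2) / 3
  | _, _, _ => 0

def batchRcvd (opt : Bool) : Participant → Participant → ℕ → ℕ
  | bp1, src, n => (n + 1) / 2
  | bp2, src, n => (n + 1) / 2
  | src, ctl, n => (n + 2) / 3
  | ctl, src, n => match opt with
    | false => (n + 2) / 4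
    | true => (n + 1) / 4
  | ctl, sk, n => match opt with
    | false => (n + 1) / 4
    | true => n / 4
  | sk, ctl, n => (n + 1) / 3
  | sk, bp1, n => (n + 3) / 6
  | sk, bp2, n => n / 6
  | _, _, _ => 0

/-- A schedule of the protocol. -/
def batchRank (opt : Bool) : Participant → ℕ → ℕ
  -- A buffer is served in a round of 12 time units: `src` acts at times 1 to 3, its processor at 4
  -- and 5, and `sk` receives the results at 6 and 7. The processors serve alternate rounds, hence
  -- the period 24 and the offsets 4 and 16.
  | bp1, n => 24 * (n / 2) + n % 2 + 4
  | bp2, n => 24 * (n / 2) + n % 2 + 16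
  | src, n => 12 * (n / 3) + n % 3 + 1
  | ctl, n => match opt with
    | false => 12 * (n / 4) + if n % 4 = 0 then 0 else n % 4 + 2
    -- The optimised control fills both buffers at times 0 and 1 and then starts each round at time
    -- 3, when the reply of `src` sent at time 2 is available.
    | true => if n < 2 then n else 12 * ((n - 2) / 4) + (n - 2) % 4 + 3
  | sk, n => 12 * (n / 3) + if n % 3 = 0 then 0 else n % 3 + 5
  | .other _, n => n

theorem batchSent_succ (opt : Bool) (p q : Participant) (n : ℕ) :
    batchSent opt p q (n + 1) =
      batchSent opt p q n + if batchAct opt p n = .send q then 1 else 0 := by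
  cases p <;> cases q <;> cases opt <;> simp only [batchSent, batchAct] <;>
    split_ifs <;> simp_all <;> omega

theorem batchRcvd_succ (opt : Bool) (p q : Participant) (n : ℕ) :
    batchRcvd opt p q (n + 1) =
      batchRcvd opt p q n + if batchAct opt p n = .recv q then 1 else 0 := by
  cases p <;> cases q <;> cases opt <;> simp only [batchRcvd, batchAct] <;>
    split_ifs <;> simp_all <;> omega

theorem batchRank_lt (opt : Bool) (p : Participant) (n : ℕ) :
    batchRank opt p n < batchRank opt p (n + 1) := by
  cases p <;> cases opt <;> simp only [batchRank] <;> (try split_ifs) <;> omega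

theorem batchRcvd_lt_batchSent (opt : Bool) (p q : Participant) (n m : ℕ)
    (h : batchAct opt p n = .recv q) (hr : batchRank opt p n ≤ batchRank opt q m) :
    batchRcvd opt p q n < batchSent opt q p m := by
  cases p <;> cases opt <;> simp only [batchAct] at h <;> (try split_ifs at h) <;> cases h <;>
    simp only [batchRank, batchRcvd, batchSent] at hr ⊢ <;> (try split_ifs at hr ⊢) <;> omega

/-- The actions are periodic from the second one on. -/
theorem batchAct_add (opt : Bool) (p : Participant) {n : ℕ} (hn : n ≠ 0) (k : ℕ) :
    batchAct opt p (n + 24 * k) = batchAct opt p n := by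
  -- All the tests are residues modulo 2, 3, 4 or 6, which divide 24, apart from the test for the
  -- very first action of the optimised control.
  have h₀ : n + 24 * k ≠ 0 := by omega
  have h₂ : (n + 24 * k) % 2 = n % 2 := by omega
  have h₃ : (n + 24 * k) % 3 = n % 3 := by omega
  have h₄ : (n + 24 * k) % 4 = n % 4 := by omega
  have h₆ : (n + 24 * k) % 6 = n % 6 := by omega
  cases p <;> simp only [batchAct, hn, h₀, h₂, h₃, h₄, h₆]

theorem batchAct_later {opt : Bool} {p : Participant} {a : Act} (n : ℕ) (hn : n ≠ 0)
    (h : batchAct opt p n = a) (N : ℕ) : ∃ n, N ≤ n ∧ batchAct opt p n = a :=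
  ⟨n + 24 * N, by omega, (batchAct_add opt p hn N).trans h⟩

theorem batchAct_recv_later (opt : Bool) (p q : Participant) (m N : ℕ)
    (h : batchAct opt p m = .send q) : ∃ n, N ≤ n ∧ batchAct opt q n = .recv p := by
  cases p <;> cases opt <;> simp only [batchAct] at h <;> (try split_ifs at h) <;> cases h <;>
    -- One of these nonzero indices is an occurrence of the partner action on the channel at hand;
    -- periodicity repeats it beyond `N`.
    first
    | exact batchAct_later 1 (by decide) rfl N
    | exact batchAct_later 2 (by decide) rfl N
    | exact batchAct_later 3 (by decide) rfl N
    | exact batchAct_later 5 (by decide) rfl N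

theorem batchAct_send_later (opt : Bool) (p q : Participant) (m N : ℕ)
    (h : batchAct opt p m = .recv q) : ∃ n, N ≤ n ∧ batchAct opt q n = .send p := by
  cases p <;> cases opt <;> simp only [batchAct] at h <;> (try split_ifs at h) <;> cases h <;>
    first
    | exact batchAct_later 1 (by decide) rfl N
    | exact batchAct_later 2 (by decide) rfl N
    | exact batchAct_later 3 (by decide) rfl N
    | exact batchAct_later 4 (by decide) rfl N
    | exact batchAct_later 5 (by decide) rfl N

/-- Used twice: with `opt` false for the environment, whose control has the ordinary type, and with
`opt` true for the session, which runs the optimised control. -/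
def batchProtocol (S : Srt) (opt : Bool) : Protocol where
  act := batchAct opt
  msg := batchMsg S
  sent := batchSent opt
  rcvd := batchRcvd opt
  rank := batchRank opt
  sent_zero p q := by cases p <;> cases q <;> cases opt <;> rfl
  rcvd_zero p q := by cases p <;> cases q <;> cases opt <;> rfl
  sent_succ := batchSent_succ opt
  rcvd_succ := batchRcvd_succ opt
  rank_lt := batchRank_lt opt
  rcvd_lt_sent p q n m := batchRcvd_lt_batchSent opt p q n m
  ne_of_recv p q n h := by
    cases p <;> cases opt <;> simp only [batchAct] at h <;> (try split_ifs at h) <;> cases h <;> simp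
  idle_of_idle p n m h := by
    cases p with
    | other _ => rfl
    | _ => cases opt <;> simp only [batchAct] at h <;> split_ifs at h
  recv_later := batchAct_recv_later opt
  send_later := batchAct_send_later opt

/-! ## The types of the parties -/

def tyBpAt (S : Srt) (n : ℕ) : Ty :=
  if n % 2 = 0 then tyBp S else .out1 sk data S (tyBp S)

def tySrcAt (S : Srt) (n : ℕ) : Ty :=
  match n % 6 with
  | 1 => .out1 ctl b1 .unit (.out1 bp1 data S (tySrc S))
  | 2 => .out1 bp1 data S (tySrc S)
  | 4 => .out1 ctl b2 .unit (.out1 bp2 data S (tySrc S))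
  | 5 => .out1 bp2 data S (tySrc S)
  | _ => tySrc S

def tyCtlAt (n : ℕ) : Ty :=
  match n % 8 with
  | 1 => .inp1 src b1 .unit (.inp1 sk b1 .unit (.out1 sk b1 .unit (.out1 src b2 .unit
      (.inp1 src b2 .unit (.inp1 sk b2 .unit (.out1 sk b2 .unit tyCtl))))))
  | 2 => .inp1 sk b1 .unit (.out1 sk b1 .unit (.out1 src b2 .unit
      (.inp1 src b2 .unit (.inp1 sk b2 .unit (.out1 sk b2 .unit tyCtl)))))
  | 3 => .out1 sk b1 .unit (.out1 src b2 .unit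
      (.inp1 src b2 .unit (.inp1 sk b2 .unit (.out1 sk b2 .unit tyCtl))))
  | 4 => .out1 src b2 .unit
      (.inp1 src b2 .unit (.inp1 sk b2 .unit (.out1 sk b2 .unit tyCtl)))
  | 5 => .inp1 src b2 .unit (.inp1 sk b2 .unit (.out1 sk b2 .unit tyCtl))
  | 6 => .inp1 sk b2 .unit (.out1 sk b2 .unit tyCtl)
  | 7 => .out1 sk b2 .unit tyCtl
  | _ => tyCtl

def tySkAt (S : Srt) (n : ℕ) : Ty :=
  match n % 6 with
  | 1 => .inp1 ctl b1 .unit (.inp1 bp1 data S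
      (.out1 ctl b2 .unit (.inp1 ctl b2 .unit (.inp1 bp2 data S (tySk S)))))
  | 2 => .inp1 bp1 data S
      (.out1 ctl b2 .unit (.inp1 ctl b2 .unit (.inp1 bp2 data S (tySk S))))
  | 3 => .out1 ctl b2 .unit (.inp1 ctl b2 .unit (.inp1 bp2 data S (tySk S)))
  | 4 => .inp1 ctl b2 .unit (.inp1 bp2 data S (tySk S))
  | 5 => .inp1 bp2 data S (tySk S)
  | _ => tySk S

/-- The type of a participant after `n` actions, with the unoptimised control. -/
def batchTyAt (S : Srt) : Participant → ℕ → Ty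
  | bp1, n => tyBpAt S n
  | bp2, n => tyBpAt S n
  | src, n => tySrcAt S n
  | ctl, n => tyCtlAt n
  | sk, n => tySkAt S n
  | .other _, _ => .done

/-- What the type `T` must look like for the participant to perform `a` with the message `m` and to
go on with the type `U`. -/
def Ty.Does (T : Ty) (m : Label × Srt) (U : Ty) : Act → Prop
  | .idle => T.Cong .done
  | .send q => T.Cong (.out1 q m.1 m.2 U)
  | .recv q => ∃ (I : Finset Label) (hI : I.Nonempty) (S : I → Srt) (T' : I → Ty) (h : m.1 ∈ I),
      T.Cong (.ext q I hI S T') ∧ S ⟨_, h⟩ = m.2 ∧ (T' ⟨_, h⟩).Cong U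

theorem Ty.does_inp1 {T U : Ty} {q : Participant} {ℓ : Label} {S : Srt}
    (h : T.Cong (.inp1 q ℓ S U)) : T.Does (ℓ, S) U (.recv q) :=
  ⟨_, _, _, _, Finset.mem_singleton_self ℓ, h, rfl, .refl _⟩

theorem bLabel_even {j : ℕ} (h : j % 2 = 0) : bLabel j = b1 := by simp [bLabel, h]

theorem bLabel_odd {j : ℕ} (h : j % 2 = 1) : bLabel j = b2 := by simp [bLabel, h]

theorem tyBp_unfold (S : Srt) :
    (tyBp S).Cong (.inp1 src data S (.out1 sk data S (tyBp S))) := .unfold _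

/-- Substitution does not compute through a conditional on an unknown label, so this unfolding needs
a case split where those of the other types hold by computation. -/
theorem tySrc_inst (S : Srt) : (Ty.ext ctl {b1, b2} (Finset.insert_nonempty _ _) (fun _ => .unit)
    (fun i => if i.1 = b1 then .out1 ctl b1 .unit (.out1 bp1 data S (.var 0))
      else .out1 ctl b2 .unit (.out1 bp2 data S (.var 0)))).inst (tySrc S) =
    .ext ctl {b1, b2} (Finset.insert_nonempty _ _) (fun _ => .unit) (fun i =>
      if i.1 = b1 then .out1 ctl b1 .unit (.out1 bp1 data S (tySrc S))
      else .out1 ctl b2 .unit (.out1 bp2 data S (tySrc S))) := by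
  simp only [Ty.inst, Ty.subst]
  congr 1
  funext i
  split_ifs <;> rfl

theorem tySrc_unfold (S : Srt) : (tySrc S).Cong
    (.ext ctl {b1, b2} (Finset.insert_nonempty _ _) (fun _ => .unit) (fun i =>
      if i.1 = b1 then .out1 ctl b1 .unit (.out1 bp1 data S (tySrc S))
      else .out1 ctl b2 .unit (.out1 bp2 data S (tySrc S)))) := by
  rw [← tySrc_inst]
  exact .unfold _

theorem tyCtl_unfold : tyCtl.Cong (.out1 src b1 .unit (tyCtlAt 1)) := .unfold _

theorem tySk_unfold (S : Srt) : (tySk S).Cong (.out1 ctl b1 .unit (tySkAt S 1)) := .unfold _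

theorem tyBpAt_does (S : Srt) (n : ℕ) :
    (tyBpAt S n).Does (data, S) (tyBpAt S (n + 1)) (if n % 2 = 0 then .recv src else .send sk) := by
  rcases Nat.mod_two_eq_zero_or_one n with h | h
  · have h' : (n + 1) % 2 = 1 := by omega
    simp only [tyBpAt, h, h']
    exact Ty.does_inp1 (tyBp_unfold S)
  · have h' : (n + 1) % 2 = 0 := by omega
    simp only [tyBpAt, h, h']
    exact .refl _

/-- One check for each stage of a cycle: two stages for a processor, six for the source and the
sink, eight for the control. A single message `m` covers sends and receptions uniformly; for an idle
participant it is arbitrary. -/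
theorem batchTyAt_does (S : Srt) (p : Participant) (n : ℕ) :
    ∃ m, (batchTyAt S p n).Does m (batchTyAt S p (n + 1)) (batchAct false p n) ∧
      (∀ q, batchAct false p n = .send q → m = batchMsg S p q (batchSent false p q n)) ∧
      ∀ q, batchAct false p n = .recv q → m = batchMsg S q p (batchRcvd false p q n) := by
  cases p with
  | bp1 =>
    refine ⟨_, tyBpAt_does S n, fun q hq => ?_, fun q hq => ?_⟩ <;>
      simp only [batchAct] at hq <;> split_ifs at hq <;> cases hq <;> rfl
  | bp2 =>
    refine ⟨_, tyBpAt_does S n, fun q hq => ?_, fun q hq => ?_⟩ <;>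
      simp only [batchAct] at hq <;> split_ifs at hq <;> cases hq <;> rfl
  | src =>
    have h6 : n % 6 = 0 ∨ n % 6 = 1 ∨ n % 6 = 2 ∨ n % 6 = 3 ∨ n % 6 = 4 ∨ n % 6 = 5 := by omega
    rcases h6 with h | h | h | h | h | h
    · have h₁ : (n + 1) % 6 = 1 := by omega
      have h₂ : n % 3 = 0 := by omega
      -- The parity of the number of messages received so far decides between the two labels.
      have h₃ : (n + 2) / 3 % 2 = 0 := by omega
      simp only [batchAct, batchTyAt, tySrcAt, h, h₁, h₂, if_true]
      exact ⟨(b1, .unit), ⟨_, _, _, _, by simp, tySrc_unfold S, rfl, .refl _⟩, by simp,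
        by simp [batchMsg, batchRcvd, bLabel_even h₃]⟩
    · have h₁ : (n + 1) % 6 = 2 := by omega
      have h₂ : n % 3 = 1 := by omega
      have h₃ : (n + 1) / 3 % 2 = 0 := by omega
      simp only [batchAct, batchTyAt, tySrcAt, h, h₁, h₂, if_true]
      exact ⟨(b1, .unit), .refl _, by simp [batchMsg, batchSent, bLabel_even h₃], by simp⟩
    · have h₁ : (n + 1) % 6 = 3 := by omega
      have h₂ : n % 3 = 2 := by omega
      simp only [batchAct, batchTyAt, tySrcAt, h, h₁, h₂, if_true]
      exact ⟨(data, S), .refl _, by simp [batchMsg], by simp⟩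
    · have h₁ : (n + 1) % 6 = 4 := by omega
      have h₂ : n % 3 = 0 := by omega
      have h₃ : (n + 2) / 3 % 2 = 1 := by omega
      simp only [batchAct, batchTyAt, tySrcAt, h, h₁, h₂, if_true]
      exact ⟨(b2, .unit), ⟨_, _, _, _, by simp, tySrc_unfold S, rfl, .refl _⟩, by simp,
        by simp [batchMsg, batchRcvd, bLabel_odd h₃]⟩
    · have h₁ : (n + 1) % 6 = 5 := by omega
      have h₂ : n % 3 = 1 := by omega
      have h₃ : (n + 1) / 3 % 2 = 1 := by omega
      simp only [batchAct, batchTyAt, tySrcAt, h, h₁, h₂, if_true]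
      exact ⟨(b2, .unit), .refl _, by simp [batchMsg, batchSent, bLabel_odd h₃], by simp⟩
    · have h₁ : (n + 1) % 6 = 0 := by omega
      have h₂ : n % 3 = 2 := by omega
      simp only [batchAct, batchTyAt, tySrcAt, h, h₁, h₂]
      exact ⟨(data, S), .refl _, by simp [batchMsg], by simp⟩
  | ctl =>
    have h8 : n % 8 = 0 ∨ n % 8 = 1 ∨ n % 8 = 2 ∨ n % 8 = 3 ∨ n % 8 = 4 ∨ n % 8 = 5 ∨ n % 8 = 6 ∨
      n % 8 = 7 := by omega
    rcases h8 with h | h | h | h | h | h | h | h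
    · have h₁ : (n + 1) % 8 = 1 := by omega
      have h₂ : n % 4 = 0 := by omega
      have h₃ : (n + 3) / 4 % 2 = 0 := by omega
      simp only [batchAct, batchTyAt, tyCtlAt, h, h₁, h₂, if_true]
      exact ⟨(b1, .unit), tyCtl_unfold, by simp [batchMsg, batchSent, bLabel_even h₃], by simp⟩
    · have h₁ : (n + 1) % 8 = 2 := by omega
      have h₂ : n % 4 = 1 := by omega
      have h₃ : (n + 2) / 4 % 2 = 0 := by omega
      simp only [batchAct, batchTyAt, tyCtlAt, h, h₁, h₂, if_true]
      exact ⟨(b1, .unit), Ty.does_inp1 (.refl _), by simp,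
        by simp [batchMsg, batchRcvd, bLabel_even h₃]⟩
    · have h₁ : (n + 1) % 8 = 3 := by omega
      have h₂ : n % 4 = 2 := by omega
      have h₃ : (n + 1) / 4 % 2 = 0 := by omega
      simp only [batchAct, batchTyAt, tyCtlAt, h, h₁, h₂, if_true]
      exact ⟨(b1, .unit), Ty.does_inp1 (.refl _), by simp,
        by simp [batchMsg, batchRcvd, bLabel_even h₃]⟩
    · have h₁ : (n + 1) % 8 = 4 := by omega
      have h₂ : n % 4 = 3 := by omega
      have h₃ : n / 4 % 2 = 0 := by omega
      simp only [batchAct, batchTyAt, tyCtlAt, h, h₁, h₂]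
      exact ⟨(b1, .unit), .refl _, by simp [batchMsg, batchSent, bLabel_even h₃], by simp⟩
    · have h₁ : (n + 1) % 8 = 5 := by omega
      have h₂ : n % 4 = 0 := by omega
      have h₃ : (n + 3) / 4 % 2 = 1 := by omega
      simp only [batchAct, batchTyAt, tyCtlAt, h, h₁, h₂, if_true]
      exact ⟨(b2, .unit), .refl _, by simp [batchMsg, batchSent, bLabel_odd h₃], by simp⟩
    · have h₁ : (n + 1) % 8 = 6 := by omega
      have h₂ : n % 4 = 1 := by omega
      have h₃ : (n + 2) / 4 % 2 = 1 := by omega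
      simp only [batchAct, batchTyAt, tyCtlAt, h, h₁, h₂, if_true]
      exact ⟨(b2, .unit), Ty.does_inp1 (.refl _), by simp,
        by simp [batchMsg, batchRcvd, bLabel_odd h₃]⟩
    · have h₁ : (n + 1) % 8 = 7 := by omega
      have h₂ : n % 4 = 2 := by omega
      have h₃ : (n + 1) / 4 % 2 = 1 := by omega
      simp only [batchAct, batchTyAt, tyCtlAt, h, h₁, h₂, if_true]
      exact ⟨(b2, .unit), Ty.does_inp1 (.refl _), by simp,
        by simp [batchMsg, batchRcvd, bLabel_odd h₃]⟩
    · have h₁ : (n + 1) % 8 = 0 := by omega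
      have h₂ : n % 4 = 3 := by omega
      have h₃ : n / 4 % 2 = 1 := by omega
      simp only [batchAct, batchTyAt, tyCtlAt, h, h₁, h₂]
      exact ⟨(b2, .unit), .refl _, by simp [batchMsg, batchSent, bLabel_odd h₃], by simp⟩
  | sk =>
    have h6 : n % 6 = 0 ∨ n % 6 = 1 ∨ n % 6 = 2 ∨ n % 6 = 3 ∨ n % 6 = 4 ∨ n % 6 = 5 := by omega
    rcases h6 with h | h | h | h | h | h
    · have h₁ : (n + 1) % 6 = 1 := by omega
      have h₂ : n % 3 = 0 := by omega
      have h₃ : (n + 2) / 3 % 2 = 0 := by omega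
      simp only [batchAct, batchTyAt, tySkAt, h, h₁, h₂, if_true]
      exact ⟨(b1, .unit), tySk_unfold S, by simp [batchMsg, batchSent, bLabel_even h₃], by simp⟩
    · have h₁ : (n + 1) % 6 = 2 := by omega
      have h₂ : n % 3 = 1 := by omega
      have h₃ : (n + 1) / 3 % 2 = 0 := by omega
      simp only [batchAct, batchTyAt, tySkAt, h, h₁, h₂, if_true]
      exact ⟨(b1, .unit), Ty.does_inp1 (.refl _), by simp,
        by simp [batchMsg, batchRcvd, bLabel_even h₃]⟩
    · have h₁ : (n + 1) % 6 = 3 := by omega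
      have h₂ : n % 3 = 2 := by omega
      simp only [batchAct, batchTyAt, tySkAt, h, h₁, h₂, if_true]
      exact ⟨(data, S), Ty.does_inp1 (.refl _), by simp, by simp [batchMsg]⟩
    · have h₁ : (n + 1) % 6 = 4 := by omega
      have h₂ : n % 3 = 0 := by omega
      have h₃ : (n + 2) / 3 % 2 = 1 := by omega
      simp only [batchAct, batchTyAt, tySkAt, h, h₁, h₂, if_true]
      exact ⟨(b2, .unit), .refl _, by simp [batchMsg, batchSent, bLabel_odd h₃], by simp⟩
    · have h₁ : (n + 1) % 6 = 5 := by omega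
      have h₂ : n % 3 = 1 := by omega
      have h₃ : (n + 1) / 3 % 2 = 1 := by omega
      simp only [batchAct, batchTyAt, tySkAt, h, h₁, h₂, if_true]
      exact ⟨(b2, .unit), Ty.does_inp1 (.refl _), by simp,
        by simp [batchMsg, batchRcvd, bLabel_odd h₃]⟩
    · have h₁ : (n + 1) % 6 = 0 := by omega
      have h₂ : n % 3 = 2 := by omega
      simp only [batchAct, batchTyAt, tySkAt, h, h₁, h₂]
      exact ⟨(data, S), Ty.does_inp1 (.refl _), by simp, by simp [batchMsg]⟩
  | other k => exact ⟨(data, S), .refl _, by simp [batchAct], by simp [batchAct]⟩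

theorem batchProtocol_typedBy (S : Srt) : (batchProtocol S false).TypedBy (batchTyAt S) where
  idle p n h := by
    obtain ⟨m, hm, -⟩ := batchTyAt_does S p n
    rwa [show batchAct false p n = .idle from h] at hm
  send p q n h := by
    obtain ⟨m, hm, hs, -⟩ := batchTyAt_does S p n
    rw [show batchAct false p n = .send q from h] at hm
    obtain rfl := hs q h
    exact hm
  recv p q n h := by
    obtain ⟨m, hm, -, hr⟩ := batchTyAt_does S p n
    rw [show batchAct false p n = .recv q from h] at hm
    obtain rfl := hr q h
    exact hm

theorem batchEnv_live (S : Srt) : (batchEnv S).Live := by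
  refine Protocol.EnvAt.live (batchProtocol_typedBy S) ⟨Protocol.consistent_zero _, fun p => ?_⟩
  have hv : (batchEnv S).view p = ([], batchTyAt S p 0) := by
    cases p <;> rfl
  rw [hv]
  exact ⟨.refl _, fun q => by rw [Protocol.pending_zero]; rfl⟩

end AsyncMPST

/-! ### The processes follow the protocol with the optimised control. -/

namespace AsyncMPST

open Participant Label

/-! ## The processes of the parties -/

def prSrcAt (datum : Expr) (n : ℕ) : Proc :=
  match n % 6 with
  | 1 => .out ctl b1 (.val .unit) (.out bp1 data datum (prSrc datum))
  | 2 => .out bp1 data datum (prSrc datum)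
  | 4 => .out ctl b2 (.val .unit) (.out bp2 data datum (prSrc datum))
  | 5 => .out bp2 data datum (prSrc datum)
  | _ => prSrc datum

/-- The loop of the optimised control. -/
def prCtlLoop : Proc :=
  .mu (.ext1 src b1 (.ext1 sk b1 (.out sk b1 (.val .unit) (.out src b1 (.val .unit)
    (.ext1 src b2 (.ext1 sk b2 (.out sk b2 (.val .unit) (.out src b2 (.val .unit)
      (.var 0)))))))))

/-- The second initial output followed by the loop coincides with the last stage of the loop, so
only stage `0` falls outside the cycle of eight; the loop starts at residue `2`. -/
def prCtlAt (n : ℕ) : Proc :=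
  if n = 0 then prCtl else
  match n % 8 with
  | 3 => .ext1 sk b1 (.out sk b1 (.val .unit) (.out src b1 (.val .unit)
      (.ext1 src b2 (.ext1 sk b2 (.out sk b2 (.val .unit) (.out src b2 (.val .unit)
        prCtlLoop))))))
  | 4 => .out sk b1 (.val .unit) (.out src b1 (.val .unit)
      (.ext1 src b2 (.ext1 sk b2 (.out sk b2 (.val .unit) (.out src b2 (.val .unit)
        prCtlLoop)))))
  | 5 => .out src b1 (.val .unit)
      (.ext1 src b2 (.ext1 sk b2 (.out sk b2 (.val .unit) (.out src b2 (.val .unit)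
        prCtlLoop))))
  | 6 => .ext1 src b2 (.ext1 sk b2 (.out sk b2 (.val .unit) (.out src b2 (.val .unit) prCtlLoop)))
  | 7 => .ext1 sk b2 (.out sk b2 (.val .unit) (.out src b2 (.val .unit) prCtlLoop))
  | 0 => .out sk b2 (.val .unit) (.out src b2 (.val .unit) prCtlLoop)
  | 1 => .out src b2 (.val .unit) prCtlLoop
  | _ => prCtlLoop

def prSkAt (n : ℕ) : Proc :=
  match n % 6 with
  | 1 => .ext1 ctl b1 (.ext1 bp1 data
      (.out ctl b2 (.val .unit) (.ext1 ctl b2 (.ext1 bp2 data prSk))))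
  | 2 => .ext1 bp1 data (.out ctl b2 (.val .unit) (.ext1 ctl b2 (.ext1 bp2 data prSk)))
  | 3 => .out ctl b2 (.val .unit) (.ext1 ctl b2 (.ext1 bp2 data prSk))
  | 4 => .ext1 ctl b2 (.ext1 bp2 data prSk)
  | 5 => .ext1 bp2 data prSk
  | _ => prSk

/-- After a reception the expression to be sent depends on the received value, of which only the
sort is known. This is why stages are sets of processes. -/
def prBpAt (S : Srt) (f : Expr) (n : ℕ) : Set Proc :=
  if n % 2 = 0 then {prBp f} else {X | ∃ e, HasSort [] e S ∧ X = .out sk data e (prBp f)}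

/-- The processes of a participant after `n` actions, with the optimised control. -/
def batchProcAt (S : Srt) (f datum : Expr) : Participant → ℕ → Set Proc
  | bp1, n => prBpAt S f n
  | bp2, n => prBpAt S f n
  | src, n => {prSrcAt datum n}
  | ctl, n => {prCtlAt n}
  | sk, n => {prSkAt n}
  | .other _, _ => {.nil}

/-- What the process `X` must look like for the participant to perform `a` with the message `m` and
to go on with a process of `Z`. -/
def Proc.Does (X : Proc) (m : Label × Srt) (Z : Set Proc) : Act → Prop
  | .idle => X.Cong .nil
  | .send q => ∃ e, ∃ Y ∈ Z, HasSort [] e m.2 ∧ X.Cong (.out q m.1 e Y)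
  | .recv q => ∃ (I : Finset Label) (R : I → Proc) (h : m.1 ∈ I), X.Cong (.ext q I R) ∧
      ∀ v, HasSort [] (.val v) m.2 → ∃ Y ∈ Z, ((R ⟨_, h⟩).instE v).Cong Y

theorem Proc.does_out {X Y : Proc} {q : Participant} {ℓ : Label} {e : Expr} {S : Srt}
    (h : X.Cong (.out q ℓ e Y)) (he : HasSort [] e S) : X.Does (ℓ, S) {Y} (.send q) :=
  ⟨e, Y, rfl, he, h⟩

theorem Proc.does_ext1 {X R Y : Proc} {q : Participant} {ℓ : Label} {S : Srt}
    (h : X.Cong (.ext1 q ℓ R)) (hR : ∀ v, R.instE v = Y) : X.Does (ℓ, S) {Y} (.recv q) :=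
  ⟨_, _, Finset.mem_singleton_self ℓ, h, fun v _ => ⟨Y, rfl, hR v ▸ .refl _⟩⟩

section Closed

variable {S : Srt} {f datum : Expr}

/-- The only variable of `f` is bound by the input. Hence neither the shift of the recursive process
under that binder nor the substitution of a received value affects the next iteration. -/
theorem prBp_substE (hf : HasSort [S] f S) (σ : ℕ → Expr) : (prBp f).substE σ = prBp f := by
  have : f.subst (upExpr σ) = f := hf.subst_eq_self fun x hx => by
    obtain rfl : x = 0 := by simpa using hx
    rfl
  simp [prBp, Proc.ext1, Proc.substE, this]

theorem prBp_renE (hf : HasSort [S] f S) (ρ : ℕ → ℕ) : (prBp f).renE ρ = prBp f := by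
  rw [Proc.renE_eq_substE, prBp_substE hf]

theorem prBp_unfold (hf : HasSort [S] f S) :
    (prBp f).Cong (.ext1 src data (.out sk data f (prBp f))) := by
  have h : (Proc.ext1 src data (.out sk data f (.var 0))).instP (prBp f) =
      .ext1 src data (.out sk data f ((prBp f).renE Nat.succ)) := rfl
  rw [prBp_renE hf] at h
  rw [← h]
  exact .unfold _

theorem prSrc_substE (hd : HasSort [] datum S) (σ : ℕ → Expr) :
    (prSrc datum).substE σ = prSrc datum := by
  have h : ∀ σ, datum.subst σ = datum := fun σ => hd.subst_eq_self (by simp)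
  simp only [prSrc, Proc.substE]
  congr 2
  funext i
  split_ifs <;> simp [Proc.substE, h, Expr.subst]

theorem prSrc_renE (hd : HasSort [] datum S) (ρ : ℕ → ℕ) : (prSrc datum).renE ρ = prSrc datum := by
  rw [Proc.renE_eq_substE, prSrc_substE hd]

theorem prSrc_unfold (hd : HasSort [] datum S) : (prSrc datum).Cong (.ext ctl {b1, b2} (fun i =>
    if i.1 = b1 then .out ctl b1 (.val .unit) (.out bp1 data datum (prSrc datum))
    else .out ctl b2 (.val .unit) (.out bp2 data datum (prSrc datum)))) := by
  have h : (Proc.ext ctl {b1, b2} (fun i =>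
      if i.1 = b1 then .out ctl b1 (.val .unit) (.out bp1 data datum (.var 0))
      else .out ctl b2 (.val .unit) (.out bp2 data datum (.var 0)))).instP (prSrc datum) =
      .ext ctl {b1, b2} (fun i =>
        if i.1 = b1 then .out ctl b1 (.val .unit) (.out bp1 data datum (prSrc datum))
        else .out ctl b2 (.val .unit) (.out bp2 data datum (prSrc datum))) := by
    simp only [Proc.instP, Proc.substP]
    congr 1
    funext i
    split_ifs <;> simp [Proc.substP, prSrc_renE hd]
  rw [← h]
  exact .unfold _

theorem prSrcAt_substE (hd : HasSort [] datum S) (n : ℕ) (σ : ℕ → Expr) :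
    (prSrcAt datum n).substE σ = prSrcAt datum n := by
  have h : ∀ σ, datum.subst σ = datum := fun σ => hd.subst_eq_self (by simp)
  unfold prSrcAt
  split <;> simp [Proc.substE, h, Expr.subst, prSrc_substE hd]

/-- The two branches enter the cycle of six stages at `1` and at `4`; the message from the control
decides which. -/
theorem prSrc_does (hd : HasSort [] datum S) : (prSrc datum).Does (b1, .unit) {prSrcAt datum 1}
    (.recv ctl) ∧ (prSrc datum).Does (b2, .unit) {prSrcAt datum 4} (.recv ctl) :=
  ⟨⟨_, _, by simp, prSrc_unfold hd, fun v _ => ⟨_, rfl, by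
      rw [Proc.instE, if_pos rfl]
      exact prSrcAt_substE hd 1 _ ▸ .refl _⟩⟩,
    ⟨_, _, by simp, prSrc_unfold hd, fun v _ => ⟨_, rfl, by
      rw [Proc.instE, if_neg (by simp)]
      exact prSrcAt_substE hd 4 _ ▸ .refl _⟩⟩⟩

theorem prBpAt_does (hf : HasSort [S] f S) {n : ℕ} {X : Proc} (hX : X ∈ prBpAt S f n) :
    X.Does (data, S) (prBpAt S f (n + 1)) (if n % 2 = 0 then .recv src else .send sk) := by
  rcases Nat.mod_two_eq_zero_or_one n with h | h
  · have h' : (n + 1) % 2 = 1 := by omega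
    simp only [prBpAt, h, h', if_true] at hX ⊢
    obtain rfl := hX
    refine ⟨_, _, Finset.mem_singleton_self data, prBp_unfold hf, fun v hv =>
      ⟨.out sk data (f.subst fun n => match n with
        | 0 => .val v
        | n + 1 => .var n) (prBp f), ⟨_, ?_, rfl⟩, ?_⟩⟩
    · refine hf.subst fun x T hx => ?_
      cases x with
      | zero =>
        obtain rfl : S = T := by simpa using hx
        exact hv
      | succ x => simp at hx
    · rw [Proc.instE, Proc.substE, prBp_substE hf]
      exact .refl _
  · have h' : (n + 1) % 2 = 0 := by omega
    simp only [prBpAt, h, h', if_true] at hX ⊢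
    obtain ⟨e, he, rfl⟩ := hX
    exact ⟨e, _, rfl, he, .refl _⟩

theorem batchProcAt_does (hf : HasSort [S] f S) (hd : HasSort [] datum S) (p : Participant)
    (n : ℕ) {X : Proc} (hX : X ∈ batchProcAt S f datum p n) :
    ∃ m, X.Does m (batchProcAt S f datum p (n + 1)) (batchAct true p n) ∧
      (∀ q, batchAct true p n = .send q → m = batchMsg S p q (batchSent true p q n)) ∧
      ∀ q, batchAct true p n = .recv q → m = batchMsg S q p (batchRcvd true p q n) := by
  have hu : HasSort [] (.val .unit) .unit := .unit _
  cases p with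
  | bp1 =>
    refine ⟨_, prBpAt_does hf hX, fun q hq => ?_, fun q hq => ?_⟩ <;>
      simp only [batchAct] at hq <;> split_ifs at hq <;> cases hq <;> rfl
  | bp2 =>
    refine ⟨_, prBpAt_does hf hX, fun q hq => ?_, fun q hq => ?_⟩ <;>
      simp only [batchAct] at hq <;> split_ifs at hq <;> cases hq <;> rfl
  | src =>
    obtain rfl := hX
    have h6 : n % 6 = 0 ∨ n % 6 = 1 ∨ n % 6 = 2 ∨ n % 6 = 3 ∨ n % 6 = 4 ∨ n % 6 = 5 := by omega
    rcases h6 with h | h | h | h | h | h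
    · have h₁ : (n + 1) % 6 = 1 := by omega
      have h₂ : n % 3 = 0 := by omega
      have h₃ : (n + 2) / 3 % 2 = 0 := by omega
      simp only [batchAct, batchProcAt, prSrcAt, h, h₁, h₂, if_true]
      exact ⟨(b1, .unit), (prSrc_does hd).1, by simp,
        by simp [batchMsg, batchRcvd, bLabel_even h₃]⟩
    · have h₁ : (n + 1) % 6 = 2 := by omega
      have h₂ : n % 3 = 1 := by omega
      have h₃ : (n + 1) / 3 % 2 = 0 := by omega
      simp only [batchAct, batchProcAt, prSrcAt, h, h₁, h₂, if_true]
      exact ⟨(b1, .unit), Proc.does_out (.refl _) hu,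
        by simp [batchMsg, batchSent, bLabel_even h₃], by simp⟩
    · have h₁ : (n + 1) % 6 = 3 := by omega
      have h₂ : n % 3 = 2 := by omega
      simp only [batchAct, batchProcAt, prSrcAt, h, h₁, h₂, if_true]
      exact ⟨(data, S), Proc.does_out (.refl _) hd, by simp [batchMsg], by simp⟩
    · have h₁ : (n + 1) % 6 = 4 := by omega
      have h₂ : n % 3 = 0 := by omega
      have h₃ : (n + 2) / 3 % 2 = 1 := by omega
      simp only [batchAct, batchProcAt, prSrcAt, h, h₁, h₂, if_true]
      exact ⟨(b2, .unit), (prSrc_does hd).2, by simp,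
        by simp [batchMsg, batchRcvd, bLabel_odd h₃]⟩
    · have h₁ : (n + 1) % 6 = 5 := by omega
      have h₂ : n % 3 = 1 := by omega
      have h₃ : (n + 1) / 3 % 2 = 1 := by omega
      simp only [batchAct, batchProcAt, prSrcAt, h, h₁, h₂, if_true]
      exact ⟨(b2, .unit), Proc.does_out (.refl _) hu,
        by simp [batchMsg, batchSent, bLabel_odd h₃], by simp⟩
    · have h₁ : (n + 1) % 6 = 0 := by omega
      have h₂ : n % 3 = 2 := by omega
      simp only [batchAct, batchProcAt, prSrcAt, h, h₁, h₂]
      exact ⟨(data, S), Proc.does_out (.refl _) hd, by simp [batchMsg], by simp⟩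
  | ctl =>
    obtain rfl := hX
    -- The first output of the control lies outside its cycle.
    by_cases h0 : n = 0
    · subst h0
      exact ⟨(b1, .unit), Proc.does_out (.refl _) hu, by simp [batchAct, batchMsg, batchSent, bLabel],
        by simp [batchAct]⟩
    have h8 : n % 8 = 0 ∨ n % 8 = 1 ∨ n % 8 = 2 ∨ n % 8 = 3 ∨ n % 8 = 4 ∨ n % 8 = 5 ∨
      n % 8 = 6 ∨ n % 8 = 7 := by omega
    have h0' : n + 1 ≠ 0 := by omega
    rcases h8 with h | h | h | h | h | h | h | h
    · have h₁ : (n + 1) % 8 = 1 := by omega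
      have h₂ : n % 4 = 0 := by omega
      have h₃ : (n - 1) / 4 % 2 = 1 := by omega
      simp only [batchAct, batchProcAt, prCtlAt, h, h₁, h₂, if_false, h0, h0']
      exact ⟨(b2, .unit), Proc.does_out (.refl _) hu,
        by simp [batchMsg, batchSent, bLabel_odd h₃], by simp⟩
    · have h₁ : (n + 1) % 8 = 2 := by omega
      have h₂ : n % 4 = 1 := by omega
      have h₃ : (n + 6) / 4 % 2 = 1 := by omega
      simp only [batchAct, batchProcAt, prCtlAt, h, h₁, h₂, if_false, if_true, h0, h0']
      exact ⟨(b2, .unit), Proc.does_out (.refl _) hu,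
        by simp [batchMsg, batchSent, bLabel_odd h₃, h0], by simp⟩
    · have h₁ : (n + 1) % 8 = 3 := by omega
      have h₂ : n % 4 = 2 := by omega
      have h₃ : (n + 1) / 4 % 2 = 0 := by omega
      simp only [batchAct, batchProcAt, prCtlAt, h, h₁, h₂, if_false, if_true, h0, h0']
      exact ⟨(b1, .unit), Proc.does_ext1 (.unfold _) fun _ => rfl, by simp,
        by simp [batchMsg, batchRcvd, bLabel_even h₃]⟩
    · have h₁ : (n + 1) % 8 = 4 := by omega
      have h₂ : n % 4 = 3 := by omega
      have h₃ : n / 4 % 2 = 0 := by omega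
      simp only [batchAct, batchProcAt, prCtlAt, h, h₁, h₂, if_false, if_true, h0, h0']
      exact ⟨(b1, .unit), Proc.does_ext1 (.refl _) fun _ => rfl, by simp,
        by simp [batchMsg, batchRcvd, bLabel_even h₃]⟩
    · have h₁ : (n + 1) % 8 = 5 := by omega
      have h₂ : n % 4 = 0 := by omega
      have h₃ : (n - 1) / 4 % 2 = 0 := by omega
      simp only [batchAct, batchProcAt, prCtlAt, h, h₁, h₂, if_false, h0, h0']
      exact ⟨(b1, .unit), Proc.does_out (.refl _) hu,
        by simp [batchMsg, batchSent, bLabel_even h₃], by simp⟩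
    · have h₁ : (n + 1) % 8 = 6 := by omega
      have h₂ : n % 4 = 1 := by omega
      have h₃ : (n + 6) / 4 % 2 = 0 := by omega
      simp only [batchAct, batchProcAt, prCtlAt, h, h₁, h₂, if_false, if_true, h0, h0']
      exact ⟨(b1, .unit), Proc.does_out (.refl _) hu,
        by simp [batchMsg, batchSent, bLabel_even h₃, h0], by simp⟩
    · have h₁ : (n + 1) % 8 = 7 := by omega
      have h₂ : n % 4 = 2 := by omega
      have h₃ : (n + 1) / 4 % 2 = 1 := by omega
      simp only [batchAct, batchProcAt, prCtlAt, h, h₁, h₂, if_false, if_true, h0, h0']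
      exact ⟨(b2, .unit), Proc.does_ext1 (.refl _) fun _ => rfl, by simp,
        by simp [batchMsg, batchRcvd, bLabel_odd h₃]⟩
    · have h₁ : (n + 1) % 8 = 0 := by omega
      have h₂ : n % 4 = 3 := by omega
      have h₃ : n / 4 % 2 = 1 := by omega
      simp only [batchAct, batchProcAt, prCtlAt, h, h₁, h₂, if_false, if_true, h0, h0']
      exact ⟨(b2, .unit), Proc.does_ext1 (.refl _) fun _ => rfl, by simp,
        by simp [batchMsg, batchRcvd, bLabel_odd h₃]⟩
  | sk =>
    obtain rfl := hX
    have h6 : n % 6 = 0 ∨ n % 6 = 1 ∨ n % 6 = 2 ∨ n % 6 = 3 ∨ n % 6 = 4 ∨ n % 6 = 5 := by omega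
    rcases h6 with h | h | h | h | h | h
    · have h₁ : (n + 1) % 6 = 1 := by omega
      have h₂ : n % 3 = 0 := by omega
      have h₃ : (n + 2) / 3 % 2 = 0 := by omega
      simp only [batchAct, batchProcAt, prSkAt, h, h₁, h₂, if_true]
      exact ⟨(b1, .unit), Proc.does_out (.unfold _) hu,
        by simp [batchMsg, batchSent, bLabel_even h₃], by simp⟩
    · have h₁ : (n + 1) % 6 = 2 := by omega
      have h₂ : n % 3 = 1 := by omega
      have h₃ : (n + 1) / 3 % 2 = 0 := by omega
      simp only [batchAct, batchProcAt, prSkAt, h, h₁, h₂, if_true]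
      exact ⟨(b1, .unit), Proc.does_ext1 (.refl _) fun _ => rfl, by simp,
        by simp [batchMsg, batchRcvd, bLabel_even h₃]⟩
    · have h₁ : (n + 1) % 6 = 3 := by omega
      have h₂ : n % 3 = 2 := by omega
      simp only [batchAct, batchProcAt, prSkAt, h, h₁, h₂, if_true]
      exact ⟨(data, S), Proc.does_ext1 (.refl _) fun _ => rfl, by simp, by simp [batchMsg]⟩
    · have h₁ : (n + 1) % 6 = 4 := by omega
      have h₂ : n % 3 = 0 := by omega
      have h₃ : (n + 2) / 3 % 2 = 1 := by omega
      simp only [batchAct, batchProcAt, prSkAt, h, h₁, h₂, if_true]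
      exact ⟨(b2, .unit), Proc.does_out (.refl _) hu,
        by simp [batchMsg, batchSent, bLabel_odd h₃], by simp⟩
    · have h₁ : (n + 1) % 6 = 5 := by omega
      have h₂ : n % 3 = 1 := by omega
      have h₃ : (n + 1) / 3 % 2 = 1 := by omega
      simp only [batchAct, batchProcAt, prSkAt, h, h₁, h₂, if_true]
      exact ⟨(b2, .unit), Proc.does_ext1 (.refl _) fun _ => rfl, by simp,
        by simp [batchMsg, batchRcvd, bLabel_odd h₃]⟩
    · have h₁ : (n + 1) % 6 = 0 := by omega
      have h₂ : n % 3 = 2 := by omega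
      simp only [batchAct, batchProcAt, prSkAt, h, h₁, h₂]
      exact ⟨(data, S), Proc.does_ext1 (.refl _) fun _ => rfl, by simp, by simp [batchMsg]⟩
  | other k =>
    obtain rfl := hX
    exact ⟨(data, S), .refl _, by simp [batchAct], by simp [batchAct]⟩

theorem batchProtocol_implementedBy (hf : HasSort [S] f S) (hd : HasSort [] datum S) :
    (batchProtocol S true).ImplementedBy (batchProcAt S f datum) where
  idle p n X h hX := by
    obtain ⟨m, hm, -⟩ := batchProcAt_does hf hd p n hX
    rwa [show batchAct true p n = .idle from h] at hm
  send p q n X h hX := by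
    obtain ⟨m, hm, hs, -⟩ := batchProcAt_does hf hd p n hX
    rw [show batchAct true p n = .send q from h] at hm
    obtain rfl := hs q h
    exact hm
  recv p q n X h hX := by
    obtain ⟨m, hm, -, hr⟩ := batchProcAt_does hf hd p n hX
    rw [show batchAct true p n = .recv q from h] at hm
    obtain rfl := hr q h
    exact hm

/-- Initially all counters are zero and nothing is in transit. Any active participant would do as
the witness `bp1`, which shows that the protocol is not idle altogether. -/
theorem batchSess_not_red_error (hf : HasSort [S] f S) (hd : HasSort [] datum S) :
    ¬ Relation.ReflTransGen Sess.Red (batchSess f datum) .error := by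
  refine Protocol.SessAt.not_red_error (batchProtocol_implementedBy hf hd) (r := bp1)
    (by simp [batchProtocol, batchAct]) (c := fun _ => 0)
    ⟨by simp [batchSess, Sess.NoError], by simp [batchSess, Sess.WF, Sess.comps],
      Protocol.consistent_zero _, fun p => ?_⟩
  have hv : ∃ X ∈ batchProcAt S f datum p 0, (batchSess f datum).view p = (X, []) := by
    cases p <;> exact ⟨_, rfl, rfl⟩
  obtain ⟨X, hX, hv⟩ := hv
  rw [hv]
  exact ⟨⟨X, hX, .refl _⟩, fun q => by rw [Protocol.pending_zero]; exact .nil⟩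

end Closed

end AsyncMPST

/-! ### Session trees, the subtyping of the control, and typing of the session. -/

namespace AsyncMPST

open Participant Label

/-! ## Trees all of whose nodes have a given property -/

/-- All nodes of a tree satisfy `Q` (coinductively). -/
def Tree.All (Q : Node → Prop) (T : Tree) : Prop :=
  ∃ R : Tree → Prop, (∀ X, R X → Q X.dest.1 ∧ ∀ i, R (X.dest.2 i)) ∧ R T

theorem Tree.All.node {Q : Node → Prop} {T : Tree} (h : T.All Q) : Q T.dest.1 := by
  obtain ⟨R, hR, hT⟩ := h
  exact (hR T hT).1

theorem Tree.All.cont {Q : Node → Prop} {T : Tree} (h : T.All Q) (i : T.dest.1.Dir) :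
    Tree.All Q (T.dest.2 i) := by
  obtain ⟨R, hR, hT⟩ := h
  exact ⟨R, hR, (hR T hT).2 i⟩

/-- All choices in a type have nodes that satisfy `Q`. -/
def Ty.All (Q : Node → Prop) : Ty → Prop
  | .ext p I hI S T => Q (.inp p I hI S) ∧ ∀ i, (T i).All Q
  | .int p I hI S T => Q (.out p I hI S) ∧ ∀ i, (T i).All Q
  | .done => True
  | .mu T => T.All Q
  | .var _ => True

theorem Ty.All.rename {Q : Node → Prop} {T : Ty} (h : T.All Q) (ρ : ℕ → ℕ) :
    (T.rename ρ).All Q := by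
  induction T generalizing ρ with
  | ext p I hI S T ih => exact ⟨h.1, fun i => ih i (h.2 i) ρ⟩
  | int p I hI S T ih => exact ⟨h.1, fun i => ih i (h.2 i) ρ⟩
  | done => trivial
  | mu T ih => exact ih h _
  | var t => trivial

theorem Ty.All.subst {Q : Node → Prop} {T : Ty} (h : T.All Q) {σ : ℕ → Ty}
    (hσ : ∀ n, (σ n).All Q) : (T.subst σ).All Q := by
  induction T generalizing σ with
  | ext p I hI S T ih => exact ⟨h.1, fun i => ih i (h.2 i) hσ⟩
  | int p I hI S T ih => exact ⟨h.1, fun i => ih i (h.2 i) hσ⟩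
  | done => trivial
  | mu T ih =>
    refine ih h fun n => ?_
    cases n with
    | zero => trivial
    | succ n => exact (hσ n).rename _
  | var t => exact hσ t

theorem Ty.All.unfoldOnce {Q : Node → Prop} {T : Ty} (h : T.All Q) : T.unfoldOnce.All Q := by
  cases T with
  | mu T =>
    refine Ty.All.subst (T := T) h fun n => ?_
    cases n with
    | zero => exact h
    | succ n => trivial
  | _ => exact h

theorem Ty.All.unfoldHead {Q : Node → Prop} {T : Ty} (h : T.All Q) : T.unfoldHead.All Q := by
  have key : ∀ n (T : Ty), T.All Q → (Ty.unfoldOnce^[n] T).All Q := by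
    intro n
    induction n with
    | zero => exact fun _ h => h
    | succ n ih => exact fun T h => ih _ h.unfoldOnce
  exact key _ _ h

/-- The types of the subtrees of a type have the same property of nodes. -/
theorem Ty.All.step {Q : Node → Prop} (hQ : Q .done) {T : Ty} (h : T.All Q) :
    Q T.step.1 ∧ ∀ i, (T.step.2 i).All Q := by
  have h' := h.unfoldHead
  unfold Ty.step
  generalize T.unfoldHead = U at h'
  cases U with
  | ext => exact h'
  | int => exact h'
  | _ => exact ⟨hQ, fun i => Empty.elim i⟩

theorem Ty.dest_tree (T : Ty) : T.tree.dest = treeSig.map Ty.tree T.step :=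
  PFunctor.M.dest_corec _ _

theorem Ty.All.tree {Q : Node → Prop} (hQ : Q .done) {T : Ty} (h : T.All Q) : T.tree.All Q := by
  refine ⟨fun X => ∃ T : Ty, T.All Q ∧ X = T.tree, ?_, T, h, rfl⟩
  rintro X ⟨T, hT, rfl⟩
  have hs := hT.step hQ
  rw [Ty.dest_tree]
  exact ⟨hs.1, fun i => ⟨_, hs.2 i, rfl⟩⟩

/-- A tree depends only on the unfolded head of its type. For concrete types this head is found by
computation, so a recursive type and its unfolding are seen to have the same tree. -/
theorem Ty.tree_congr {T U : Ty} (h : T.unfoldHead = U.unfoldHead) : T.tree = U.tree := by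
  have hs : T.step = U.step := by
    unfold Ty.step
    rw [h]
  rw [← PFunctor.M.mk_dest T.tree, ← PFunctor.M.mk_dest U.tree, Ty.dest_tree, Ty.dest_tree, hs]

theorem Ty.tree_out1 (p : Participant) (ℓ : Label) (S : Srt) (T : Ty) :
    (Ty.out1 p ℓ S T).tree = Tree.out1 p ℓ S T.tree := by
  rw [← PFunctor.M.mk_dest (Ty.tree _), Ty.dest_tree]
  rfl

theorem Ty.tree_inp1 (p : Participant) (ℓ : Label) (S : Srt) (T : Ty) :
    (Ty.inp1 p ℓ S T).tree = Tree.inp1 p ℓ S T.tree := by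
  rw [← PFunctor.M.mk_dest (Ty.tree _), Ty.dest_tree]
  rfl

/-! ## Trees with singleton choices -/

/-- Selections are singletons and, if `b` holds, branchings are singletons as well. -/
def Node.Single (b : Prop) : Node → Prop
  | .done => True
  | .inp _ I _ _ => b → ∃ ℓ, I = {ℓ}
  | .out _ I _ _ => ∃ ℓ, I = {ℓ}

theorem Tree.out_singleton (p : Participant) (ℓ : Label) (hI : ({ℓ} : Finset Label).Nonempty)
    (S : ({ℓ} : Finset Label) → Srt) (T : ({ℓ} : Finset Label) → Tree)
    (i : ({ℓ} : Finset Label)) : Tree.out p {ℓ} hI S T = Tree.out1 p i.1 (S i) (T i) := by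
  obtain ⟨j, hj⟩ := i
  obtain rfl := Finset.mem_singleton.1 hj
  have hS : S = fun _ => S ⟨j, hj⟩ := funext fun i => by rw [Subsingleton.elim i ⟨j, hj⟩]
  have hT : T = fun _ => T ⟨j, hj⟩ := funext fun i => by rw [Subsingleton.elim i ⟨j, hj⟩]
  rw [hS, hT]
  rfl

theorem Tree.inp_singleton (p : Participant) (ℓ : Label) (hI : ({ℓ} : Finset Label).Nonempty)
    (S : ({ℓ} : Finset Label) → Srt) (T : ({ℓ} : Finset Label) → Tree)
    (i : ({ℓ} : Finset Label)) : Tree.inp p {ℓ} hI S T = Tree.inp1 p i.1 (S i) (T i) := by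
  obtain ⟨j, hj⟩ := i
  obtain rfl := Finset.mem_singleton.1 hj
  have hS : S = fun _ => S ⟨j, hj⟩ := funext fun i => by rw [Subsingleton.elim i ⟨j, hj⟩]
  have hT : T = fun _ => T ⟨j, hj⟩ := funext fun i => by rw [Subsingleton.elim i ⟨j, hj⟩]
  rw [hS, hT]
  rfl

/-- With singleton selections there is nothing to choose; the decomposition relation is then a
bisimulation. -/
theorem Tree.eq_of_mem_SO {b : Prop} {T U : Tree} (hT : T.All (Node.Single b)) (hU : U ∈ T.SO) :
    U = T := by
  obtain ⟨R, hR, hU⟩ := hU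
  refine PFunctor.M.bisim (fun x y : Tree => R y x ∧ y.All (Node.Single b)) ?_ _ _ ⟨hU, hT⟩
  rintro x y ⟨hxy, hy⟩
  cases hR _ _ hxy with
  | done => exact ⟨_, _, _, rfl, rfl, fun i => i.elim⟩
  | out p I hI S T i U h =>
    obtain ⟨ℓ, rfl⟩ := hy.node
    refine ⟨_, _, _, rfl, (congrArg PFunctor.M.dest (Tree.out_singleton p ℓ hI S T i)).trans rfl,
      fun _ => ⟨h, hy.cont i⟩⟩
  | inp p I hI S T U h => exact ⟨_, _, _, rfl, rfl, fun i => ⟨h i, hy.cont i⟩⟩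

theorem Tree.eq_of_mem_SI {T V : Tree} (hT : T.All (Node.Single True)) (hV : V ∈ T.SI) :
    V = T := by
  obtain ⟨R, hR, hV⟩ := hV
  refine PFunctor.M.bisim (fun x y : Tree => R y x ∧ y.All (Node.Single True)) ?_ _ _ ⟨hV, hT⟩
  rintro x y ⟨hxy, hy⟩
  cases hR _ _ hxy with
  | done => exact ⟨_, _, _, rfl, rfl, fun i => i.elim⟩
  | inp p I hI S T i V h =>
    obtain ⟨ℓ, rfl⟩ := hy.node trivial
    refine ⟨_, _, _, rfl, (congrArg PFunctor.M.dest (Tree.inp_singleton p ℓ hI S T i)).trans rfl,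
      fun _ => ⟨h, hy.cont i⟩⟩
  | out p I hI S T V h => exact ⟨_, _, _, rfl, rfl, fun i => ⟨h i, hy.cont i⟩⟩

/-- The decomposition keeps selections, which are singletons already, and cuts every branching down
to one alternative. -/
theorem Tree.all_of_mem_SI {b : Prop} {T V : Tree} (hT : T.All (Node.Single b)) (hV : V ∈ T.SI) :
    V.All (Node.Single True) := by
  obtain ⟨R, hR, hV⟩ := hV
  refine ⟨fun V => ∃ T : Tree, R T V ∧ T.All (Node.Single b), ?_, T, hV, hT⟩
  rintro V ⟨T, hTV, hT⟩
  cases hR _ _ hTV with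
  | done => exact ⟨trivial, fun i => i.elim⟩
  | inp p I hI S T i V h => exact ⟨fun _ => ⟨_, rfl⟩, fun _ => ⟨_, h, hT.cont i⟩⟩
  | out p I hI S T V h => exact ⟨hT.node, fun i => ⟨_, h i, hT.cont i⟩⟩

/-- The possible roots of a tree. -/
theorem Tree.eq_mk (T : Tree) : T = Tree.done ∨
    (∃ p I hI S U, T = Tree.inp p I hI S U) ∨ ∃ p I hI S U, T = Tree.out p I hI S U := by
  rw [← PFunctor.M.mk_dest T]
  obtain ⟨a, U⟩ := T.dest
  cases a with
  | done =>
    obtain rfl : U = fun i => Empty.elim i := funext fun i => Empty.elim i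
    exact .inl rfl
  | inp p I hI S => exact .inr (.inl ⟨p, I, hI, S, U, rfl⟩)
  | out p I hI S => exact .inr (.inr ⟨p, I, hI, S, U, rfl⟩)

theorem Tree.mem_SO_self {T : Tree} (hT : T.All (Node.Single True)) : T ∈ T.SO := by
  refine ⟨fun X Y => X = Y ∧ X.All (Node.Single True), ?_, rfl, hT⟩
  rintro X _ ⟨rfl, hX⟩
  obtain rfl | ⟨p, I, hI, S, U, rfl⟩ | ⟨p, I, hI, S, U, rfl⟩ := X.eq_mk
  · exact .done
  · exact .inp p I hI S U U fun i => ⟨rfl, hX.cont i⟩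
  · obtain ⟨ℓ, rfl⟩ := hX.node
    have i : ({ℓ} : Finset Label) := ⟨ℓ, Finset.mem_singleton_self ℓ⟩
    have h := SOStep.out (R := fun X Y => X = Y ∧ X.All (Node.Single True)) p {ℓ} hI S U i (U i)
      ⟨rfl, hX.cont i⟩
    rwa [← Tree.out_singleton p ℓ hI S U i] at h

theorem Tree.mem_SI_self {T : Tree} (hT : T.All (Node.Single True)) : T ∈ T.SI := by
  refine ⟨fun X Y => X = Y ∧ X.All (Node.Single True), ?_, rfl, hT⟩
  rintro X _ ⟨rfl, hX⟩
  obtain rfl | ⟨p, I, hI, S, U, rfl⟩ | ⟨p, I, hI, S, U, rfl⟩ := X.eq_mk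
  · exact .done
  · obtain ⟨ℓ, rfl⟩ := hX.node trivial
    have i : ({ℓ} : Finset Label) := ⟨ℓ, Finset.mem_singleton_self ℓ⟩
    have h := SIStep.inp (R := fun X Y => X = Y ∧ X.All (Node.Single True)) p {ℓ} hI S U i (U i)
      ⟨rfl, hX.cont i⟩
    rwa [← Tree.inp_singleton p ℓ hI S U i] at h
  · exact .out p I hI S U U fun i => ⟨rfl, hX.cont i⟩

theorem Tree.refines_self {T : Tree} (hT : T.All (Node.Single True)) : T.Refines T := by
  refine ⟨fun X Y => X = Y ∧ X.All (Node.Single True), ?_, rfl, hT⟩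
  rintro X _ ⟨rfl, hX⟩
  obtain rfl | ⟨p, I, hI, S, U, rfl⟩ | ⟨p, I, hI, S, U, rfl⟩ := X.eq_mk
  · exact .refEnd
  · obtain ⟨ℓ, rfl⟩ := hX.node trivial
    have i : ({ℓ} : Finset Label) := ⟨ℓ, Finset.mem_singleton_self ℓ⟩
    have h := hX.cont i
    rw [Tree.inp_singleton p ℓ hI S U i]
    exact .refIn p i.1 _ _ _ _ (.refl _) ⟨rfl, h⟩
  · obtain ⟨ℓ, rfl⟩ := hX.node
    have i : ({ℓ} : Finset Label) := ⟨ℓ, Finset.mem_singleton_self ℓ⟩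
    have h := hX.cont i
    rw [Tree.out_singleton p ℓ hI S U i]
    exact .refOut p i.1 _ _ _ _ (.refl _) ⟨rfl, h⟩

/-- Subtyping is reflexive on single-output trees. -/
theorem Tree.subtype_self {T : Tree} (hT : T.All (Node.Single False)) : T.Subtype T := by
  intro U hU V hV
  obtain rfl := Tree.eq_of_mem_SO hT hU
  have hV' := Tree.all_of_mem_SI hT hV
  -- The branchings kept on the right determine the choice on the left: the same SISO tree serves on
  -- both sides.
  exact ⟨V, hV, V, Tree.mem_SO_self hV', Tree.refines_self hV'⟩

/-- For SISO trees both decompositions are trivial, so the quantifiers in subtyping collapse to a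
single refinement. -/
theorem Tree.Refines.subtype {T T' : Tree} (h : T.Refines T') (hT : T.All (Node.Single True))
    (hT' : T'.All (Node.Single True)) : T.Subtype T' := by
  intro U hU V hV
  obtain rfl := Tree.eq_of_mem_SO hT hU
  obtain rfl := Tree.eq_of_mem_SI hT' hV
  exact ⟨U, Tree.mem_SI_self hT, V, Tree.mem_SO_self hT', h⟩

/-! ## Actions of trees -/

/-- The action of a node, if there is one, belongs to `A`. -/
def Node.ActsIn (A : Set Action) : Node → Prop
  | .done => True
  | .inp p _ _ _ => .recv p ∈ A
  | .out p _ _ _ => .send p ∈ A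

theorem Tree.All.actions_subset {A : Set Action} {T : Tree} (h : T.All (Node.ActsIn A)) :
    T.actions ⊆ A := by
  intro a ha
  induction ha with
  | inp p I hI S T => exact h.node
  | out p I hI S T => exact h.node
  | inpCont a p I hI S T i _ ih => exact ih (h.cont i)
  | outCont a p I hI S T i _ ih => exact ih (h.cont i)

theorem Tree.actions_inp1 (p : Participant) (ℓ : Label) (S : Srt) (W : Tree) :
    (Tree.inp1 p ℓ S W).actions = insert (.recv p) W.actions := by
  ext a
  constructor
  · intro h
    change Tree.Occurs a _ at h
    generalize hX : Tree.inp1 p ℓ S W = X at h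
    cases h with
    | inp q I hI S' T => cases PFunctor.M.mk_inj hX; exact .inl rfl
    | out q I hI S' T => cases PFunctor.M.mk_inj hX
    | inpCont _ q I hI S' T i h => cases PFunctor.M.mk_inj hX; exact .inr h
    | outCont _ q I hI S' T i h => cases PFunctor.M.mk_inj hX
  · rintro (rfl | h)
    · exact .inp ..
    · exact .inpCont _ p {ℓ} _ _ _ ⟨ℓ, Finset.mem_singleton_self ℓ⟩ h

theorem Tree.actions_out1 (p : Participant) (ℓ : Label) (S : Srt) (W : Tree) :
    (Tree.out1 p ℓ S W).actions = insert (.send p) W.actions := by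
  ext a
  constructor
  · intro h
    change Tree.Occurs a _ at h
    generalize hX : Tree.out1 p ℓ S W = X at h
    cases h with
    | inp q I hI S' T => cases PFunctor.M.mk_inj hX
    | out q I hI S' T => cases PFunctor.M.mk_inj hX; exact .inl rfl
    | inpCont _ q I hI S' T i h => cases PFunctor.M.mk_inj hX
    | outCont _ q I hI S' T i h => cases PFunctor.M.mk_inj hX; exact .inr h
  · rintro (rfl | h)
    · exact Tree.Occurs.out ..
    · exact Tree.Occurs.outCont _ p {ℓ} _ _ _ ⟨ℓ, Finset.mem_singleton_self ℓ⟩ h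

/-! ## The optimised control is a subtype of the control -/

/-- The loop of the optimised control. -/
def tyCtlLoop : Ty :=
  .mu (.inp1 src b1 .unit (.inp1 sk b1 .unit (.out1 sk b1 .unit (.out1 src b1 .unit
    (.inp1 src b2 .unit (.inp1 sk b2 .unit (.out1 sk b2 .unit (.out1 src b2 .unit
      (.var 0)))))))))

theorem tyCtl_tree : tyCtl.tree = .out1 src b1 .unit (.inp1 src b1 .unit (.inp1 sk b1 .unit
    (.out1 sk b1 .unit (.out1 src b2 .unit (.inp1 src b2 .unit (.inp1 sk b2 .unit
      (.out1 sk b2 .unit tyCtl.tree))))))) := by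
  simp only [← Ty.tree_out1, ← Ty.tree_inp1]
  exact Ty.tree_congr rfl

theorem tyCtlLoop_tree : tyCtlLoop.tree = .inp1 src b1 .unit (.inp1 sk b1 .unit
    (.out1 sk b1 .unit (.out1 src b1 .unit (.inp1 src b2 .unit (.inp1 sk b2 .unit
      (.out1 sk b2 .unit (.out1 src b2 .unit tyCtlLoop.tree))))))) := by
  simp only [← Ty.tree_out1, ← Ty.tree_inp1]
  exact Ty.tree_congr rfl

theorem tyCtlOpt_tree :
    tyCtlOpt.tree = .out1 src b1 .unit (.out1 src b2 .unit tyCtlLoop.tree) := by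
  simp only [← Ty.tree_out1]
  rfl

/-- The actions of the control. -/
def ctlActions : Set Action := {.recv src, .send src, .recv sk, .send sk}

/-- The upper bound is an invariant of all nodes, checked on the syntax of the type; the lower bound
is visible after one unfolding. -/
theorem tyCtl_actions : tyCtl.tree.actions = ctlActions := by
  refine (Tree.All.actions_subset (Ty.All.tree trivial ?_)).antisymm ?_
  · simp [tyCtl, Ty.All, Ty.out1, Ty.inp1, Node.ActsIn, ctlActions]
  · rw [tyCtl_tree]
    simp [Tree.actions_inp1, Tree.actions_out1, ctlActions, Set.insert_subset_iff]

theorem tyCtlLoop_actions : tyCtlLoop.tree.actions = ctlActions := by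
  refine (Tree.All.actions_subset (Ty.All.tree trivial ?_)).antisymm ?_
  · simp [tyCtlLoop, Ty.All, Ty.out1, Ty.inp1, Node.ActsIn, ctlActions]
  · rw [tyCtlLoop_tree]
    simp [Tree.actions_inp1, Tree.actions_out1, ctlActions, Set.insert_subset_iff]

/-- Pairs of trees, with `K` for the control and `L` for the loop of the optimised control, that
witness the refinement. -/
inductive CtlRel (K L : Tree) : Tree → Tree → Prop
  | start : CtlRel K L (.out1 src b1 .unit (.out1 src b2 .unit L)) K
  | anticipate₂ : CtlRel K L (.out1 src b2 .unit L)
      (.inp1 src b1 .unit (.inp1 sk b1 .unit (.out1 sk b1 .unit (.out1 src b2 .unit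
        (.inp1 src b2 .unit (.inp1 sk b2 .unit (.out1 sk b2 .unit K)))))))
  -- On the right the second output to `src` has been removed, as it is matched already; from here
  -- on the left is one such output ahead.
  | first : CtlRel K L L
      (.inp1 src b1 .unit (.inp1 sk b1 .unit (.out1 sk b1 .unit
        (.inp1 src b2 .unit (.inp1 sk b2 .unit (.out1 sk b2 .unit K))))))
  | first' : CtlRel K L (.inp1 sk b1 .unit (.out1 sk b1 .unit (.out1 src b1 .unit
      (.inp1 src b2 .unit (.inp1 sk b2 .unit (.out1 sk b2 .unit (.out1 src b2 .unit L)))))))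
      (.inp1 sk b1 .unit (.out1 sk b1 .unit
        (.inp1 src b2 .unit (.inp1 sk b2 .unit (.out1 sk b2 .unit K)))))
  | first'' : CtlRel K L (.out1 sk b1 .unit (.out1 src b1 .unit
      (.inp1 src b2 .unit (.inp1 sk b2 .unit (.out1 sk b2 .unit (.out1 src b2 .unit L))))))
      (.out1 sk b1 .unit (.inp1 src b2 .unit (.inp1 sk b2 .unit (.out1 sk b2 .unit K))))
  | anticipate₁ : CtlRel K L (.out1 src b1 .unit
      (.inp1 src b2 .unit (.inp1 sk b2 .unit (.out1 sk b2 .unit (.out1 src b2 .unit L)))))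
      (.inp1 src b2 .unit (.inp1 sk b2 .unit (.out1 sk b2 .unit K)))
  | second : CtlRel K L
      (.inp1 src b2 .unit (.inp1 sk b2 .unit (.out1 sk b2 .unit (.out1 src b2 .unit L))))
      (.inp1 src b2 .unit (.inp1 sk b2 .unit (.out1 sk b2 .unit
        (.inp1 src b1 .unit (.inp1 sk b1 .unit (.out1 sk b1 .unit (.out1 src b2 .unit
          (.inp1 src b2 .unit (.inp1 sk b2 .unit (.out1 sk b2 .unit K))))))))))
  | second' : CtlRel K L
      (.inp1 sk b2 .unit (.out1 sk b2 .unit (.out1 src b2 .unit L)))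
      (.inp1 sk b2 .unit (.out1 sk b2 .unit
        (.inp1 src b1 .unit (.inp1 sk b1 .unit (.out1 sk b1 .unit (.out1 src b2 .unit
          (.inp1 src b2 .unit (.inp1 sk b2 .unit (.out1 sk b2 .unit K)))))))))
  | second'' : CtlRel K L
      (.out1 sk b2 .unit (.out1 src b2 .unit L))
      (.out1 sk b2 .unit
        (.inp1 src b1 .unit (.inp1 sk b1 .unit (.out1 sk b1 .unit (.out1 src b2 .unit
          (.inp1 src b2 .unit (.inp1 sk b2 .unit (.out1 sk b2 .unit K))))))))

theorem isBCtx_sk (ℓ : Label) :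
    IsBCtx src [.inp src ℓ .unit, .inp sk ℓ .unit, .out sk ℓ .unit] :=
  ⟨by simp, by simp⟩

/-- The pairs form a cycle: after `start`, each leads to the next, and `second''` returns to
`anticipate₂`. With `K` and `L` as variables, their fixed-point equations are used only at the
positions that need an unfolding. -/
theorem CtlRel.step {K L : Tree}
    (hK : K = .out1 src b1 .unit (.inp1 src b1 .unit (.inp1 sk b1 .unit
      (.out1 sk b1 .unit (.out1 src b2 .unit (.inp1 src b2 .unit (.inp1 sk b2 .unit
        (.out1 sk b2 .unit K))))))))
    (hL : L = .inp1 src b1 .unit (.inp1 sk b1 .unit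
      (.out1 sk b1 .unit (.out1 src b1 .unit (.inp1 src b2 .unit (.inp1 sk b2 .unit
        (.out1 sk b2 .unit (.out1 src b2 .unit L))))))))
    (hKa : K.actions = ctlActions) (hLa : L.actions = ctlActions) {X Y : Tree}
    (h : CtlRel K L X Y) : RefStep (CtlRel K L) X Y := by
  have hu : Srt.Le .unit .unit := .refl _
  cases h with
  | start =>
    refine (congrArg (RefStep (CtlRel K L) _) hK).mpr ?_
    exact .refOut _ _ _ _ _ _ hu .anticipate₂
  | anticipate₂ =>
    -- The output is moved across one input from `src`, one input from `sk` and one output to `sk`;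
    -- none of these is an output to `src`, so the prefix is admissible.
    refine .refB src b2 .unit .unit L
      (.inp1 src b2 .unit (.inp1 sk b2 .unit (.out1 sk b2 .unit K))) _ (isBCtx_sk b1) hu .first ?_
    simp [Tree.prepend, Tree.actions_inp1, Tree.actions_out1, hKa, hLa, ctlActions]
  | first =>
    refine (congrArg (fun X => RefStep (CtlRel K L) X _) hL).mpr ?_
    exact .refIn _ _ _ _ _ _ hu .first'
  | first' => exact .refIn _ _ _ _ _ _ hu .first''
  | first'' => exact .refOut _ _ _ _ _ _ hu .anticipate₁
  | anticipate₁ =>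
    -- The output to match belongs to the next iteration of the ordinary control, so its tree is
    -- unfolded once, behind the rest of the current one.
    refine (congrArg (fun Z => RefStep (CtlRel K L) _ (.inp1 src b2 .unit (.inp1 sk b2 .unit
      (.out1 sk b2 .unit Z)))) hK).mpr ?_
    refine .refB src b1 .unit .unit _ (.inp1 src b1 .unit (.inp1 sk b1 .unit (.out1 sk b1 .unit
      (.out1 src b2 .unit (.inp1 src b2 .unit (.inp1 sk b2 .unit (.out1 sk b2 .unit K)))))))
      _ (isBCtx_sk b2) hu .second ?_
    simp [Tree.prepend, Tree.actions_inp1, Tree.actions_out1, hKa, hLa, ctlActions]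
  | second => exact .refIn _ _ _ _ _ _ hu .second'
  | second' => exact .refIn _ _ _ _ _ _ hu .second''
  | second'' => exact .refOut _ _ _ _ _ _ hu .anticipate₂

theorem tyCtlOpt_subtype_tyCtl : tyCtlOpt.Subtype tyCtl := by
  refine Tree.Refines.subtype ⟨CtlRel tyCtl.tree tyCtlLoop.tree, fun X Y h =>
    h.step tyCtl_tree tyCtlLoop_tree tyCtl_actions tyCtlLoop_actions, ?_⟩
    (Ty.All.tree trivial ?_) (Ty.All.tree trivial ?_)
  · rw [tyCtlOpt_tree]
    exact .start
  · simp [tyCtlOpt, Ty.All, Ty.out1, Ty.inp1, Node.Single]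
  · simp [tyCtl, Ty.All, Ty.out1, Ty.inp1, Node.Single]

/-! ## Typing of the session -/

theorem Typed.ext1 {Θ : List Srt} {Ξ : List Ty} {P : Proc} {S : Srt} {T : Ty} (q : Participant)
    (ℓ : Label) (h : Typed (S :: Θ) Ξ P T) : Typed Θ Ξ (.ext1 q ℓ P) (.inp1 q ℓ S T) :=
  .ext q {ℓ} _ _ fun _ => h

/-- A process of the unfolded type is one of the folded type. -/
theorem Typed.fold {Θ : List Srt} {Ξ : List Ty} {P : Proc} {T U : Ty} (h : Typed Θ Ξ P U)
    (hU : U.unfoldHead = T.unfoldHead) (hWF : T.WF) (hT : T.All (Node.Single False)) :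
    Typed Θ Ξ P T := by
  refine .sub h hWF ?_
  rw [Ty.Subtype, Ty.tree_congr hU]
  exact Tree.subtype_self (hT.tree trivial)

theorem tyBp_wf (S : Srt) : (tyBp S).WF := by
  simp [Ty.WF, tyBp, Ty.ClosedAt, Ty.Guarded, Ty.out1, Ty.inp1]

theorem tySrc_wf (S : Srt) : (tySrc S).WF := by
  simp only [Ty.WF, tySrc, Ty.ClosedAt, Ty.Guarded]
  refine ⟨fun i => ?_, fun t => by simp, fun i => ?_⟩ <;> split_ifs <;>
    simp [Ty.ClosedAt, Ty.Guarded, Ty.out1]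

theorem tySk_wf (S : Srt) : (tySk S).WF := by
  simp [Ty.WF, tySk, Ty.ClosedAt, Ty.Guarded, Ty.out1, Ty.inp1]

theorem tyCtl_wf : tyCtl.WF := by
  simp [Ty.WF, tyCtl, Ty.ClosedAt, Ty.Guarded, Ty.out1, Ty.inp1]

theorem tyCtlLoop_wf : tyCtlLoop.WF := by
  simp [Ty.WF, tyCtlLoop, Ty.ClosedAt, Ty.Guarded, Ty.out1, Ty.inp1]

section Typing

variable {S : Srt} {f datum : Expr}

theorem HasSort.weaken {Θ : List Srt} {e : Expr} {T : Srt} (h : HasSort Θ e T) (Θ' : List Srt) :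
    HasSort (Θ ++ Θ') e T := by
  have := h.subst (Θ' := Θ ++ Θ') (σ := Expr.var) fun x U hx => .var _ _ _ (by
    obtain ⟨hlt, -⟩ := List.getElem?_eq_some_iff.1 hx
    rwa [List.getElem?_append_left hlt])
  rwa [Expr.subst_var] at this

/-- The recursion rule wants the body at the recursive type itself, whereas the constructors yield
its unfolding; `Typed.fold` bridges the two by subsumption. -/
theorem prBp_typed (hf : HasSort [S] f S) : Typed [] [] (prBp f) (tyBp S) := by
  refine .mu (tyBp_wf S) trivial (Typed.fold (U := .inp1 src data S (.out1 sk data S (tyBp S)))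
    (.ext1 _ _ (.out _ _ hf (.var _ _ _ _ rfl))) rfl (tyBp_wf S) ?_)
  simp [tyBp, Ty.All, Ty.out1, Ty.inp1, Node.Single]

theorem prSrc_typed (hd : HasSort [] datum S) : Typed [] [] (prSrc datum) (tySrc S) := by
  refine .mu (tySrc_wf S) trivial (Typed.fold (U := .ext ctl {b1, b2} (Finset.insert_nonempty _ _)
    (fun _ => .unit) (fun i =>
      if i.1 = b1 then .out1 ctl b1 .unit (.out1 bp1 data S (tySrc S))
      else .out1 ctl b2 .unit (.out1 bp2 data S (tySrc S)))) (.ext _ _ _ _ fun i => ?_)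
      ?_ (tySrc_wf S) ?_)
  · split_ifs
    · exact .out _ _ (.unit _) (.out _ _ (hd.weaken [_]) (.var _ _ _ _ rfl))
    · exact .out _ _ (.unit _) (.out _ _ (hd.weaken [_]) (.var _ _ _ _ rfl))
  · rw [← tySrc_inst]
    rfl
  -- The branching of the source has two alternatives; reflexivity of subtyping only needs its
  -- selections to be singletons.
  · refine ⟨False.elim, fun i => ?_⟩
    beta_reduce
    split_ifs <;> simp [Ty.All, Ty.out1, Node.Single]

theorem prSk_typed : Typed [] [] prSk (tySk S) := by
  refine .mu (tySk_wf S) trivial (Typed.fold (U := .out1 ctl b1 .unit (tySkAt S 1))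
    (.out _ _ (.unit _) (.ext1 _ _ (.ext1 _ _ (.out _ _ (.unit _) (.ext1 _ _ (.ext1 _ _
      (.var _ _ _ _ rfl))))))) rfl (tySk_wf S) ?_)
  simp [tySk, Ty.All, Ty.out1, Ty.inp1, Node.Single]

theorem prCtlLoop_typed : Typed [] [] prCtlLoop tyCtlLoop := by
  refine .mu tyCtlLoop_wf trivial (Typed.fold (U := .inp1 src b1 .unit (.inp1 sk b1 .unit
    (.out1 sk b1 .unit (.out1 src b1 .unit (.inp1 src b2 .unit (.inp1 sk b2 .unit
      (.out1 sk b2 .unit (.out1 src b2 .unit tyCtlLoop))))))))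
    (.ext1 _ _ (.ext1 _ _ (.out _ _ (.unit _) (.out _ _ (.unit _) (.ext1 _ _ (.ext1 _ _
      (.out _ _ (.unit _) (.out _ _ (.unit _) (.var _ _ _ _ rfl))))))))) rfl tyCtlLoop_wf ?_)
  simp [tyCtlLoop, Ty.All, Ty.out1, Ty.inp1, Node.Single]

/-- The process has the optimised type by syntax; the subtyping of part (1) then gives it the type
that the environment records. -/
theorem prCtl_typed : Typed [] [] prCtl tyCtl :=
  .sub (.out _ _ (.unit _) (.out _ _ (.unit _) prCtlLoop_typed)) tyCtl_wf tyCtlOpt_subtype_tyCtl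

theorem batchSess_typed (hf : HasSort [S] f S) (hd : HasSort [] datum S) :
    SessTyped (batchEnv S) (batchSess f datum) := by
  refine ⟨by simp [batchSess, Sess.NoError], by simp [batchSess, Sess.WF, Sess.comps],
    fun p => ?_, fun c hc => ?_⟩
  · cases p <;> simp [batchEnv, batchSess, Sess.comps]
  · simp only [batchSess, Sess.comps, List.cons_append, List.nil_append, List.mem_cons,
      List.not_mem_nil, or_false] at hc
    obtain rfl | rfl | rfl | rfl | rfl := hc
    · exact ⟨[], tyBp S, rfl, prBp_typed hf, .nil⟩
    · exact ⟨[], tyBp S, rfl, prBp_typed hf, .nil⟩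
    · exact ⟨[], tySrc S, rfl, prSrc_typed hd, .nil⟩
    · exact ⟨[], tyCtl, rfl, prCtl_typed, .nil⟩
    · exact ⟨[], tySk S, rfl, prSk_typed, .nil⟩

end Typing

end AsyncMPST

theorem mainTheorem11 (S : AsyncMPST.Srt) (f datum : AsyncMPST.Expr)
    (hf : AsyncMPST.HasSort [S] f S) (hdatum : AsyncMPST.HasSort [] datum S) :
    AsyncMPST.Ty.Subtype AsyncMPST.tyCtlOpt AsyncMPST.tyCtl ∧
      AsyncMPST.Env.Live (AsyncMPST.batchEnv S) ∧
      AsyncMPST.SessTyped (AsyncMPST.batchEnv S) (AsyncMPST.batchSess f datum) ∧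
      ¬ Relation.ReflTransGen AsyncMPST.Sess.Red (AsyncMPST.batchSess f datum)
          AsyncMPST.Sess.error := by
  exact ⟨AsyncMPST.tyCtlOpt_subtype_tyCtl, AsyncMPST.batchEnv_live S,
    AsyncMPST.batchSess_typed hf hdatum, AsyncMPST.batchSess_not_red_error hf hdatum⟩
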